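/- Let $V=\mathbb R^4$, let $\mathbb S^3=(V\setminus\{0\})/\mathbb R_{+}$ be the projective sphere, and let $\mathrm{SL}_\pm(4,\mathbb R)$ be the group of linear automorphisms of $V$ of determinant $\pm1$. Let $\mathcal G$ be the labeled combinatorial 3-polytope with six facets $\mathcal G_1,\dots,\mathcal G_6$ and six vertices, the vertices lying exactly on the facets with index sets $$\{1,3,4\},\ \{1,2,4,6\},\ \{1,2,3\},\ \{3,4,5\},\ \{4,5,6\},\ \{2,3,5,6\},$$ whose edges $\mathcal G_i\cap\mathcal G_j$ carry the labels $$m_{12}=m_{13}=m_{14}=m_{23}=m_{26}=m_{46}=m_{56}=2,\qquad m_{34}=m_{35}=m_{45}=3$$ (the other pairs of facets are not adjacent). *Definitions.* A realization of $\mathcal G$ is a tuple $(p_v)$ of points of $\mathbb S^3$, indexed by the vertices of $\mathcal G$, such that $\operatorname{conv}\{p_v\}$ is a convex 3-polytope combinatorially equivalent to $\mathcal G$, and for each set $F$ of vertices $\operatorname{conv}\{p_v: v\in F\}$ is a face of it if and only if $F$ is the vertex set of a face of $\mathcal G$ of the same dimension. The realization space $\mathcal{RS}(\mathcal G)$ is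 the space of realizations (a subspace of $(\mathbb S^3)^6$) modulo $\mathrm{SL}_\pm(4,\mathbb R)$. A Coxeter polytope realizing $\mathcal G$ is a tuple $(P,r_1,\dots,r_6)$ in which $P\subset\mathbb S^3$ is a convex 3-polytope combinatorially equivalent to $\mathcal G$, with facets $P_i$ corresponding to $\mathcal G_i$; $r_i\in\mathrm{SL}_\pm(4,\mathbb R)$ is a linear reflection in the hyperplane supporting $P_i$; $r_ir_j$ has order $m_{ij}$ whenever $\mathcal G_i,\mathcal G_j$ are adjacent; and $\operatorname{Int}P\cap\gamma\operatorname{Int}P=\varnothing$ for all $\gamma\ne1$ in the group generated by $r_1,\dots,r_6$. The deformation space $\mathcal C(\mathcal G)$ is the set of Coxeter polytopes realizing $\mathcal G$ modulo $g\cdot(P,r_i)=(gP,gr_ig^{-1})$, $g\in\mathrm{SL}_\pm(4,\mathbb R)$. Writing $r_i=\mathrm{Id}-\alpha_i\otimes v_i$ with $\alpha_i(v_i)=2$ and $\alpha_i\ge0$ on $P$ defines a map $$\mathcal C(\mathcal G)\to\big((V^*)^6\times V^6\big)/\big(\mathrm{SL}_\pm(4,\mathbb R)\times\mathbb R_+^6\big),\qquad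 [(P,r_1,\dots,r_6)]\mapsto[(\alpha,v)],$$ where $(A,c)\cdot(\alpha,v)=(c_i^{-1}\alpha_i\circ A^{-1},\,c_iAv_i)_i$, and $\mathcal C(\mathcal G)$ has the topology induced by this map. For a convex polytope $Q$, the restricted deformation space $\mathcal C_Q(\mathcal G)\subset\mathcal C(\mathcal G)$ consists of the classes $[(P,r_1,\dots,r_6)]$ with $P=A(Q)$ for some $A\in\mathrm{SL}_\pm(4,\mathbb R)$. The projection $\mathcal C(\mathcal G)\to\mathcal{RS}(\mathcal G)$ sends $[(P,r_1,\dots,r_6)]$ to the class of the tuple $(p_v)$ of vertices of $P$, indexed so that $r_j$ fixes $p_v$ if and only if $v\in\mathcal G_j$. For $d>1$ put $\beta_i=e_i^*$ for $1\le i\le4$, $$\beta_5=-e_1^*+e_2^*+e_3^*+e_4^*,\qquad \beta_6^d=-e_1^*+d\,e_2^*+e_4^*,$$ and let $P_d=\{[y]\in\mathbb S^3:\beta_i(y)\ge0\ (1\le i\le5),\ \beta_6^d(y)\ge0\}$. *Statement.* The polytope $\mathcal G$ has $f=6$ facets, $e=10$ edges and $e_2=7$ edges of order $2$, and it is orderable: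 its facets can be totally ordered so that each of them has at most three edges that are of order $2$ or shared with a preceding facet. Moreover: 1. For each $d>1$ there is a realization $(p_v)$ of $\mathcal G$ with $\operatorname{conv}\{p_v\}=P_d$ in which $p_v$ lies on the hyperplane of the $i$-th functional if and only if $v\in\mathcal G_i$. The map sending $d$ to its class is a homeomorphism $(1,\infty)\to\mathcal{RS}(\mathcal G)$. 2. The projection $\mathcal C(\mathcal G)\to\mathcal{RS}(\mathcal G)$ is well defined, and for each $d>1$ its fiber over the point with parameter $d$ is the restricted deformation space $\mathcal C_{P_d}(\mathcal G)$. 3. For $d>1$, the space $\mathcal C_{P_d}(\mathcal G)$ is nonempty if and only if $d<\frac43$. 4. For $1<d<\frac43$ one has $\frac d{2-2d}<-2$, and $\mathcal C_{P_d}(\mathcal G)$ is homeomorphic to the open interval $\frac{d}{2-2d}<x<-2$, via the map sending $x$ to the class of $P_d$ with the reflections $r_i=\mathrm{Id}-\beta_i\otimes w_i$ (where $\beta_6=\beta_6^d$) given by $$w_1=(2,0,0,0),\quad w_2=(0,2,0,-2d),\quad w_3=(0,0,2,x),\quad w_4=\Big(0,-\tfrac2d,\tfrac1x,2\Big),\quad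 w_6=(-2,0,-2,0),$$ $$w_5=\left(\frac{d\left(\frac1{x+2}-2\right)}{d-1}+\frac1{-\frac2d+\frac1x+2},\ \frac{\frac1{x+2}-2}{d-1},\ \frac1{x+2},\ \frac1{-\frac2d+\frac1x+2}\right).$$ 5. $\mathcal C(\mathcal G)$ is homeomorphic to $\mathbb R^2$. -/

import Mathlib

open scoped Pointwise

noncomputable section

namespace CoxDef

/-! ### The projective sphere and its group of automorphisms -/

/-- The vector space `ℝ⁴`. -/
abbrev V : Type := Fin 4 → ℝ

/-- The projective sphere `𝕊³`: nonzero vectors of `ℝ⁴` up to positive scaling. -/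
abbrev S3 : Type := Module.Ray ℝ V

/-- The quotient topology on `𝕊³`. -/
instance : TopologicalSpace S3 :=
  TopologicalSpace.coinduced (fun x : {x : V // x ≠ 0} => rayOfNeZero ℝ x.1 x.2) inferInstance

/-- `SL±(4, ℝ)`: linear automorphisms of `ℝ⁴` of determinant `±1`. -/
def SLpm : Subgroup (V ≃ₗ[ℝ] V) where
  carrier := {g | |LinearMap.det (g : V →ₗ[ℝ] V)| = 1}
  one_mem' := by
    change |LinearMap.det (LinearMap.id : V →ₗ[ℝ] V)| = 1
    simp
  mul_mem' := by
    intro a b ha hb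
    simp only [Set.mem_ofPred_eq] at ha hb ⊢
    change |LinearMap.det ((a : V →ₗ[ℝ] V) * (b : V →ₗ[ℝ] V))| = 1
    rw [map_mul, abs_mul, ha, hb, one_mul]
  inv_mem' := by
    intro a ha
    simp only [Set.mem_ofPred_eq] at ha ⊢
    have h := congrArg abs (LinearEquiv.det_symm_mul_det a)
    rw [abs_mul, ha, mul_one, abs_one] at h
    exact h

/-- The image in `𝕊³` of a set of vectors. -/
def sph (A : Set V) : Set S3 := {p | ∃ (x : V) (hx : x ≠ 0), x ∈ A ∧ rayOfNeZero ℝ x hx = p}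

/-- The set of (nonzero) vectors representing the points of a subset of `𝕊³`. -/
def coneOver (C : Set S3) : Set V := {x | ∃ hx : x ≠ 0, rayOfNeZero ℝ x hx ∈ C}

/-- The affine chart `{[x] | α x > 0}`. -/
def chart (α : StrongDual ℝ V) : Set S3 := sph {x | 0 < α x}

/-- The part of `C` in the chart of `α`, where the chart is identified with the affine hyperplane
`{x | α x = 1}` of `ℝ⁴`. -/
def inChart (α : StrongDual ℝ V) (C : Set S3) : Set V := {x | α x = 1 ∧ x ∈ coneOver C}

/-- A subset of `𝕊³` is properly convex if it is convex (in an affine chart) and its closure is a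
convex bounded subset of an affine chart. -/
def IsProperlyConvex (C : Set S3) : Prop :=
  (∃ α : StrongDual ℝ V, α ≠ 0 ∧ C ⊆ chart α ∧ Convex ℝ (inChart α C)) ∧
  ∃ α : StrongDual ℝ V, α ≠ 0 ∧ closure C ⊆ chart α ∧ Convex ℝ (inChart α (closure C)) ∧
    Bornology.IsBounded (inChart α (closure C))

/-- A convex 3-polytope in `𝕊³`: a properly convex set with nonempty interior which is defined by
finitely many linear inequalities. -/
def IsConvexPolytope (P : Set S3) : Prop :=
  IsProperlyConvex P ∧ (interior P).Nonempty ∧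
  ∃ (k : ℕ) (α : Fin k → StrongDual ℝ V), (∀ i, α i ≠ 0) ∧ P = sph {x | ∀ i, 0 ≤ α i x}

/-- The convex hull of a subset of `𝕊³`. -/
def convHull (A : Set S3) : Set S3 := sph (convexHull ℝ (coneOver A))

/-- The nonempty faces of `P` (including `P` itself): intersections of `P` with `{α = 0}`, where
`α ≥ 0` on `P`. -/
def IsFace (P F : Set S3) : Prop :=
  F.Nonempty ∧ ∃ α : StrongDual ℝ V, P ⊆ sph {x | 0 ≤ α x} ∧ F = P ∩ sph {x | α x = 0}

/-- The face lattice of `P`, ordered by inclusion. -/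
abbrev FaceLattice (P : Set S3) : Type := {F : Set S3 // IsFace P F}

/-- `F` spans a projective subspace of dimension `k`. -/
def HasDim (F : Set S3) (k : ℕ) : Prop :=
  Module.finrank ℝ (Submodule.span ℝ (coneOver F)) = k + 1

/-! ### Labeled combinatorial polytopes -/

/-- Combinatorial data of a labeled 3-polytope with `n` vertices and `f` facets: the vertex sets of
the facets and the integer labels of the edges. Two facets are adjacent when they share exactly two
vertices, and the edges are the intersections of adjacent facets. The value of `label i j` is
meaningful only if the facets `i` and `j` are adjacent. -/
structure LabeledPolytope (n f : ℕ) where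
  facet : Fin f → Finset (Fin n)
  label : Fin f → Fin f → ℕ
  label_symm : ∀ i j, label i j = label j i
  two_le_label : ∀ i j, i ≠ j → (facet i ∩ facet j).card = 2 → 2 ≤ label i j

namespace LabeledPolytope

variable {n f : ℕ} (G : LabeledPolytope n f)

/-- Adjacency of facets. -/
def Adj (i j : Fin f) : Prop := i ≠ j ∧ (G.facet i ∩ G.facet j).card = 2

instance : DecidableRel G.Adj := fun _ _ => inferInstanceAs (Decidable (_ ∧ _))

/-- The edges, each given by the pair of adjacent facets `i < j` containing it. -/
def edges : Finset (Fin f × Fin f) := {p | p.1 < p.2 ∧ G.Adj p.1 p.2}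

/-- The edges of order 2. -/
def edgesOrderTwo : Finset (Fin f × Fin f) := {p ∈ G.edges | G.label p.1 p.2 = 2}

/-- Orderability: the facets can be totally ordered (`σ i` is the position of the facet `i`) so that
each facet has at most three edges which are of order 2 or shared with a preceding facet. -/
def Orderable : Prop :=
  ∃ σ : Equiv.Perm (Fin f), ∀ i : Fin f,
    (Finset.univ.filter fun j => G.Adj i j ∧ (G.label i j = 2 ∨ σ j < σ i)).card ≤ 3

/-- `S` is the vertex set of a face of dimension `k`. -/
def IsFaceOfDim (S : Finset (Fin n)) : ℕ → Prop
  | 0 => ∃ v, S = {v}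
  | 1 => ∃ i j, G.Adj i j ∧ S = G.facet i ∩ G.facet j
  | 2 => ∃ i, S = G.facet i
  | 3 => S = Finset.univ
  | _ => False

/-- The face lattice of the combinatorial polytope: vertex sets of faces, ordered by inclusion. -/
abbrev FL : Type := {S : Finset (Fin n) // ∃ k, G.IsFaceOfDim S k}

/-- The facets as elements of the face lattice. -/
def facetFace (i : Fin f) : G.FL := ⟨G.facet i, 2, i, rfl⟩

end LabeledPolytope

variable {n f : ℕ}

/-! ### Deformation spaces -/

/-- `r` is the linear reflection `x ↦ x - α(x) v`, where `α(v) = 2` and `α ≥ 0` on `P`. -/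
def IsReflectionWith (P : Set S3) (r : SLpm) (α : StrongDual ℝ V) (v : V) : Prop :=
  α v = 2 ∧ P ⊆ sph {x | 0 ≤ α x} ∧ ∀ x : V, (r : V ≃ₗ[ℝ] V) x = x - α x • v

/-- A Coxeter 3-polytope realizing `G`. -/
structure CoxeterPolytope (G : LabeledPolytope n f) where
  P : Set S3
  r : Fin f → SLpm
  isConvexPolytope : IsConvexPolytope P
  /-- `P` is combinatorially equivalent to `G`, and `r i` is a reflection in the hyperplane supporting
  the facet of `P` corresponding to the `i`-th facet of `G`. -/
  exists_iso : ∃ φ : G.FL ≃o FaceLattice P, ∀ i, ∃ α v, IsReflectionWith P (r i) α v ∧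
    (φ (G.facetFace i) : Set S3) = P ∩ sph {x | α x = 0}
  orderOf_mul : ∀ i j, G.Adj i j → orderOf (r i * r j) = G.label i j
  disjoint_interior : ∀ γ ∈ Subgroup.closure (Set.range r), γ ≠ 1 →
    Disjoint (interior P) (γ • interior P)

/-- The orbit equivalence relation of `SL±(4, ℝ)` on Coxeter polytopes, where
`g · (P, r₁, …) = (g P, g r₁ g⁻¹, …)`. -/
def coxeterSetoid (G : LabeledPolytope n f) : Setoid (CoxeterPolytope G) where
  r X Y := ∃ g : SLpm, Y.P = g • X.P ∧ ∀ i, Y.r i = g * X.r i * g⁻¹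
  iseqv :=
    { refl := fun X => ⟨1, by simp, fun i => by simp⟩
      symm := by
        rintro X Y ⟨g, h, h'⟩
        refine ⟨g⁻¹, by rw [h, inv_smul_smul], fun i => ?_⟩
        rw [h' i]; group
      trans := by
        rintro X Y Z ⟨g, h, h'⟩ ⟨k, hk, hk'⟩
        refine ⟨k * g, by rw [hk, h, mul_smul], fun i => ?_⟩
        rw [hk' i, h' i]; group }

/-- The deformation space `𝒞(G)`. -/
def DefSpace (G : LabeledPolytope n f) : Type := Quotient (coxeterSetoid G)

/-- The class in `𝒞(G)` of a Coxeter polytope. -/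
def DefSpace.mk {G : LabeledPolytope n f} (X : CoxeterPolytope G) : DefSpace G :=
  Quotient.mk (coxeterSetoid G) X

/-- The space `(V*)^f × V^f`. -/
abbrev Pairs (f : ℕ) : Type := (Fin f → StrongDual ℝ V) × (Fin f → V)

/-- The orbit equivalence relation of the action of `SL±(4, ℝ) × ℝ₊^f` on `(V*)^f × V^f` given by
`(A, c) · (α, v) = (c⁻¹ α ∘ A⁻¹, c A v)`. -/
def pairSetoid (f : ℕ) : Setoid (Pairs f) where
  r p q := ∃ (A : SLpm) (c : Fin f → ℝ), (∀ i, 0 < c i) ∧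
    (∀ i x, q.1 i x = (c i)⁻¹ * p.1 i (A⁻¹ • x)) ∧ ∀ i, q.2 i = c i • A • p.2 i
  iseqv :=
    { refl := fun p => ⟨1, fun _ => 1, by simp, by simp, by simp⟩
      symm := by
        rintro p q ⟨A, c, hc, h1, h2⟩
        refine ⟨A⁻¹, fun i => (c i)⁻¹, fun i => inv_pos.2 (hc i), fun i x => ?_, fun i => ?_⟩
        · have := (hc i).ne'
          rw [h1]
          simp [this]
        · have := (hc i).ne'
          rw [h2, smul_comm (A⁻¹) (c i), inv_smul_smul, smul_smul, inv_mul_cancel₀ this, one_smul]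
      trans := by
        rintro p q s ⟨A, c, hc, h1, h2⟩ ⟨B, d, hd, k1, k2⟩
        refine ⟨B * A, fun i => d i * c i, fun i => mul_pos (hd i) (hc i), fun i x => ?_,
          fun i => ?_⟩
        · rw [k1, h1, mul_inv, mul_inv_rev, mul_smul]; ring
        · rw [k2, h2, smul_comm B (c i), smul_smul, ← mul_smul B A] }

theorem CoxeterPolytope.exists_functionals {G : LabeledPolytope n f} (X : CoxeterPolytope G) :
    ∃ p : Pairs f, ∀ i, IsReflectionWith X.P (X.r i) (p.1 i) (p.2 i) := by
  obtain ⟨φ, h⟩ := X.exists_iso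
  choose α v h using h
  exact ⟨(α, v), fun i => (h i).1⟩

/-- Functionals `αᵢ` and vectors `vᵢ` with `rᵢ = Id - αᵢ ⊗ vᵢ`, `αᵢ(vᵢ) = 2` and `αᵢ ≥ 0` on `P`. -/
def CoxeterPolytope.functionals {G : LabeledPolytope n f} (X : CoxeterPolytope G) : Pairs f :=
  X.exists_functionals.choose

theorem CoxeterPolytope.functionals_spec {G : LabeledPolytope n f} (X : CoxeterPolytope G)
    (i : Fin f) : IsReflectionWith X.P (X.r i) (X.functionals.1 i) (X.functionals.2 i) :=
  X.exists_functionals.choose_spec i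

theorem mem_sph_iff {A : Set V} (hA : ∀ (x : V) (t : ℝ), 0 < t → x ∈ A → t • x ∈ A) {x : V}
    (hx : x ≠ 0) : rayOfNeZero ℝ x hx ∈ sph A ↔ x ∈ A := by
  constructor
  · rintro ⟨y, hy, hyA, h⟩
    rw [ray_eq_iff] at h
    obtain ⟨a, b, ha, hb, hab⟩ := h.exists_pos hy hx
    have : x = (b⁻¹ * a) • y := by
      rw [mul_smul, hab, smul_smul, inv_mul_cancel₀ hb.ne', one_smul]
    rw [this]
    exact hA y _ (by positivity) hyA
  · intro h
    exact ⟨x, hx, h, rfl⟩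

theorem nonneg_of_mem {α : StrongDual ℝ V} {x : V} (hx : x ≠ 0)
    (h : rayOfNeZero ℝ x hx ∈ sph {x | 0 ≤ α x}) : 0 ≤ α x := by
  refine (mem_sph_iff (A := {x | 0 ≤ α x}) ?_ hx).1 h
  intro y t ht hy
  simp only [Set.mem_ofPred_eq, map_smul, smul_eq_mul] at hy ⊢
  positivity

/-- A set with nonempty interior contains a point at which a given functional does not vanish. -/
theorem exists_mem_ne_zero {P : Set S3} (hP : (interior P).Nonempty) (α : StrongDual ℝ V) {v : V}
    (hv : α v ≠ 0) : ∃ (x : V) (hx : x ≠ 0), rayOfNeZero ℝ x hx ∈ P ∧ α x ≠ 0 := by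
  obtain ⟨p, hp⟩ := hP
  induction p using Module.Ray.ind with
  | h x hx =>
  by_cases hαx : α x = 0
  · have hopen : IsOpen ((fun x : {x : V // x ≠ 0} => rayOfNeZero ℝ x.1 x.2) ⁻¹' interior P) :=
      isOpen_coinduced.1 isOpen_interior
    obtain ⟨U, hU, hUeq⟩ := isOpen_induced_iff.1 hopen
    have hxU : x ∈ U := by
      have : (⟨x, hx⟩ : {x : V // x ≠ 0}) ∈ Subtype.val ⁻¹' U := by rw [hUeq]; exact hp
      exact this
    have hc : Continuous fun t : ℝ => x + t • v := by fun_prop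
    have h0 : (0 : ℝ) ∈ (fun t : ℝ => x + t • v) ⁻¹' U := by simpa using hxU
    obtain ⟨ε, hε, hball⟩ := Metric.isOpen_iff.1 (hU.preimage hc) 0 h0
    have hmem : x + (ε / 2) • v ∈ U := by
      refine hball (?_ : ε / 2 ∈ Metric.ball (0 : ℝ) ε)
      rw [Metric.mem_ball, dist_zero_right, Real.norm_eq_abs, abs_of_pos (by positivity)]
      linarith
    have hα : α (x + (ε / 2) • v) ≠ 0 := by
      simp only [map_add, map_smul, hαx, zero_add, smul_eq_mul]
      exact mul_ne_zero (by positivity) hv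
    have hne : x + (ε / 2) • v ≠ 0 := by
      intro h; rw [h] at hα; exact hα (map_zero α)
    refine ⟨_, hne, interior_subset ?_, hα⟩
    have : (⟨_, hne⟩ : {x : V // x ≠ 0}) ∈ Subtype.val ⁻¹' U := hmem
    rw [hUeq] at this
    exact this
  · exact ⟨x, hx, interior_subset hp, hαx⟩

theorem functionals_equiv {G : LabeledPolytope n f} {X Y : CoxeterPolytope G}
    (h : coxeterSetoid G X Y) : pairSetoid f X.functionals Y.functionals := by
  obtain ⟨g, hP, hr⟩ := h
  set α := X.functionals.1
  set v := X.functionals.2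
  set α' := Y.functionals.1
  set v' := Y.functionals.2
  have key : ∀ i, ∃ k : ℝ, 0 < k ∧ (∀ x, α' i x = k * α i (g⁻¹ • x)) ∧ g • v i = k • v' i := by
    intro i
    obtain ⟨h1, h2, h3⟩ : IsReflectionWith X.P (X.r i) (α i) (v i) := X.functionals_spec i
    obtain ⟨k1, k2, k3⟩ : IsReflectionWith Y.P (Y.r i) (α' i) (v' i) := Y.functionals_spec i
    have hv' : v' i ≠ 0 := by
      intro h; rw [h, map_zero] at k1; norm_num at k1
    have e1 : ∀ x : V, α i (g⁻¹ • x) • g • v i = α' i x • v' i := by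
      intro x
      have e : (Y.r i : V ≃ₗ[ℝ] V) x = g • ((X.r i : V ≃ₗ[ℝ] V) (g⁻¹ • x)) := by
        rw [hr i]; rfl
      rw [k3, h3, smul_sub, smul_inv_smul, smul_comm g] at e
      exact (sub_right_injective e).symm
    have e2 : g • v i = (α' i (g • v i) / 2) • v' i := by
      have := e1 (g • v i)
      rw [inv_smul_smul, h1] at this
      rw [div_eq_inv_mul, mul_smul, ← this, smul_smul]
      norm_num
    set k := α' i (g • v i) / 2 with hk
    have e3 : ∀ x, α' i x = k * α i (g⁻¹ • x) := by
      intro x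
      have := e1 x
      rw [e2, smul_smul] at this
      rw [← smul_left_injective ℝ hv' this, mul_comm]
    refine ⟨k, ?_, e3, e2⟩
    have hk0 : k ≠ 0 := by
      intro h
      have := e3 (v' i)
      rw [k1, h, zero_mul] at this
      norm_num at this
    obtain ⟨x, hx, hxP, hαx⟩ := exists_mem_ne_zero X.isConvexPolytope.2.1 (α i) (v := v i)
      (by rw [h1]; norm_num)
    have p1 : 0 < α i x := lt_of_le_of_ne (nonneg_of_mem hx (h2 hxP)) hαx.symm
    have hgx : g • x ≠ 0 := by
      intro h; exact hx ((smul_eq_zero_iff_eq g).1 h)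
    have hgP : rayOfNeZero ℝ (g • x) hgx ∈ Y.P := by
      rw [hP]
      exact ⟨_, hxP, rfl⟩
    have p2 : 0 ≤ α' i (g • x) := nonneg_of_mem hgx (k2 hgP)
    rw [e3, inv_smul_smul] at p2
    exact lt_of_le_of_ne (nonneg_of_mul_nonneg_left p2 p1) hk0.symm
  choose k hk h1 h2 using key
  refine ⟨g, fun i => (k i)⁻¹, fun i => inv_pos.2 (hk i), fun i x => ?_, fun i => ?_⟩
  · simp only [inv_inv]; exact h1 i x
  · have := (hk i).ne'
    change v' i = (k i)⁻¹ • g • v i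
    rw [h2, smul_smul, inv_mul_cancel₀ this, one_smul]

/-- The map `Φ : 𝒞(G) → ((V*)^f × V^f) / (SL±(4, ℝ) × ℝ₊^f)`, `[(P, r)] ↦ [(α, v)]`. -/
def Phi (G : LabeledPolytope n f) : DefSpace G → Quotient (pairSetoid f) :=
  Quotient.lift (fun X => Quotient.mk (pairSetoid f) X.functionals)
    fun _ _ h => Quotient.sound (s := pairSetoid f) (functionals_equiv h)

/-- `𝒞(G)` carries the topology induced by `Φ` from the quotient topology. -/
instance (G : LabeledPolytope n f) : TopologicalSpace (DefSpace G) :=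
  TopologicalSpace.induced (Phi G) inferInstance

/-- The restricted deformation space `𝒞_Q(G)` with fundamental polytope `Q`: the classes of those
`(P, r₁, …)` for which `P` is projectively equivalent to `Q`. -/
def restricted (G : LabeledPolytope n f) (Q : Set S3) : Set (DefSpace G) :=
  {c | ∃ X : CoxeterPolytope G, DefSpace.mk X = c ∧ ∃ A : SLpm, A • Q = X.P}

/-! ### Realization spaces -/

/-- `(p_v)` is a realization of the combinatorial polytope underlying `G`. -/
def IsRealization (G : LabeledPolytope n f) (p : Fin n → S3) : Prop :=
  IsConvexPolytope (convHull (Set.range p)) ∧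
  Nonempty (G.FL ≃o FaceLattice (convHull (Set.range p))) ∧
  ∀ (S : Finset (Fin n)) (k : ℕ),
    IsFace (convHull (Set.range p)) (convHull (p '' S)) ∧ HasDim (convHull (p '' S)) k ↔
      G.IsFaceOfDim S k

/-- The pre-realization space, a subspace of `(𝕊³)^𝒱`. -/
abbrev PreRS (G : LabeledPolytope n f) : Type := {p : Fin n → S3 // IsRealization G p}

/-- The orbit equivalence relation of `SL±(4, ℝ)` on the pre-realization space. -/
def realizationSetoid (G : LabeledPolytope n f) : Setoid (PreRS G) where
  r p q := ∃ A : SLpm, ∀ v, q.1 v = A • p.1 v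
  iseqv :=
    { refl := fun p => ⟨1, by simp⟩
      symm := by
        rintro p q ⟨A, h⟩
        exact ⟨A⁻¹, fun v => by rw [h, inv_smul_smul]⟩
      trans := by
        rintro p q s ⟨A, h⟩ ⟨B, k⟩
        exact ⟨B * A, fun v => by rw [k, h, mul_smul]⟩ }

/-- The realization space `ℛ𝒮(G)`, with the quotient topology. -/
abbrev RealizationSpace (G : LabeledPolytope n f) : Type := Quotient (realizationSetoid G)

/-- The graph of the projection `𝒞(G) → ℛ𝒮(G)`, `[(P, r₁, …)] ↦ [(p_v)]`: the `p_v` are the vertices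
of `P`, and `p_v` is fixed by the `j`-th reflection if and only if `v` is a vertex of the `j`-th
facet. -/
def ProjectsTo {G : LabeledPolytope n f} (c : DefSpace G) (s : RealizationSpace G) : Prop :=
  ∃ (X : CoxeterPolytope G) (p : PreRS G), DefSpace.mk X = c ∧ Quotient.mk _ p = s ∧
    convHull (Set.range p.1) = X.P ∧ ∀ v j, v ∈ G.facet j ↔ X.r j • p.1 v = p.1 v

/-! ### The example -/

/-- The labeled polytope of the example. The indices `0, …, 5` of the facets stand for
`𝒢₁, …, 𝒢₆`, and the six vertices `0, …, 5` are those on the facets with the index sets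
`134`, `1246`, `123`, `345`, `456`, `2356`. In the table of labels, `0` stands for the pairs of
facets that are not adjacent. -/
def exG : LabeledPolytope 6 6 where
  facet := ![{0, 1, 2}, {1, 2, 5}, {0, 2, 3, 5}, {0, 1, 3, 4}, {3, 4, 5}, {1, 4, 5}]
  label := ![![1, 2, 2, 2, 0, 0],
             ![2, 1, 2, 0, 0, 2],
             ![2, 2, 1, 3, 3, 0],
             ![2, 0, 3, 1, 3, 2],
             ![0, 0, 3, 3, 1, 2],
             ![0, 2, 0, 2, 2, 1]]
  label_symm := by decide
  two_le_label := by decide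

/-- The coordinate functionals on `ℝ⁴`. -/
def coord (i : Fin 4) : StrongDual ℝ V := ContinuousLinearMap.proj i

/-- The functionals `β₁, …, β₅, β₆^d`. -/
def beta (d : ℝ) : Fin 6 → StrongDual ℝ V :=
  ![coord 0, coord 1, coord 2, coord 3,
    -coord 0 + coord 1 + coord 2 + coord 3,
    -coord 0 + d • coord 1 + coord 3]

/-- The polytope defined by the inequalities `βᵢ ≥ 0`. -/
def polytope (d : ℝ) : Set S3 := sph {x | ∀ i, 0 ≤ beta d i x}

/-- The vectors `w₁, …, w₆`. -/
def w (d x : ℝ) : Fin 6 → V :=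
  ![![2, 0, 0, 0],
    ![0, 2, 0, -2 * d],
    ![0, 0, 2, x],
    ![0, -2 / d, 1 / x, 2],
    ![d * (1 / (x + 2) - 2) / (d - 1) + 1 / (-2 / d + 1 / x + 2), (1 / (x + 2) - 2) / (d - 1),
      1 / (x + 2), 1 / (-2 / d + 1 / x + 2)],
    ![-2, 0, -2, 0]]

end CoxDef

end

open CoxDef

/-! Everything is reduced to explicit coordinates. Call functionals `α i` and vectors `q v` incident
if `α i (q v)` vanishes for `v ∈ exG.facet i` and is positive otherwise. Both a realization and a
Coxeter polytope yield such a configuration (`IsRealization.exists_incident`,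
`CoxeterPolytope.exists_incident`). The first four functionals of an incident configuration are
linear coordinates. Expanding the other two in them and rescaling every functional by a positive
factor brings all six to the form `beta d`, with one remaining modulus `d > 1`
(`Incident.exists_normal_form`). A functional vanishing at the right places determines each vertex
up to scale, so the realization is `pvert d`. The number `d` is a ratio of products of determinants
of the vertices in which all scalings cancel, hence it is a continuous invariant, and `ℛ𝒮` is the
interval `d > 1`.

For the reflections `Id - α i ⊗ v i`, an edge of order 2 means `α i (v j) = 0 = α j (v i)`, and an
edge of order 3 means `α i (v j) * α j (v i) = 1` with negative entries. The sign comes from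
disjointness of the translates: if the entries were positive, `r i * r j * r i` would fix an
interior point of the polytope. In normal form these equations leave a single free entry `x`, and
the three negativity conditions read `x < 0`, `x + 2 < 0` and `-2 / d + 1 / x + 2 < 0`, that is, `d
/ (2 - 2 * d) < x < -2`. Such an `x` exists exactly when `d < 4 / 3`. This is
`CoxeterPolytope.exists_equiv_model`.

Conversely, every admissible `(d, x)` gives a Coxeter polytope. For nonadjacent facets the two
entries are automatically negative with product at least 4, so each pair of reflections satisfies
the dihedral condition of Tits. The induction of Tits (`tits_induction`) then moves the open chamber
under a nontrivial group element strictly beyond one of its walls, which gives disjointness.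

For the topology, products of the entries `α i (v j)` along cycles are invariant under the group
action. Two of them recover `x` and `d` continuously, so `𝒞(G)` is homeomorphic to the parameter
region, an open interval of `x` over each `d` in `(1, 4 / 3)`, and hence to the plane.

The restricted deformation spaces are defined by projective equivalence without labels. That they
are the fibers needs one more fact, `eq_of_smul_polytope_eq`: a projective equivalence of two models
permutes the vertices by one of only two combinatorial automorphisms, and both of them preserve `d`.
-/

namespace CoxDef

/-! ### Rays -/

/-- The point of `𝕊³` represented by a nonzero vector. -/
abbrev rayOf (x : V) (hx : x ≠ 0) : S3 := rayOfNeZero ℝ x hx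

theorem rayOf_eq_iff {x y : V} (hx : x ≠ 0) (hy : y ≠ 0) :
    rayOf x hx = rayOf y hy ↔ ∃ t : ℝ, 0 < t ∧ y = t • x := by
  rw [rayOf, rayOf, ray_eq_iff]
  constructor
  · intro h
    obtain ⟨r, hr, h⟩ := h.exists_pos_left hx hy
    exact ⟨r, hr, h.symm⟩
  · rintro ⟨t, ht, rfl⟩
    exact SameRay.sameRay_pos_smul_right x ht

theorem exists_rayOf (p : S3) : ∃ (x : V) (hx : x ≠ 0), rayOf x hx = p := by
  induction p using Module.Ray.ind with
  | h x hx => exact ⟨x, hx, rfl⟩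

theorem rayOf_mem_sph_nonneg (α : StrongDual ℝ V) {x : V} (hx : x ≠ 0) :
    rayOf x hx ∈ sph {x | 0 ≤ α x} ↔ 0 ≤ α x :=
  mem_sph_iff (A := {x | 0 ≤ α x}) (fun y t ht hy => by
    simp only [Set.mem_ofPred_eq, map_smul, smul_eq_mul] at hy ⊢; positivity) hx

theorem rayOf_mem_sph_pos (α : StrongDual ℝ V) {x : V} (hx : x ≠ 0) :
    rayOf x hx ∈ sph {x | 0 < α x} ↔ 0 < α x :=
  mem_sph_iff (A := {x | 0 < α x}) (fun y t ht hy => by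
    simp only [Set.mem_ofPred_eq, map_smul, smul_eq_mul] at hy ⊢; positivity) hx

theorem rayOf_mem_sph_zero (α : StrongDual ℝ V) {x : V} (hx : x ≠ 0) :
    rayOf x hx ∈ sph {x | α x = 0} ↔ α x = 0 :=
  mem_sph_iff (A := {x | α x = 0}) (fun y t ht hy => by
    simp only [Set.mem_ofPred_eq, map_smul, smul_eq_mul] at hy ⊢; simp [hy]) hx

/-- The intersection of the half-spaces of a family of functionals. -/
def pcone {ι : Type*} (α : ι → StrongDual ℝ V) : Set S3 := sph {x | ∀ i, 0 ≤ α i x}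

/-- The intersection of the open half-spaces of a family of functionals. -/
def pconePos {ι : Type*} (α : ι → StrongDual ℝ V) : Set S3 := sph {x | ∀ i, 0 < α i x}

theorem rayOf_mem_pcone {ι : Type*} (α : ι → StrongDual ℝ V) {x : V} (hx : x ≠ 0) :
    rayOf x hx ∈ pcone α ↔ ∀ i, 0 ≤ α i x :=
  mem_sph_iff (A := {x | ∀ i, 0 ≤ α i x}) (fun y t ht hy i => by
    have := hy i
    simp only [map_smul, smul_eq_mul]; positivity) hx

theorem rayOf_mem_pconePos {ι : Type*} (α : ι → StrongDual ℝ V) {x : V} (hx : x ≠ 0) :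
    rayOf x hx ∈ pconePos α ↔ ∀ i, 0 < α i x :=
  mem_sph_iff (A := {x | ∀ i, 0 < α i x}) (fun y t ht hy i => by
    have := hy i
    simp only [map_smul, smul_eq_mul]; positivity) hx

theorem set_ext_rayOf {A B : Set S3} (h : ∀ (x : V) (hx : x ≠ 0), rayOf x hx ∈ A ↔ rayOf x hx ∈ B) :
    A = B := by
  ext p
  obtain ⟨x, hx, rfl⟩ := exists_rayOf p
  exact h x hx

theorem subset_of_rayOf {A B : Set S3} (h : ∀ (x : V) (hx : x ≠ 0), rayOf x hx ∈ A → rayOf x hx ∈ B) :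
    A ⊆ B := by
  intro p hp
  obtain ⟨x, hx, rfl⟩ := exists_rayOf p
  exact h x hx hp

theorem smul_ne_zero_of_SLpm (g : SLpm) {x : V} (hx : x ≠ 0) : g • x ≠ 0 :=
  fun h => hx ((smul_eq_zero_iff_eq g).1 h)

theorem smul_rayOf (g : SLpm) {x : V} (hx : x ≠ 0) :
    g • rayOf x hx = rayOf (g • x) (smul_ne_zero_of_SLpm g hx) := smul_rayOfNeZero g x hx

theorem rayOf_mem_smul_set (g : SLpm) (P : Set S3) {x : V} (hx : x ≠ 0) :
    rayOf x hx ∈ g • P ↔ rayOf (g⁻¹ • x) (smul_ne_zero_of_SLpm g⁻¹ hx) ∈ P := by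
  rw [Set.mem_smul_set_iff_inv_smul_mem, smul_rayOf]

/-! ### Topology -/

theorem isOpen_S3_iff {U : Set S3} :
    IsOpen U ↔ IsOpen {x : {x : V // x ≠ 0} | rayOf x.1 x.2 ∈ U} := isOpen_coinduced

theorem continuous_rayOf : Continuous fun x : {x : V // x ≠ 0} => rayOf x.1 x.2 :=
  continuous_coinduced_rng

theorem isOpen_pconePos {ι : Type*} [Finite ι] (α : ι → StrongDual ℝ V) : IsOpen (pconePos α) := by
  rw [isOpen_S3_iff]
  simp only [rayOf_mem_pconePos, Set.ofPred_forall]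
  refine isOpen_iInter_of_finite fun i => isOpen_lt continuous_const ?_
  exact (α i).continuous.comp continuous_subtype_val

theorem isClosed_pcone {ι : Type*} (α : ι → StrongDual ℝ V) : IsClosed (pcone α) := by
  rw [← isOpen_compl_iff, isOpen_S3_iff]
  have : {x : {x : V // x ≠ 0} | rayOf x.1 x.2 ∈ (pcone α)ᶜ}
      = {x : {x : V // x ≠ 0} | ∀ i, 0 ≤ α i x.1}ᶜ := by
    ext x
    simp only [Set.mem_ofPred_eq, Set.mem_compl_iff, rayOf_mem_pcone]
  rw [this, isOpen_compl_iff]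
  simp only [Set.ofPred_forall]
  refine isClosed_iInter fun i => isClosed_le continuous_const ?_
  exact (α i).continuous.comp continuous_subtype_val

/-- A point of an open set can be moved slightly in a given direction. -/
theorem exists_pos_add_mem {U : Set S3} (hU : IsOpen U) {x : V} (hx : x ≠ 0) (h : rayOf x hx ∈ U)
    (v : V) : ∃ (t : ℝ) (_ : 0 < t) (hy : x + t • v ≠ 0), rayOf (x + t • v) hy ∈ U := by
  rw [isOpen_S3_iff] at hU
  obtain ⟨W, hW, hWeq⟩ := isOpen_induced_iff.1 hU
  have hx' : (⟨x, hx⟩ : {x : V // x ≠ 0}) ∈ Subtype.val ⁻¹' W := by rw [hWeq]; exact h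
  have hc : Continuous fun t : ℝ => x + t • v := by fun_prop
  have hev : ∀ᶠ t : ℝ in nhds 0, x + t • v ∈ W ∧ x + t • v ≠ 0 := by
    have h0 := hc.tendsto 0
    simp only [zero_smul, add_zero] at h0
    exact h0.eventually (p := fun y => y ∈ W ∧ y ≠ 0)
      (Filter.Eventually.and (hW.mem_nhds hx') (isOpen_ne.mem_nhds hx))
  obtain ⟨ε, hε, hball⟩ := Metric.eventually_nhds_iff.1 hev
  have hm := hball (y := ε / 2) (by
    rw [dist_zero_right, Real.norm_eq_abs, abs_of_pos (by positivity)]; linarith)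
  refine ⟨ε / 2, by positivity, hm.2, ?_⟩
  have h2 : (⟨_, hm.2⟩ : {x : V // x ≠ 0}) ∈ Subtype.val ⁻¹' W := hm.1
  rw [hWeq] at h2
  exact h2

theorem pconePos_subset_pcone {ι : Type*} (α : ι → StrongDual ℝ V) : pconePos α ⊆ pcone α :=
  subset_of_rayOf fun x hx h => by
    rw [rayOf_mem_pconePos] at h
    rw [rayOf_mem_pcone]
    exact fun i => (h i).le

/-- From an interior point one can move a little in a direction in which a given nonzero `α i`
decreases and still stay in the cone, so `α i` was strictly positive there. -/
theorem interior_pcone {ι : Type*} [Finite ι] (α : ι → StrongDual ℝ V) (hα : ∀ i, α i ≠ 0) :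
    interior (pcone α) = pconePos α := by
  apply Set.Subset.antisymm
  · refine subset_of_rayOf fun x hx h => ?_
    rw [rayOf_mem_pconePos]
    intro i
    obtain ⟨v, hv⟩ : ∃ v, α i v < 0 := by
      obtain ⟨v, hv⟩ : ∃ v, α i v ≠ 0 := by
        by_contra hcon
        push Not at hcon
        exact hα i (ContinuousLinearMap.ext hcon)
      rcases lt_or_gt_of_ne hv with h | h
      · exact ⟨v, h⟩
      · exact ⟨-v, by simpa using h⟩
    obtain ⟨t, ht, hy, hm⟩ := exists_pos_add_mem isOpen_interior hx h v
    have := (rayOf_mem_pcone α hy).1 (interior_subset hm) i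
    simp only [map_add, map_smul, smul_eq_mul] at this
    nlinarith
  · exact interior_maximal (pconePos_subset_pcone α) (isOpen_pconePos α)

/-- The unit vector representing a point of `𝕊³`. -/
noncomputable def unitVec (p : S3) : V := ‖p.someVector‖⁻¹ • p.someVector

theorem unitVec_rayOf {x : V} (hx : x ≠ 0) : unitVec (rayOf x hx) = ‖x‖⁻¹ • x := by
  obtain ⟨t, ht, h⟩ := (rayOf_eq_iff hx (rayOf x hx).someVector_ne_zero).1
    (rayOf x hx).someVector_ray.symm
  rw [unitVec, h, norm_smul, Real.norm_eq_abs, abs_of_pos ht, mul_inv, mul_comm, mul_smul,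
    smul_smul t⁻¹, inv_mul_cancel₀ ht.ne', one_smul]

/-- A continuous choice of representatives turns determinants of the vertices into continuous
functions on the realization space. -/
theorem continuous_unitVec : Continuous unitVec := by
  refine continuous_coinduced_dom.2 ?_
  have : (unitVec ∘ fun x : {x : V // x ≠ 0} => rayOfNeZero ℝ x.1 x.2)
      = fun x : {x : V // x ≠ 0} => ‖x.1‖⁻¹ • x.1 := by
    funext x
    exact unitVec_rayOf x.2
  rw [this]
  refine Continuous.smul (Continuous.inv₀ continuous_subtype_val.norm fun x => ?_)
    continuous_subtype_val
  exact norm_ne_zero_iff.2 x.2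

theorem exists_unitVec_eq {x : V} (hx : x ≠ 0) :
    ∃ t : ℝ, 0 < t ∧ unitVec (rayOf x hx) = t • x :=
  ⟨‖x‖⁻¹, inv_pos.2 (norm_pos_iff.2 hx), unitVec_rayOf hx⟩

/-! ### Convex hulls -/

/-- The convex hull of finitely many points of `𝕊³` consists of the nonnegative combinations. -/
theorem rayOf_mem_convHull_image {ι : Type*} [Fintype ι] {q : ι → V} (hq : ∀ v, q v ≠ 0)
    (S : Finset ι) {y : V} (hy : y ≠ 0) :
    rayOf y hy ∈ convHull ((fun v => rayOf (q v) (hq v)) '' S) ↔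
      ∃ c : ι → ℝ, (∀ v, 0 ≤ c v) ∧ (∀ v, v ∉ S → c v = 0) ∧ y = ∑ v, c v • q v := by
  set K : Set V := {y | ∃ c : ι → ℝ, (∀ v, 0 ≤ c v) ∧ (∀ v, v ∉ S → c v = 0) ∧
    y = ∑ v, c v • q v} with hK
  have hsmul : ∀ (x : V) (t : ℝ), 0 ≤ t → x ∈ K → t • x ∈ K := by
    rintro x t ht ⟨c, h1, h2, rfl⟩
    refine ⟨fun v => t * c v, fun v => mul_nonneg ht (h1 v), fun v hv => by simp [h2 v hv], ?_⟩
    simp only [Finset.smul_sum, mul_smul]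
  have hadd : ∀ x ∈ K, ∀ y ∈ K, x + y ∈ K := by
    rintro x ⟨c, h1, h2, rfl⟩ y ⟨e, k1, k2, rfl⟩
    refine ⟨fun v => c v + e v, fun v => add_nonneg (h1 v) (k1 v),
      fun v hv => by simp [h2 v hv, k2 v hv], ?_⟩
    simp only [add_smul, Finset.sum_add_distrib]
  constructor
  · rintro ⟨x, hx, hxm, h⟩
    have hxK : x ∈ K := by
      refine convexHull_min ?_ ?_ hxm
      · rintro z ⟨hz, v, hv, hvz⟩
        classical
        obtain ⟨t, ht, rfl⟩ := (rayOf_eq_iff (hq v) hz).1 hvz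
        refine ⟨fun u => if u = v then t else 0, fun u => by dsimp only; split_ifs <;> simp [ht.le],
          fun u hu => ?_, ?_⟩
        · refine if_neg ?_
          rintro rfl
          exact hu hv
        · simp [ite_smul]
      · intro a ha b hb s t hs ht _
        exact hadd _ (hsmul _ _ hs ha) _ (hsmul _ _ ht hb)
    obtain ⟨t, ht, rfl⟩ := (rayOf_eq_iff hx hy).1 h
    exact hsmul _ _ ht.le hxK
  · rintro ⟨c, h1, h2, hyc⟩
    have hT : 0 < ∑ v, c v := by
      refine lt_of_le_of_ne (Finset.sum_nonneg fun v _ => h1 v) fun h => hy ?_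
      have := (Finset.sum_eq_zero_iff_of_nonneg fun v _ => h1 v).1 h.symm
      rw [hyc]
      exact Finset.sum_eq_zero fun v hv => by rw [this v hv, zero_smul]
    have hS : ∑ v, c v = ∑ v ∈ S, c v :=
      (Finset.sum_subset (Finset.subset_univ S) fun v _ hv => h2 v hv).symm
    have hyS : y = ∑ v ∈ S, c v • q v := by
      rw [hyc]
      exact (Finset.sum_subset (Finset.subset_univ S) fun v _ hv => by rw [h2 v hv, zero_smul]).symm
    refine ⟨y, hy, ?_, rfl⟩
    -- `coneOver` is stable under positive scaling, so a conical combination with total weight `T`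
    -- is a convex combination of the vectors `T • q v`.
    set T := ∑ v, c v with hTdef
    have : y = ∑ v ∈ S, (c v / T) • (T • q v) := by
      rw [hyS]
      refine Finset.sum_congr rfl fun v _ => ?_
      rw [smul_smul, div_mul_cancel₀ _ hT.ne']
    rw [this]
    refine (convex_convexHull ℝ _).sum_mem (fun v _ => div_nonneg (h1 v) hT.le) ?_ fun v hv => ?_
    · rw [← Finset.sum_div, ← hS, div_self hT.ne']
    · refine subset_convexHull ℝ _ ⟨smul_ne_zero hT.ne' (hq v), v, hv, ?_⟩
      exact (rayOf_eq_iff _ _).2 ⟨T, hT, rfl⟩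

/-! ### The vertices of the model polytope -/

theorem beta_zero (d : ℝ) (y : V) : beta d 0 y = y 0 := rfl
theorem beta_one (d : ℝ) (y : V) : beta d 1 y = y 1 := rfl
theorem beta_two (d : ℝ) (y : V) : beta d 2 y = y 2 := rfl
theorem beta_three (d : ℝ) (y : V) : beta d 3 y = y 3 := rfl
theorem beta_four (d : ℝ) (y : V) : beta d 4 y = -y 0 + y 1 + y 2 + y 3 := rfl
theorem beta_five (d : ℝ) (y : V) : beta d 5 y = -y 0 + d * y 1 + y 3 := rfl

/-- The vertices of the polytope `P_d`. -/
def vert (d : ℝ) : Fin 6 → V :=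
  ![![0, 1, 0, 0], ![0, 0, 1, 0], ![0, 0, 0, 1], ![1, 1, 0, 0], ![d, 1, d - 1, 0], ![1, 0, 0, 1]]

theorem vert_ne_zero (d : ℝ) (v : Fin 6) : vert d v ≠ 0 := by
  have h : ∀ i : Fin 4, vert d v i ≠ 0 → vert d v ≠ 0 := fun i h h' => h (by rw [h']; rfl)
  fin_cases v
  · exact h 1 (by simp [vert])
  · exact h 2 (by simp [vert])
  · exact h 3 (by simp [vert])
  · exact h 0 (by simp [vert])
  · exact h 1 (by simp [vert])
  · exact h 0 (by simp [vert])

/-- Functionals `αᵢ` and vectors `q_v` with the incidences of the facets and vertices of `exG`. -/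
def Incident (α : Fin 6 → StrongDual ℝ V) (q : Fin 6 → V) : Prop :=
  ∀ i v, (v ∈ exG.facet i → α i (q v) = 0) ∧ (v ∉ exG.facet i → 0 < α i (q v))

theorem incident_beta_vert {d : ℝ} (hd : 1 < d) : Incident (beta d) (vert d) := by
  intro i v
  refine ⟨fun h => ?_, fun h => ?_⟩
  · fin_cases i <;> fin_cases v <;> first | (exfalso; revert h; decide) | skip
    all_goals simp [beta, coord, vert]
  · fin_cases i <;> fin_cases v <;> first | (exfalso; revert h; decide) | skip
    all_goals simp [beta, coord, vert]
    all_goals linarith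

theorem Incident.nonneg {α : Fin 6 → StrongDual ℝ V} {q : Fin 6 → V} (h : Incident α q)
    (i v : Fin 6) : 0 ≤ α i (q v) := by
  by_cases hv : v ∈ exG.facet i
  · exact ((h i v).1 hv).ge
  · exact ((h i v).2 hv).le

theorem Incident.eq_zero_iff {α : Fin 6 → StrongDual ℝ V} {q : Fin 6 → V} (h : Incident α q)
    (i v : Fin 6) : α i (q v) = 0 ↔ v ∈ exG.facet i :=
  ⟨fun h0 => by_contra fun hv => ((h i v).2 hv).ne' h0, (h i v).1⟩

theorem Incident.ne_zero {α : Fin 6 → StrongDual ℝ V} {q : Fin 6 → V} (h : Incident α q)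
    (v : Fin 6) : q v ≠ 0 := by
  intro h0
  obtain ⟨i, hi⟩ := (by decide : ∀ v, ∃ i, v ∉ exG.facet i) v
  have := (h i v).2 hi
  rw [h0, map_zero] at this
  exact this.false

theorem Incident.functional_ne_zero {α : Fin 6 → StrongDual ℝ V} {q : Fin 6 → V}
    (h : Incident α q) (i : Fin 6) : α i ≠ 0 := by
  intro h0
  obtain ⟨v, hv⟩ := (by decide : ∀ i, ∃ v, v ∉ exG.facet i) i
  have := (h i v).2 hv
  rw [h0] at this
  exact this.false

theorem vec_ext {x y : V} (h0 : x 0 = y 0) (h1 : x 1 = y 1) (h2 : x 2 = y 2) (h3 : x 3 = y 3) :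
    x = y := by
  ext i
  fin_cases i <;> assumption

/-- A vertex of `P_d` is determined by the facets on which it lies. -/
theorem eq_smul_vert {d : ℝ} {y : V} {v : Fin 6}
    (h0 : ∀ i, v ∈ exG.facet i → beta d i y = 0)
    (h1 : ∀ i, v ∉ exG.facet i → 0 < beta d i y) :
    ∃ t : ℝ, 0 < t ∧ y = t • vert d v := by
  fin_cases v
  · have a0 := h0 0 (by decide)
    have a2 := h0 2 (by decide)
    have a3 := h0 3 (by decide)
    have a1 := h1 1 (by decide)
    rw [beta_zero] at a0; rw [beta_two] at a2; rw [beta_three] at a3; rw [beta_one] at a1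
    exact ⟨y 1, a1, vec_ext (by simp [vert, *]) (by simp [vert, *]) (by simp [vert, *])
      (by simp [vert, *])⟩
  · have a0 := h0 0 (by decide)
    have a2 := h0 1 (by decide)
    have a3 := h0 3 (by decide)
    have a1 := h1 2 (by decide)
    rw [beta_zero] at a0; rw [beta_one] at a2; rw [beta_three] at a3; rw [beta_two] at a1
    exact ⟨y 2, a1, vec_ext (by simp [vert, *]) (by simp [vert, *]) (by simp [vert, *])
      (by simp [vert, *])⟩
  · have a0 := h0 0 (by decide)
    have a2 := h0 1 (by decide)
    have a3 := h0 2 (by decide)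
    have a1 := h1 3 (by decide)
    rw [beta_zero] at a0; rw [beta_one] at a2; rw [beta_two] at a3; rw [beta_three] at a1
    exact ⟨y 3, a1, vec_ext (by simp [vert, *]) (by simp [vert, *]) (by simp [vert, *])
      (by simp [vert, *])⟩
  · have a2 := h0 2 (by decide)
    have a3 := h0 3 (by decide)
    have a4 := h0 4 (by decide)
    have a1 := h1 1 (by decide)
    rw [beta_two] at a2; rw [beta_three] at a3; rw [beta_four] at a4; rw [beta_one] at a1
    have : y 0 = y 1 := by linarith
    exact ⟨y 1, a1, vec_ext (by simp [vert, *]) (by simp [vert, *]) (by simp [vert, *])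
      (by simp [vert, *])⟩
  · have a3 := h0 3 (by decide)
    have a4 := h0 4 (by decide)
    have a5 := h0 5 (by decide)
    have a1 := h1 1 (by decide)
    rw [beta_three] at a3; rw [beta_four] at a4; rw [beta_five] at a5; rw [beta_one] at a1
    have e0 : y 0 = y 1 * d := by linarith
    have e2 : y 2 = y 1 * (d - 1) := by linarith
    exact ⟨y 1, a1, vec_ext (by simp [vert, *]) (by simp [vert, *]) (by simp [vert, *])
      (by simp [vert, *])⟩
  · have a1 := h0 1 (by decide)
    have a2 := h0 2 (by decide)
    have a4 := h0 4 (by decide)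
    have a3 := h1 3 (by decide)
    rw [beta_one] at a1; rw [beta_two] at a2; rw [beta_four] at a4; rw [beta_three] at a3
    have : y 0 = y 3 := by linarith
    exact ⟨y 3, a3, vec_ext (by simp [vert, *]) (by simp [vert, *]) (by simp [vert, *])
      (by simp [vert, *])⟩

/-- The cone over `P_d` is generated by the vertices. -/
theorem exists_nonneg_comb {d : ℝ} (hd : 1 < d) {y : V} (hy : ∀ i, 0 ≤ beta d i y) :
    ∃ c : Fin 6 → ℝ, (∀ v, 0 ≤ c v) ∧ y = ∑ v, c v • vert d v := by
  have b0 := hy 0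
  have b1 := hy 1
  have b2 := hy 2
  have b3 := hy 3
  have b4 := hy 4
  have b5 := hy 5
  rw [beta_zero] at b0; rw [beta_one] at b1; rw [beta_two] at b2; rw [beta_three] at b3
  rw [beta_four] at b4; rw [beta_five] at b5
  -- Once the coefficients of vertices 3, 4, 5 are chosen, coordinates 1, 2, 3 force those of
  -- vertices 0, 1, 2. What remains is to produce `y 0`: it is taken from vertex 5 as far as `y 3`
  -- allows, then from vertex 3 as far as `y 1` allows, and only then by trading vertex 3 for vertex
  -- 4. The inequalities of `beta d 4` and `beta d 5` bound this last exchange.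
  have main : ∀ c3 c4 c5 : ℝ, 0 ≤ c3 → 0 ≤ c4 → 0 ≤ c5 → c3 + c4 ≤ y 1 → (d - 1) * c4 ≤ y 2 →
      c5 ≤ y 3 → y 0 = c3 + d * c4 + c5 →
      ∃ c : Fin 6 → ℝ, (∀ v, 0 ≤ c v) ∧ y = ∑ v, c v • vert d v := by
    intro c3 c4 c5 h3 h4 h5 h1 h2 h6 h0
    refine ⟨![y 1 - c3 - c4, y 2 - (d - 1) * c4, y 3 - c5, c3, c4, c5], fun v => ?_, ?_⟩
    · fin_cases v <;> simp <;> linarith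
    · apply vec_ext <;> simp [Fin.sum_univ_succ, vert] <;> linarith
  rcases le_total (y 0) (y 3) with h | h
  · exact main 0 0 (y 0) le_rfl le_rfl b0 (by linarith) (by linarith) h (by ring)
  · rcases le_total (y 0 - y 3) (y 1) with h' | h'
    · exact main (y 0 - y 3) 0 (y 3) (by linarith) le_rfl b3 (by linarith) (by linarith) le_rfl
        (by ring)
    · have hd' : 0 < d - 1 := by linarith
      have e1 : (d - 1) * ((y 0 - y 3 - y 1) / (d - 1)) = y 0 - y 3 - y 1 := by field_simp
      have e2 : (y 0 - y 3 - y 1) / (d - 1) ≤ y 1 := by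
        rw [div_le_iff₀ hd']; linarith
      refine main (y 1 - (y 0 - y 3 - y 1) / (d - 1)) ((y 0 - y 3 - y 1) / (d - 1)) (y 3)
        (by linarith) (div_nonneg (by linarith) hd'.le) b3 (by linarith) (by linarith) le_rfl ?_
      linarith

theorem rayOf_mem_polytope (d : ℝ) {x : V} (hx : x ≠ 0) :
    rayOf x hx ∈ polytope d ↔ ∀ i, 0 ≤ beta d i x := rayOf_mem_pcone (beta d) hx

/-- The vertices of `P_d` as points of `𝕊³`. -/
abbrev pvert (d : ℝ) (v : Fin 6) : S3 := rayOf (vert d v) (vert_ne_zero d v)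

theorem rayOf_mem_convHull_pvert (d : ℝ) (S : Finset (Fin 6)) {y : V} (hy : y ≠ 0) :
    rayOf y hy ∈ convHull (pvert d '' S) ↔
      ∃ c : Fin 6 → ℝ, (∀ v, 0 ≤ c v) ∧ (∀ v, v ∉ S → c v = 0) ∧ y = ∑ v, c v • vert d v :=
  rayOf_mem_convHull_image (vert_ne_zero d) S hy

theorem convHull_range_pvert {d : ℝ} (hd : 1 < d) : convHull (Set.range (pvert d)) = polytope d := by
  rw [← Set.image_univ, ← Finset.coe_univ]
  refine set_ext_rayOf fun y hy => ?_
  rw [rayOf_mem_convHull_pvert, rayOf_mem_polytope]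
  constructor
  · rintro ⟨c, hc, -, rfl⟩ i
    rw [map_sum]
    refine Finset.sum_nonneg fun v _ => ?_
    rw [map_smul, smul_eq_mul]
    exact mul_nonneg (hc v) ((incident_beta_vert hd).nonneg i v)
  · intro h
    obtain ⟨c, hc, h⟩ := exists_nonneg_comb hd h
    exact ⟨c, hc, fun v hv => absurd (Finset.mem_univ v) hv, h⟩

theorem interior_polytope {d : ℝ} (hd : 1 < d) : interior (polytope d) = pconePos (beta d) :=
  interior_pcone _ fun i => (incident_beta_vert hd).functional_ne_zero i

/-! ### The faces of the model polytope -/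

/-- The vertex sets satisfying the conditions imposed by the affine dependences of the vertices. -/
def CircuitClosed (Z : Finset (Fin 6)) : Prop :=
  (0 ∈ Z ∧ 5 ∈ Z ↔ 2 ∈ Z ∧ 3 ∈ Z) ∧ (0 ∈ Z ∧ 4 ∈ Z ↔ 1 ∈ Z ∧ 3 ∈ Z) ∧
  (2 ∈ Z ∧ 4 ∈ Z ↔ 1 ∈ Z ∧ 3 ∈ Z ∧ 5 ∈ Z) ∧ (2 ∈ Z ∧ 4 ∈ Z ↔ 1 ∈ Z ∧ 0 ∈ Z ∧ 5 ∈ Z)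

instance : DecidablePred CircuitClosed := fun _ => inferInstanceAs (Decidable (_ ∧ _))

set_option maxRecDepth 20000 in
theorem CircuitClosed.isFace_cases : ∀ Z : Finset (Fin 6), Z.Nonempty → CircuitClosed Z →
    (∃ v, Z = {v}) ∨ (∃ i j, exG.Adj i j ∧ Z = exG.facet i ∩ exG.facet j) ∨
      (∃ i, Z = exG.facet i) ∨ Z = Finset.univ := by
  decide

theorem CircuitClosed.exists_isFaceOfDim {Z : Finset (Fin 6)} (hne : Z.Nonempty)
    (hZ : CircuitClosed Z) : ∃ k, exG.IsFaceOfDim Z k := by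
  rcases CircuitClosed.isFace_cases Z hne hZ with h | h | h | h
  exacts [⟨0, h⟩, ⟨1, h⟩, ⟨2, h⟩, ⟨3, h⟩]

theorem IsFaceOfDim.cases {S : Finset (Fin 6)} {k : ℕ} (h : exG.IsFaceOfDim S k) :
    (∃ v, S = {v}) ∨ (∃ i j, exG.Adj i j ∧ S = exG.facet i ∩ exG.facet j) ∨
      (∃ i, S = exG.facet i) ∨ S = Finset.univ := by
  match k, h with
  | 0, h => exact Or.inl h
  | 1, h => exact Or.inr (Or.inl h)
  | 2, h => exact Or.inr (Or.inr (Or.inl h))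
  | 3, h => exact Or.inr (Or.inr (Or.inr h))

/-- Each face is the intersection of the facets containing it. This makes the sum `faceFun` vanish
at no vertices other than those of the face. -/
theorem IsFaceOfDim.mem_of_facets {S : Finset (Fin 6)} {k : ℕ} (h : exG.IsFaceOfDim S k) :
    ∀ v, (∀ i, S ⊆ exG.facet i → v ∈ exG.facet i) → v ∈ S := by
  rcases IsFaceOfDim.cases h with ⟨v, rfl⟩ | ⟨i, j, hij, rfl⟩ | ⟨i, rfl⟩ | rfl
  · clear h; revert v; decide
  · intro v hv
    exact Finset.mem_inter.2 ⟨hv i Finset.inter_subset_left, hv j Finset.inter_subset_right⟩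
  · exact fun v hv => hv i subset_rfl
  · exact fun v _ => Finset.mem_univ v

theorem IsFaceOfDim.nonempty {S : Finset (Fin 6)} {k : ℕ} (h : exG.IsFaceOfDim S k) :
    S.Nonempty := by
  rcases IsFaceOfDim.cases h with ⟨v, rfl⟩ | ⟨i, j, hij, rfl⟩ | ⟨i, rfl⟩ | rfl
  · exact Finset.singleton_nonempty v
  · exact Finset.card_pos.1 (by rw [hij.2]; norm_num)
  · exact (by decide : ∀ i, (exG.facet i).Nonempty) i
  · exact Finset.univ_nonempty

/-- The sum of the functionals of the facets containing `S`. -/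
noncomputable def faceFun (d : ℝ) (S : Finset (Fin 6)) : StrongDual ℝ V :=
  ∑ i ∈ Finset.univ.filter (fun i => S ⊆ exG.facet i), beta d i

theorem faceFun_apply (d : ℝ) (S : Finset (Fin 6)) (y : V) :
    faceFun d S y = ∑ i ∈ Finset.univ.filter (fun i => S ⊆ exG.facet i), beta d i y := by
  simp [faceFun]

theorem faceFun_vert_nonneg {d : ℝ} (hd : 1 < d) (S : Finset (Fin 6)) (v : Fin 6) :
    0 ≤ faceFun d S (vert d v) := by
  rw [faceFun_apply]
  exact Finset.sum_nonneg fun i _ => (incident_beta_vert hd).nonneg i v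

theorem faceFun_vert_eq_zero_iff {d : ℝ} (hd : 1 < d) {S : Finset (Fin 6)} {k : ℕ}
    (h : exG.IsFaceOfDim S k) (v : Fin 6) : faceFun d S (vert d v) = 0 ↔ v ∈ S := by
  rw [faceFun_apply,
    Finset.sum_eq_zero_iff_of_nonneg fun i _ => (incident_beta_vert hd).nonneg i v]
  constructor
  · intro h'
    refine IsFaceOfDim.mem_of_facets h v fun i hi => ?_
    exact ((incident_beta_vert hd).eq_zero_iff i v).1 (h' i (by simpa using hi))
  · intro hv i hi
    exact ((incident_beta_vert hd).eq_zero_iff i v).2 ((Finset.mem_filter.1 hi).2 hv)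

theorem nonneg_on_polytope_iff {d : ℝ} (hd : 1 < d) (α : StrongDual ℝ V) :
    polytope d ⊆ sph {x | 0 ≤ α x} ↔ ∀ v, 0 ≤ α (vert d v) := by
  constructor
  · intro h v
    refine nonneg_of_mem (vert_ne_zero d v) (h ?_)
    exact (rayOf_mem_polytope d (vert_ne_zero d v)).2 fun i => (incident_beta_vert hd).nonneg i v
  · intro h
    refine subset_of_rayOf fun x hx hxP => ?_
    rw [rayOf_mem_polytope] at hxP
    rw [rayOf_mem_sph_nonneg]
    obtain ⟨c, hc, rfl⟩ := exists_nonneg_comb hd hxP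
    simp only [map_sum, map_smul, smul_eq_mul]
    exact Finset.sum_nonneg fun v _ => mul_nonneg (hc v) (h v)

/-- The face cut out by a functional is the convex hull of the vertices at which it vanishes. -/
theorem polytope_inter_eq_convHull {d : ℝ} (hd : 1 < d) {α : StrongDual ℝ V}
    (hα : ∀ v, 0 ≤ α (vert d v)) {Z : Finset (Fin 6)} (hZ : ∀ v, α (vert d v) = 0 ↔ v ∈ Z) :
    polytope d ∩ sph {x | α x = 0} = convHull (pvert d '' Z) := by
  refine set_ext_rayOf fun y hy => ?_
  rw [rayOf_mem_convHull_pvert, Set.mem_inter_iff, rayOf_mem_sph_zero, rayOf_mem_polytope]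
  constructor
  · rintro ⟨h1, h2⟩
    obtain ⟨c, hc, rfl⟩ := exists_nonneg_comb hd h1
    refine ⟨c, hc, fun v hv => ?_, rfl⟩
    simp only [map_sum, map_smul, smul_eq_mul] at h2
    have := (Finset.sum_eq_zero_iff_of_nonneg fun v _ => mul_nonneg (hc v) (hα v)).1 h2 v
      (Finset.mem_univ v)
    rcases mul_eq_zero.1 this with h | h
    · exact h
    · exact absurd ((hZ v).1 h) hv
  · rintro ⟨c, hc, h0, rfl⟩
    constructor
    · intro i
      rw [map_sum]
      refine Finset.sum_nonneg fun v _ => ?_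
      rw [map_smul, smul_eq_mul]
      exact mul_nonneg (hc v) ((incident_beta_vert hd).nonneg i v)
    · rw [map_sum]
      refine Finset.sum_eq_zero fun v _ => ?_
      rw [map_smul, smul_eq_mul]
      by_cases hv : v ∈ Z
      · rw [(hZ v).2 hv, mul_zero]
      · rw [h0 v hv, zero_mul]

/-- The linear dependences of the vertices on the two quadrilateral facets 2 and 3. Six vectors
spanning a space of dimension 4 have no further independent relations. -/
theorem vert_relation (d : ℝ) (α : StrongDual ℝ V) :
    α (vert d 0) + α (vert d 5) = α (vert d 2) + α (vert d 3) ∧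
    (d - 1) * α (vert d 0) + α (vert d 4) = (d - 1) * α (vert d 1) + d * α (vert d 3) := by
  constructor
  · rw [← map_add, ← map_add]
    congr 1
    apply vec_ext <;> simp [vert]
  · simp only [← smul_eq_mul, ← map_smul, ← map_add]
    congr 1
    apply vec_ext <;> simp [vert]

/-- A dependence written with positive coefficients on both sides shows that a nonnegative
functional vanishes on all of one side exactly when it vanishes on all of the other. Two of the four
dependences are those of `vert_relation`; the other two arise by eliminating vertex 0 or vertex 3.
-/
theorem circuitClosed_zeroSet {d : ℝ} (hd : 1 < d) {α : StrongDual ℝ V}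
    (hα : ∀ v, 0 ≤ α (vert d v)) {Z : Finset (Fin 6)} (hZ : ∀ v, α (vert d v) = 0 ↔ v ∈ Z) :
    CircuitClosed Z := by
  have hd' : 0 < d - 1 := by linarith
  obtain ⟨r1, r2⟩ := vert_relation d α
  have h0 := hα 0
  have h1 := hα 1
  have h2 := hα 2
  have h3 := hα 3
  have h4 := hα 4
  have h5 := hα 5
  have m0 := mul_nonneg hd'.le h0
  have m1 := mul_nonneg hd'.le h1
  have m2 := mul_nonneg hd'.le h2
  have m3 := mul_nonneg hd'.le h3
  have m5 := mul_nonneg hd'.le h5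
  have key : ∀ a : ℝ, (d - 1) * a ≤ 0 → 0 ≤ a → a = 0 := fun a ha h =>
    le_antisymm (by nlinarith) h
  simp only [CircuitClosed, ← hZ]
  refine ⟨⟨?_, ?_⟩, ⟨?_, ?_⟩, ⟨?_, ?_⟩, ⟨?_, ?_⟩⟩
  · rintro ⟨a, b⟩; constructor <;> linarith
  · rintro ⟨a, b⟩; constructor <;> linarith
  · rintro ⟨a, b⟩
    rw [a, b] at r2
    exact ⟨key _ (by nlinarith) h1, by nlinarith⟩
  · rintro ⟨a, b⟩
    rw [a, b] at r2
    exact ⟨key _ (by nlinarith) h0, by nlinarith⟩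
  · rintro ⟨a, b⟩
    rw [a] at r1
    rw [b] at r2
    -- The combination that eliminates vertex 0.
    have e : (d - 1) * α (vert d 1) + α (vert d 3) + (d - 1) * α (vert d 5) = 0 := by
      linear_combination (d - 1) * r1 - r2
    exact ⟨key _ (by linarith) h1, by linarith, key _ (by linarith) h5⟩
  · rintro ⟨a, b, c⟩
    rw [b, c] at r1
    rw [a, b] at r2
    have e : (d - 1) * α (vert d 2) + α (vert d 4) = 0 := by
      linear_combination r2 - (d - 1) * r1
    exact ⟨key _ (by linarith) h2, by linarith⟩
  · rintro ⟨a, b⟩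
    rw [a] at r1
    rw [b] at r2
    -- The combination that eliminates vertex 3.
    have e : (d - 1) * α (vert d 1) + α (vert d 0) + (d - 1) * α (vert d 5) + α (vert d 5) = 0 := by
      linear_combination d * r1 - r2
    exact ⟨key _ (by linarith) h1, by linarith, by linarith⟩
  · rintro ⟨a, b, c⟩
    rw [b, c] at r1
    rw [a, b] at r2
    have : α (vert d 2) = 0 := by linarith
    have : α (vert d 3) = 0 := by linarith
    refine ⟨by assumption, ?_⟩
    rw [this] at r2
    linarith

/-- The vertices at which a supporting functional vanishes form a set closed under the circuit
conditions, and inspection of all 64 subsets shows that the nonempty ones are combinatorial faces.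
Conversely, `faceFun` exposes each combinatorial face. -/
theorem isFace_polytope_iff {d : ℝ} (hd : 1 < d) (F : Set S3) :
    IsFace (polytope d) F ↔
      ∃ S : Finset (Fin 6), (∃ k, exG.IsFaceOfDim S k) ∧ F = convHull (pvert d '' S) := by
  classical
  constructor
  · rintro ⟨hne, α, hα, rfl⟩
    rw [nonneg_on_polytope_iff hd] at hα
    have hZ : ∀ v, α (vert d v) = 0 ↔ v ∈ Finset.univ.filter fun v => α (vert d v) = 0 := by simp
    have hF := polytope_inter_eq_convHull hd hα hZ
    refine ⟨_, CircuitClosed.exists_isFaceOfDim ?_ (circuitClosed_zeroSet hd hα hZ), hF⟩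
    rw [hF] at hne
    obtain ⟨p, hp⟩ := hne
    obtain ⟨y, hy, rfl⟩ := exists_rayOf p
    obtain ⟨c, hc, h0, h⟩ := (rayOf_mem_convHull_pvert d _ hy).1 hp
    rw [Finset.nonempty_iff_ne_empty]
    intro hZ0
    refine hy (h.trans (Finset.sum_eq_zero fun v _ => ?_))
    rw [h0 v (by rw [hZ0]; exact Finset.notMem_empty v), zero_smul]
  · rintro ⟨S, ⟨k, hS⟩, rfl⟩
    constructor
    · obtain ⟨v, hv⟩ := IsFaceOfDim.nonempty hS
      refine ⟨pvert d v, (rayOf_mem_convHull_pvert d S (vert_ne_zero d v)).2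
        ⟨fun u => if u = v then 1 else 0, fun u => ?_, fun u hu => ?_, ?_⟩⟩
      · dsimp only; split_ifs <;> simp
      · refine if_neg ?_
        rintro rfl
        exact hu hv
      · simp [ite_smul]
    · exact ⟨faceFun d S, (nonneg_on_polytope_iff hd _).2 (faceFun_vert_nonneg hd S),
        (polytope_inter_eq_convHull hd (faceFun_vert_nonneg hd S)
          (faceFun_vert_eq_zero_iff hd hS)).symm⟩

/-- The functional `faceFun d {v}` vanishes at `v` and is positive at every other vertex, so `v` is
not in the hull of the others. -/
theorem pvert_mem_convHull_iff {d : ℝ} (hd : 1 < d) (S : Finset (Fin 6)) (v : Fin 6) :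
    pvert d v ∈ convHull (pvert d '' S) ↔ v ∈ S := by
  rw [rayOf_mem_convHull_pvert]
  constructor
  · rintro ⟨c, hc, h0, h⟩
    by_contra hv
    have hf : exG.IsFaceOfDim {v} 0 := ⟨v, rfl⟩
    have e := (faceFun_vert_eq_zero_iff hd hf v).2 (Finset.mem_singleton_self v)
    rw [h, map_sum] at e
    simp only [map_smul, smul_eq_mul] at e
    rw [Finset.sum_eq_zero_iff_of_nonneg fun u _ =>
      mul_nonneg (hc u) (faceFun_vert_nonneg hd {v} u)] at e
    refine vert_ne_zero d v (h.trans (Finset.sum_eq_zero fun u _ => ?_))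
    by_cases hu : u = v
    · rw [hu, h0 v hv, zero_smul]
    · rcases mul_eq_zero.1 (e u (Finset.mem_univ u)) with h | h
      · rw [h, zero_smul]
      · exact absurd (Finset.mem_singleton.1 ((faceFun_vert_eq_zero_iff hd hf u).1 h)) hu
  · intro hv
    refine ⟨fun u => if u = v then 1 else 0, fun u => ?_, fun u hu => ?_, ?_⟩
    · dsimp only; split_ifs <;> simp
    · refine if_neg ?_
      rintro rfl
      exact hu hv
    · simp [ite_smul]

theorem convHull_pvert_subset_iff {d : ℝ} (hd : 1 < d) (S T : Finset (Fin 6)) :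
    convHull (pvert d '' S) ⊆ convHull (pvert d '' T) ↔ S ⊆ T := by
  constructor
  · intro h v hv
    exact (pvert_mem_convHull_iff hd T v).1 (h ((pvert_mem_convHull_iff hd S v).2 hv))
  · intro h
    refine subset_of_rayOf fun y hy hyS => ?_
    rw [rayOf_mem_convHull_pvert] at hyS ⊢
    obtain ⟨c, hc, h0, e⟩ := hyS
    exact ⟨c, hc, fun v hv => h0 v fun hv' => hv (h hv'), e⟩

theorem convHull_pvert_injective {d : ℝ} (hd : 1 < d) {S T : Finset (Fin 6)}
    (h : convHull (pvert d '' S) = convHull (pvert d '' T)) : S = T :=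
  Finset.Subset.antisymm ((convHull_pvert_subset_iff hd S T).1 h.subset)
    ((convHull_pvert_subset_iff hd T S).1 h.superset)

/-- The face lattice of `P_d` is the face lattice of `exG`. -/
noncomputable def faceIso {d : ℝ} (hd : 1 < d) : exG.FL ≃o FaceLattice (polytope d) where
  toEquiv := Equiv.ofBijective
    (fun S => ⟨convHull (pvert d '' S.1), (isFace_polytope_iff hd _).2 ⟨S.1, S.2, rfl⟩⟩) (by
      constructor
      · intro S T h
        exact Subtype.ext (convHull_pvert_injective hd (congrArg Subtype.val h))
      · rintro ⟨F, hF⟩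
        obtain ⟨S, hS, rfl⟩ := (isFace_polytope_iff hd F).1 hF
        exact ⟨⟨S, hS⟩, rfl⟩)
  map_rel_iff' := by
    intro S T
    exact convHull_pvert_subset_iff hd S.1 T.1

theorem faceIso_facetFace {d : ℝ} (hd : 1 < d) (i : Fin 6) :
    (faceIso hd (exG.facetFace i) : Set S3) = polytope d ∩ sph {x | beta d i x = 0} :=
  (polytope_inter_eq_convHull hd (fun v => (incident_beta_vert hd).nonneg i v)
    (fun v => (incident_beta_vert hd).eq_zero_iff i v)).symm

/-! ### Dimensions of faces and the model realization -/

theorem span_coneOver_convHull (d : ℝ) (S : Finset (Fin 6)) :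
    Submodule.span ℝ (coneOver (convHull (pvert d '' S))) = Submodule.span ℝ (vert d '' S) := by
  apply le_antisymm
  · rw [Submodule.span_le]
    rintro y ⟨hy, hm⟩
    obtain ⟨c, hc, h0, rfl⟩ := (rayOf_mem_convHull_pvert d S hy).1 hm
    refine Submodule.sum_mem _ fun v _ => ?_
    by_cases hv : v ∈ S
    · exact Submodule.smul_mem _ _ (Submodule.subset_span ⟨v, hv, rfl⟩)
    · rw [h0 v hv, zero_smul]
      exact Submodule.zero_mem _
  · rw [Submodule.span_le]
    rintro _ ⟨v, hv, rfl⟩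
    refine Submodule.subset_span ⟨vert_ne_zero d v, ?_⟩
    rw [rayOf_mem_convHull_pvert]
    refine ⟨fun u => if u = v then 1 else 0, fun u => ?_, fun u hu => ?_, ?_⟩
    · dsimp only; split_ifs <;> simp
    · refine if_neg ?_
      rintro rfl
      exact hu hv
    · simp [ite_smul]

/-- The dimension of the span of a set of vertices. -/
noncomputable def spanRank (d : ℝ) (S : Finset (Fin 6)) : ℕ :=
  Module.finrank ℝ (Submodule.span ℝ (vert d '' S))

/-- The functional `faceFun d S` vanishes on the span of the face `S` but not at a vertex outside
it. -/
theorem spanRank_lt {d : ℝ} (hd : 1 < d) {S T : Finset (Fin 6)} {k : ℕ}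
    (hS : exG.IsFaceOfDim S k) (h : S ⊂ T) : spanRank d S < spanRank d T := by
  refine Submodule.finrank_lt_finrank_of_lt (lt_of_le_of_ne
    (Submodule.span_mono (Set.image_mono (Finset.coe_subset.2 h.1))) fun he => ?_)
  obtain ⟨v, hvT, hvS⟩ := Finset.exists_of_ssubset h
  refine hvS ((faceFun_vert_eq_zero_iff hd hS v).1 ?_)
  have hm : vert d v ∈ Submodule.span ℝ (vert d '' S) := by
    rw [he]
    exact Submodule.subset_span ⟨v, hvT, rfl⟩
  have hle : Submodule.span ℝ (vert d '' S) ≤ LinearMap.ker (faceFun d S).toLinearMap := by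
    rw [Submodule.span_le]
    rintro _ ⟨u, hu, rfl⟩
    exact (faceFun_vert_eq_zero_iff hd hS u).2 hu
  exact hle hm

theorem spanRank_le (d : ℝ) (S : Finset (Fin 6)) : spanRank d S ≤ 4 := by
  have := Submodule.finrank_le (Submodule.span ℝ (vert d '' S))
  simpa [spanRank] using this

theorem spanRank_singleton (d : ℝ) (v : Fin 6) : spanRank d {v} = 1 := by
  rw [spanRank, Finset.coe_singleton, Set.image_singleton]
  exact finrank_span_singleton (vert_ne_zero d v)

/-- Along a flag vertex, edge, facet, polytope the rank increases strictly from 1 and cannot exceed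
4, so every value is forced. -/
theorem spanRank_edge_facet {d : ℝ} (hd : 1 < d) {i j : Fin 6} (hij : exG.Adj i j) :
    spanRank d (exG.facet i ∩ exG.facet j) = 2 ∧ spanRank d (exG.facet i) = 3 ∧
      spanRank d Finset.univ = 4 := by
  obtain ⟨v, hv⟩ : ∃ v, v ∈ exG.facet i ∩ exG.facet j :=
    Finset.card_pos.1 (by rw [hij.2]; norm_num)
  have c1 : {v} ⊂ exG.facet i ∩ exG.facet j := by
    refine (Finset.ssubset_iff_subset_ne).2 ⟨Finset.singleton_subset_iff.2 hv, fun h => ?_⟩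
    have := hij.2
    rw [← h] at this
    simp at this
  have c2 : exG.facet i ∩ exG.facet j ⊂ exG.facet i := by
    refine (Finset.ssubset_iff_subset_ne).2 ⟨Finset.inter_subset_left, fun h => ?_⟩
    have := hij.2
    rw [h] at this
    exact (by decide : ∀ i, (exG.facet i).card ≠ 2) i this
  have c3 : exG.facet i ⊂ Finset.univ := (by decide : ∀ i, exG.facet i ⊂ Finset.univ) i
  have l1 := spanRank_lt hd (k := 0) ⟨v, rfl⟩ c1
  have l2 := spanRank_lt hd (k := 1) ⟨i, j, hij, rfl⟩ c2
  have l3 := spanRank_lt hd (k := 2) ⟨i, rfl⟩ c3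
  have l4 := spanRank_le d Finset.univ
  rw [spanRank_singleton] at l1
  omega

theorem spanRank_of_isFaceOfDim {d : ℝ} (hd : 1 < d) {S : Finset (Fin 6)} {k : ℕ}
    (hS : exG.IsFaceOfDim S k) : spanRank d S = k + 1 := by
  match k, hS with
  | 0, ⟨v, h⟩ => rw [h, spanRank_singleton]
  | 1, ⟨i, j, hij, h⟩ => rw [h, (spanRank_edge_facet hd hij).1]
  | 2, ⟨i, h⟩ =>
    obtain ⟨j, hij⟩ := (by decide : ∀ i, ∃ j, exG.Adj i j) i
    rw [h, (spanRank_edge_facet hd hij).2.1]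
  | 3, h =>
    have h : S = Finset.univ := h
    rw [h, (spanRank_edge_facet hd (by decide : exG.Adj 0 1)).2.2]

theorem hasDim_convHull_iff (d : ℝ) (S : Finset (Fin 6)) (k : ℕ) :
    HasDim (convHull (pvert d '' S)) k ↔ spanRank d S = k + 1 := by
  rw [HasDim, span_coneOver_convHull, spanRank]

theorem isConvexPolytope_polytope {d : ℝ} (hd : 1 < d) : IsConvexPolytope (polytope d) := by
  have hcl : closure (polytope d) = polytope d := (isClosed_pcone (beta d)).closure_eq
  -- All coordinates are nonnegative on `polytope d`, so their sum is positive at its points and the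
  -- slice where the sum equals 1 lies in the standard simplex.
  set α : StrongDual ℝ V := coord 0 + coord 1 + coord 2 + coord 3 with hα
  have hαx : ∀ x, α x = x 0 + x 1 + x 2 + x 3 := fun x => rfl
  have hα0 : α ≠ 0 := by
    intro h
    have := hαx ![1, 0, 0, 0]
    rw [h] at this
    simp at this
  have hch : polytope d ⊆ chart α := by
    refine subset_of_rayOf fun x hx h => ?_
    rw [rayOf_mem_polytope] at h
    rw [chart, rayOf_mem_sph_pos, hαx]
    have h0 := h 0
    have h1 := h 1
    have h2 := h 2
    have h3 := h 3
    rw [beta_zero] at h0; rw [beta_one] at h1; rw [beta_two] at h2; rw [beta_three] at h3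
    by_contra hneg
    exact hx (vec_ext (by simp; linarith) (by simp; linarith) (by simp; linarith)
      (by simp; linarith))
  have hmem : ∀ x, x ∈ inChart α (polytope d) ↔ α x = 1 ∧ ∀ i, 0 ≤ beta d i x := by
    intro x
    constructor
    · rintro ⟨h, hx, hm⟩
      exact ⟨h, (rayOf_mem_polytope d hx).1 hm⟩
    · rintro ⟨h, hm⟩
      have hx : x ≠ 0 := by
        rintro rfl
        simp at h
      exact ⟨h, hx, (rayOf_mem_polytope d hx).2 hm⟩
  have hconv : Convex ℝ (inChart α (polytope d)) := by
    intro x hx y hy a b ha hb hab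
    rw [hmem] at hx hy ⊢
    constructor
    · rw [map_add, map_smul, map_smul, hx.1, hy.1]
      simpa using hab
    · intro i
      rw [map_add, map_smul, map_smul, smul_eq_mul, smul_eq_mul]
      exact add_nonneg (mul_nonneg ha (hx.2 i)) (mul_nonneg hb (hy.2 i))
  refine ⟨⟨⟨α, hα0, hch, hconv⟩, ⟨α, hα0, ?_, ?_, ?_⟩⟩, ?_, 6, beta d,
    (incident_beta_vert hd).functional_ne_zero, rfl⟩
  · rwa [hcl]
  · rwa [hcl]
  · rw [hcl, Metric.isBounded_iff_subset_closedBall (0 : V)]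
    refine ⟨1, fun x hx => ?_⟩
    rw [hmem, hαx] at hx
    obtain ⟨h, hx⟩ := hx
    have h0 := hx 0
    have h1 := hx 1
    have h2 := hx 2
    have h3 := hx 3
    rw [beta_zero] at h0; rw [beta_one] at h1; rw [beta_two] at h2; rw [beta_three] at h3
    rw [mem_closedBall_zero_iff, pi_norm_le_iff_of_nonneg zero_le_one]
    intro i
    rw [Real.norm_eq_abs, abs_le]
    fin_cases i <;> simp <;> constructor <;> linarith
  · rw [interior_polytope hd]
    have hx : (![1, 2, 1, 1] : V) ≠ 0 := fun h => by simpa using congrFun h 0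
    refine ⟨rayOf _ hx, (rayOf_mem_pconePos _ hx).2 fun i => ?_⟩
    fin_cases i <;> simp [beta, coord]
    all_goals linarith

theorem isRealization_pvert {d : ℝ} (hd : 1 < d) : IsRealization exG (pvert d) := by
  rw [IsRealization, convHull_range_pvert hd]
  refine ⟨isConvexPolytope_polytope hd, ⟨faceIso hd⟩, fun S k => ?_⟩
  rw [isFace_polytope_iff hd, hasDim_convHull_iff]
  constructor
  · rintro ⟨⟨T, ⟨l, hT⟩, h⟩, hk⟩
    obtain rfl := convHull_pvert_injective hd h
    have := spanRank_of_isFaceOfDim hd hT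
    obtain rfl : k = l := by omega
    exact hT
  · intro h
    exact ⟨⟨S, ⟨k, h⟩, rfl⟩, spanRank_of_isFaceOfDim hd h⟩

/-- The model realization with parameter `d`. -/
noncomputable def stdRealization {d : ℝ} (hd : 1 < d) : PreRS exG := ⟨pvert d, isRealization_pvert hd⟩

/-! ### Normal form of an incidence configuration -/

/-- Up to a positive factor every linear automorphism has determinant `±1`. -/
theorem exists_SLpm_smul (g : V ≃ₗ[ℝ] V) :
    ∃ (t : ℝ) (h : SLpm), 0 < t ∧ ∀ x : V, h • x = t • g x := by
  set D := |LinearMap.det (g : V →ₗ[ℝ] V)| with hD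
  have hDpos : 0 < D := abs_pos.2 (LinearEquiv.isUnit_det' g).ne_zero
  -- In dimension 4 scaling by `t` multiplies the determinant by `t ^ 4`, so `t` is the fourth root
  -- of `1 / |det g|`.
  set t := Real.sqrt (Real.sqrt D⁻¹) with ht
  have htpos : 0 < t := Real.sqrt_pos.2 (Real.sqrt_pos.2 (inv_pos.2 hDpos))
  have ht4 : t ^ 4 = D⁻¹ := by
    have : t ^ 4 = (t ^ 2) ^ 2 := by ring
    rw [this, ht, Real.sq_sqrt (Real.sqrt_nonneg _), Real.sq_sqrt (inv_pos.2 hDpos).le]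
  set h : V ≃ₗ[ℝ] V := g.trans (LinearEquiv.smulOfNeZero ℝ V t htpos.ne') with hh
  have hcoe : (h : V →ₗ[ℝ] V) = t • (g : V →ₗ[ℝ] V) := by
    ext x
    rfl
  refine ⟨t, ⟨h, ?_⟩, htpos, fun x => rfl⟩
  change |LinearMap.det (h : V →ₗ[ℝ] V)| = 1
  rw [hcoe, LinearMap.det_smul, abs_mul]
  simp only [Module.finrank_fintype_fun_eq_card, Fintype.card_fin]
  rw [abs_of_pos (by positivity), ht4, ← hD, inv_mul_cancel₀ hDpos.ne']

theorem Incident.smul {α : Fin 6 → StrongDual ℝ V} {q : Fin 6 → V} (h : Incident α q)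
    {c : Fin 6 → ℝ} (hc : ∀ i, 0 < c i) : Incident (fun i => c i • α i) q := by
  intro i v
  refine ⟨fun hv => ?_, fun hv => ?_⟩
  · simp [(h i v).1 hv]
  · simpa using mul_pos (hc i) ((h i v).2 hv)

/-- The first four functionals are linear coordinates. -/
theorem Incident.exists_coordinates {α : Fin 6 → StrongDual ℝ V} {q : Fin 6 → V}
    (h : Incident α q) :
    ∃ g : V ≃ₗ[ℝ] V, ∀ x, g x 0 = α 0 x ∧ g x 1 = α 1 x ∧ g x 2 = α 2 x ∧ g x 3 = α 3 x := by
  set f : V →ₗ[ℝ] V := LinearMap.pi (![(α 0).toLinearMap, (α 1).toLinearMap, (α 2).toLinearMap,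
    (α 3).toLinearMap]) with hf
  have hf' : ∀ x, f x 0 = α 0 x ∧ f x 1 = α 1 x ∧ f x 2 = α 2 x ∧ f x 3 = α 3 x :=
    fun x => ⟨rfl, rfl, rfl, rfl⟩
  have p03 := (h 0 3).2 (by decide)
  have p10 := (h 1 0).2 (by decide)
  have p21 := (h 2 1).2 (by decide)
  have p32 := (h 3 2).2 (by decide)
  have z00 := (h 0 0).1 (by decide)
  have z01 := (h 0 1).1 (by decide)
  have z02 := (h 0 2).1 (by decide)
  have z11 := (h 1 1).1 (by decide)
  have z12 := (h 1 2).1 (by decide)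
  have z20 := (h 2 0).1 (by decide)
  have z22 := (h 2 2).1 (by decide)
  have z23 := (h 2 3).1 (by decide)
  have z30 := (h 3 0).1 (by decide)
  have z31 := (h 3 1).1 (by decide)
  have z33 := (h 3 3).1 (by decide)
  -- On `q 3, q 0, q 1, q 2` the first four functionals form a triangular system with positive
  -- diagonal; the preimage is its solution.
  have hsurj : Function.Surjective f := by
    intro y
    refine ⟨(y 0 / α 0 (q 3)) • q 3
      + ((y 1 - y 0 / α 0 (q 3) * α 1 (q 3)) / α 1 (q 0)) • q 0
      + (y 2 / α 2 (q 1)) • q 1 + (y 3 / α 3 (q 2)) • q 2, ?_⟩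
    obtain ⟨e0, e1, e2, e3⟩ := hf' ((y 0 / α 0 (q 3)) • q 3
      + ((y 1 - y 0 / α 0 (q 3) * α 1 (q 3)) / α 1 (q 0)) • q 0
      + (y 2 / α 2 (q 1)) • q 1 + (y 3 / α 3 (q 2)) • q 2)
    simp only [map_add, map_smul, smul_eq_mul, z00, z01, z02, z11, z12, z20, z22, z23, z30, z31,
      z33, mul_zero, add_zero, zero_add, div_mul_cancel₀ _ p03.ne', div_mul_cancel₀ _ p10.ne',
      div_mul_cancel₀ _ p21.ne', div_mul_cancel₀ _ p32.ne'] at e0 e1 e2 e3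
    refine vec_ext ?_ ?_ ?_ ?_ <;> simp only [map_add, map_smul]
    · rw [e0]
    · rw [e1]; ring
    · rw [e2]
    · rw [e3]
  exact ⟨LinearEquiv.ofBijective f ⟨LinearMap.injective_iff_surjective.2 hsurj, hsurj⟩, hf'⟩

/-- Every functional is a combination of the first four. -/
theorem Incident.exists_expansion {α : Fin 6 → StrongDual ℝ V} {q : Fin 6 → V}
    (h : Incident α q) (γ : StrongDual ℝ V) :
    ∃ k : Fin 4 → ℝ, ∀ x, γ x = k 0 * α 0 x + k 1 * α 1 x + k 2 * α 2 x + k 3 * α 3 x := by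
  obtain ⟨g, hg⟩ := h.exists_coordinates
  refine ⟨fun j => γ (g.symm (Pi.single j 1)), fun x => ?_⟩
  obtain ⟨h0, h1, h2, h3⟩ := hg x
  have := LinearMap.pi_apply_eq_sum_univ (γ.toLinearMap ∘ₗ (g.symm : V →ₗ[ℝ] V)) (g x)
  simp only [LinearMap.comp_apply, LinearEquiv.coe_coe, LinearEquiv.symm_apply_apply,
    Fin.sum_univ_four, h0, h1, h2, h3, smul_eq_mul] at this
  have hs : ∀ i : Fin 4, (fun j => if i = j then (1 : ℝ) else 0) = Pi.single i 1 := by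
    intro i
    ext j
    simp [Pi.single_apply, eq_comm]
  simp only [hs] at this
  change γ x = _ at this
  rw [this]
  simp only [ContinuousLinearMap.coe_coe]
  ring

/-- Write `α 4` and `α 5` in terms of the first four functionals with coefficients `k` and `l`. The
incidences at single vertices give `k 1, k 2, k 3, l 1, l 3 > 0`, `l 2 = 0` and `k 0 < 0`. Both
functionals vanish at `q 5`, which makes `(l 0, l 3)` proportional to `(k 0, k 3)`. Rescaling
therefore normalizes every coefficient except the one of `α 1` in `α 5`, which becomes `d`. -/
theorem Incident.exists_normal_form {α : Fin 6 → StrongDual ℝ V} {q : Fin 6 → V}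
    (h : Incident α q) :
    ∃ (d : ℝ) (g : SLpm) (c : Fin 6 → ℝ), 1 < d ∧ (∀ i, 0 < c i) ∧
      ∀ i x, beta d i (g • x) = c i * α i x := by
  obtain ⟨k, hk⟩ := h.exists_expansion (α 4)
  obtain ⟨l, hl⟩ := h.exists_expansion (α 5)
  have p03 := (h 0 3).2 (by decide)
  have p05 := (h 0 5).2 (by decide)
  have p10 := (h 1 0).2 (by decide)
  have p13 := (h 1 3).2 (by decide)
  have p21 := (h 2 1).2 (by decide)
  have p32 := (h 3 2).2 (by decide)
  have p35 := (h 3 5).2 (by decide)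
  have p40 := (h 4 0).2 (by decide)
  have p41 := (h 4 1).2 (by decide)
  have p42 := (h 4 2).2 (by decide)
  have p50 := (h 5 0).2 (by decide)
  have p52 := (h 5 2).2 (by decide)
  have p53 := (h 5 3).2 (by decide)
  have z43 := (h 4 3).1 (by decide)
  have z45 := (h 4 5).1 (by decide)
  have z51 := (h 5 1).1 (by decide)
  have z55 := (h 5 5).1 (by decide)
  have z00 := (h 0 0).1 (by decide)
  have z01 := (h 0 1).1 (by decide)
  have z02 := (h 0 2).1 (by decide)
  have z11 := (h 1 1).1 (by decide)
  have z12 := (h 1 2).1 (by decide)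
  have z15 := (h 1 5).1 (by decide)
  have z20 := (h 2 0).1 (by decide)
  have z22 := (h 2 2).1 (by decide)
  have z23 := (h 2 3).1 (by decide)
  have z25 := (h 2 5).1 (by decide)
  have z30 := (h 3 0).1 (by decide)
  have z31 := (h 3 1).1 (by decide)
  have z33 := (h 3 3).1 (by decide)
  rw [hk] at p40 p41 p42 z43 z45
  rw [hl] at p50 p52 p53 z51 z55
  simp only [z00, z01, z02, z11, z12, z15, z20, z22, z23, z25, z30, z31, z33, mul_zero, zero_add,
    add_zero] at p40 p41 p42 z43 z45 p50 p52 p53 z51 z55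
  have k1 : 0 < k 1 := pos_of_mul_pos_left p40 p10.le
  have k2 : 0 < k 2 := pos_of_mul_pos_left p41 p21.le
  have k3 : 0 < k 3 := pos_of_mul_pos_left p42 p32.le
  have l1 : 0 < l 1 := pos_of_mul_pos_left p50 p10.le
  have l3 : 0 < l 3 := pos_of_mul_pos_left p52 p32.le
  have l2 : l 2 = 0 := (mul_eq_zero.1 z51).resolve_right p21.ne'
  have k0 : k 0 < 0 := by
    by_contra hneg
    have := mul_nonneg (not_lt.1 hneg) p03.le
    have := mul_pos k1 p13
    linarith
  have l0 : k 3 * l 0 = l 3 * k 0 := by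
    have : α 0 (q 5) * (k 3 * l 0 - l 3 * k 0) = 0 := by
      linear_combination k 3 * z55 - l 3 * z45
    rcases mul_eq_zero.1 this with h | h
    · exact absurd h p05.ne'
    · linarith
  have l0' : k 3 / l 3 * l 0 = k 0 := by
    field_simp
    linarith
  set d := k 3 * l 1 / (l 3 * k 1) with hd
  -- Since `α 4` vanishes at `q 3` and `α 5` is positive there, the coefficient of `α 1` in the
  -- rescaled `α 5` exceeds the one in `α 4`.
  have hd1 : 1 < d := by
    rw [hd, one_lt_div (by positivity)]
    have e1 : 0 < k 1 * (l 0 * α 0 (q 3) + l 1 * α 1 (q 3)) * k 3 := by positivity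
    have e2 : k 1 * (l 0 * α 0 (q 3) + l 1 * α 1 (q 3)) * k 3
        = k 1 * α 1 (q 3) * (k 3 * l 1 - l 3 * k 1) := by
      linear_combination k 1 * α 0 (q 3) * l0 + l 3 * k 1 * z43
    rw [e2] at e1
    have := pos_of_mul_pos_right e1 (mul_pos k1 p13).le
    linarith
  set c : Fin 6 → ℝ := ![-k 0, k 1, k 2, k 3, 1, k 3 / l 3] with hc
  have hcpos : ∀ i, 0 < c i := by
    intro i
    fin_cases i
    · exact neg_pos.2 k0
    · exact k1
    · exact k2
    · exact k3
    · exact one_pos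
    · exact div_pos k3 l3
  obtain ⟨g, hg⟩ := (h.smul hcpos).exists_coordinates
  obtain ⟨t, u, ht, hu⟩ := exists_SLpm_smul g
  refine ⟨d, u, fun i => t * c i, hd1, fun i => mul_pos ht (hcpos i), fun i x => ?_⟩
  rw [hu, map_smul, smul_eq_mul, mul_assoc]
  congr 1
  obtain ⟨h0, h1, h2, h3⟩ := hg x
  change g x 0 = -k 0 * α 0 x at h0
  change g x 1 = k 1 * α 1 x at h1
  change g x 2 = k 2 * α 2 x at h2
  change g x 3 = k 3 * α 3 x at h3
  fin_cases i
  · exact h0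
  · exact h1
  · exact h2
  · exact h3
  · change beta d 4 (g x) = 1 * α 4 x
    rw [beta_four, h0, h1, h2, h3, hk]
    ring
  · change beta d 5 (g x) = k 3 / l 3 * α 5 x
    rw [beta_five, h0, h1, h3, hl, hd, l2]
    have e : k 3 / l 3 * (l 0 * α 0 x + l 1 * α 1 x + 0 * α 2 x + l 3 * α 3 x)
        = (k 3 / l 3 * l 0) * α 0 x + k 3 / l 3 * l 1 * α 1 x + k 3 / l 3 * l 3 * α 3 x := by ring
    rw [e, l0']
    field_simp

/-- A transformation taking the functionals to the model functionals takes the points to the model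
vertices. -/
theorem Incident.smul_eq_smul_vert {α : Fin 6 → StrongDual ℝ V} {q : Fin 6 → V}
    (h : Incident α q) {d : ℝ} {g : SLpm} {c : Fin 6 → ℝ} (hc : ∀ i, 0 < c i)
    (hg : ∀ i x, beta d i (g • x) = c i * α i x) (v : Fin 6) :
    ∃ t : ℝ, 0 < t ∧ g • q v = t • vert d v := by
  refine eq_smul_vert (fun i hi => ?_) fun i hi => ?_
  · rw [hg, (h i v).1 hi, mul_zero]
  · rw [hg]
    exact mul_pos (hc i) ((h i v).2 hi)

/-- A transformation taking the functionals to the model functionals takes the cone to the model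
polytope. -/
theorem smul_pcone_eq_polytope {α : Fin 6 → StrongDual ℝ V} {d : ℝ} {g : SLpm} {c : Fin 6 → ℝ}
    (hc : ∀ i, 0 < c i) (hg : ∀ i x, beta d i (g • x) = c i * α i x) :
    g • pcone α = polytope d := by
  refine set_ext_rayOf fun x hx => ?_
  rw [rayOf_mem_smul_set, rayOf_mem_pcone, rayOf_mem_polytope]
  refine forall_congr' fun i => ?_
  have := hg i (g⁻¹ • x)
  rw [smul_inv_smul] at this
  rw [this, mul_nonneg_iff_of_pos_left (hc i)]

/-- The cone of an incidence configuration is generated by its points. -/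
theorem Incident.exists_nonneg_comb {α : Fin 6 → StrongDual ℝ V} {q : Fin 6 → V}
    (h : Incident α q) {y : V} (hy : ∀ i, 0 ≤ α i y) :
    ∃ e : Fin 6 → ℝ, (∀ v, 0 ≤ e v) ∧ y = ∑ v, e v • q v := by
  obtain ⟨d, g, c, hd, hc, hg⟩ := h.exists_normal_form
  obtain ⟨e, he, h'⟩ := CoxDef.exists_nonneg_comb hd (y := g • y) fun i => by
    rw [hg]
    exact mul_nonneg (hc i).le (hy i)
  choose t ht hq using h.smul_eq_smul_vert hc hg
  refine ⟨fun v => e v / t v, fun v => div_nonneg (he v) (ht v).le, ?_⟩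
  have : y = g⁻¹ • (g • y) := (inv_smul_smul g y).symm
  rw [this, h', Finset.smul_sum]
  refine Finset.sum_congr rfl fun v _ => ?_
  dsimp only
  rw [smul_comm, div_eq_mul_inv, mul_smul]
  congr 1
  rw [inv_smul_eq_iff, smul_comm, hq, smul_smul, inv_mul_cancel₀ (ht v).ne', one_smul]

/-! ### The realization space -/

theorem mem_convHull_range_self (p : Fin 6 → S3) (S : Finset (Fin 6)) {v : Fin 6} (hv : v ∈ S) :
    p v ∈ convHull (p '' S) := by
  obtain ⟨x, hx, h⟩ := exists_rayOf (p v)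
  exact ⟨x, hx, subset_convexHull ℝ _ ⟨hx, v, hv, h.symm⟩, h⟩

theorem convHull_insert {ι : Type*} [Fintype ι] [DecidableEq ι] {q : ι → V} (hq : ∀ v, q v ≠ 0)
    {S : Finset ι} {v : ι}
    (hv : rayOf (q v) (hq v) ∈ convHull ((fun v => rayOf (q v) (hq v)) '' S)) :
    convHull ((fun v => rayOf (q v) (hq v)) '' (insert v S : Finset ι))
      = convHull ((fun v => rayOf (q v) (hq v)) '' S) := by
  rw [rayOf_mem_convHull_image hq] at hv
  obtain ⟨c, hc, hc0, hcv⟩ := hv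
  refine set_ext_rayOf fun y hy => ?_
  rw [rayOf_mem_convHull_image hq, rayOf_mem_convHull_image hq]
  constructor
  · rintro ⟨e, he, he0, rfl⟩
    by_cases hvS : v ∈ S
    · exact ⟨e, he, fun u hu => he0 u (by rwa [Finset.insert_eq_of_mem hvS]), rfl⟩
    refine ⟨fun u => (if u = v then 0 else e u) + e v * c u, fun u => ?_, fun u hu => ?_, ?_⟩
    · have := mul_nonneg (he v) (hc u)
      have := he u
      dsimp only
      split_ifs <;> linarith
    · dsimp only
      rw [hc0 u hu, mul_zero, add_zero]
      split_ifs with h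
      · rfl
      · exact he0 u fun hu' => (Finset.mem_insert.1 hu').elim h hu
    · simp only [add_smul, Finset.sum_add_distrib, mul_smul]
      rw [← Finset.smul_sum, ← hcv, ← Finset.add_sum_erase Finset.univ (fun u => e u • q u)
        (Finset.mem_univ v), add_comm, ← Finset.add_sum_erase Finset.univ
        (fun u => (if u = v then 0 else e u) • q u) (Finset.mem_univ v)]
      simp only [if_true, zero_smul, zero_add]
      congr 1
      refine Finset.sum_congr rfl fun u hu => ?_
      rw [if_neg (Finset.ne_of_mem_erase hu)]
  · rintro ⟨e, he, he0, h⟩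
    exact ⟨e, he, fun u hu => he0 u fun h => hu (Finset.mem_insert_of_mem h), h⟩

/-- Each facet has a supporting functional. If it vanished at a vertex not belonging to the facet,
adding that vertex would not change the convex hull (`convHull_insert`), so the enlarged set would
also be the vertex set of a 2-dimensional face, although it is not a facet of `exG`. -/
theorem IsRealization.exists_incident {p : Fin 6 → S3} (hp : IsRealization exG p) :
    ∃ (α : Fin 6 → StrongDual ℝ V) (q : Fin 6 → V) (hq : ∀ v, q v ≠ 0),
      Incident α q ∧ p = fun v => rayOf (q v) (hq v) := by
  choose q hq h using fun v => exists_rayOf (p v)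
  obtain rfl : p = fun v => rayOf (q v) (hq v) := funext fun v => (h v).symm
  obtain ⟨-, -, hp⟩ := hp
  have hface : ∀ i, ∃ α : StrongDual ℝ V, ∀ v, (v ∈ exG.facet i → α (q v) = 0) ∧
      (v ∉ exG.facet i → 0 < α (q v)) := by
    intro i
    have hi := (hp (exG.facet i) 2).2 ⟨i, rfl⟩
    obtain ⟨⟨hne, α, hα, hF⟩, hdim⟩ := hi
    refine ⟨α, fun v => ⟨fun hv => ?_, fun hv => ?_⟩⟩
    · have := mem_convHull_range_self (fun v => rayOf (q v) (hq v)) _ hv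
      rw [hF] at this
      exact (rayOf_mem_sph_zero α (hq v)).1 this.2
    · have hmem : rayOf (q v) (hq v) ∈ convHull (Set.range fun v => rayOf (q v) (hq v)) := by
        rw [← Set.image_univ, ← Finset.coe_univ]
        exact mem_convHull_range_self (fun v => rayOf (q v) (hq v)) _ (Finset.mem_univ v)
      refine lt_of_le_of_ne (nonneg_of_mem (hq v) (hα hmem)) fun h0 => ?_
      have hv' : rayOf (q v) (hq v)
          ∈ convHull ((fun v => rayOf (q v) (hq v)) '' (exG.facet i : Finset (Fin 6))) := by
        rw [hF]
        exact ⟨hmem, (rayOf_mem_sph_zero α (hq v)).2 h0.symm⟩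
      have := (hp (insert v (exG.facet i)) 2).1 (by
        rw [convHull_insert hq hv']
        exact ⟨⟨hne, α, hα, hF⟩, hdim⟩)
      obtain ⟨j, hj⟩ := this
      exact (by decide : ∀ i v, v ∉ exG.facet i → ∀ j, insert v (exG.facet i) ≠ exG.facet j)
        i v hv j hj
  choose α hα using hface
  exact ⟨α, q, hq, hα, rfl⟩

theorem IsRealization.exists_smul_eq_pvert {p : Fin 6 → S3} (hp : IsRealization exG p) :
    ∃ (d : ℝ) (g : SLpm), 1 < d ∧ ∀ v, g • p v = pvert d v := by
  obtain ⟨α, q, hq, h, rfl⟩ := hp.exists_incident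
  obtain ⟨d, g, c, hd, hc, hg⟩ := h.exists_normal_form
  refine ⟨d, g, hd, fun v => ?_⟩
  obtain ⟨t, ht, e⟩ := h.smul_eq_smul_vert hc hg v
  rw [smul_rayOf]
  exact ((rayOf_eq_iff _ _).2 ⟨t, ht, e⟩).symm

/-- The determinant of four of the vectors `n`. -/
noncomputable def bracket (n : Fin 6 → V) (σ : Fin 4 → Fin 6) : ℝ :=
  Matrix.det (Matrix.of fun i => n (σ i))

theorem bracket_eq (n m : Fin 6 → V) (s : Fin 6 → ℝ) (g : SLpm) (h : ∀ v, n v = s v • g • m v)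
    (σ : Fin 4 → Fin 6) :
    bracket n σ = (∏ i, s (σ i)) * LinearMap.det (g.1 : V →ₗ[ℝ] V) * bracket m σ := by
  have e1 : ∀ k : Fin 6 → V, bracket k σ = (Pi.basisFun ℝ (Fin 4)).det (fun i => k (σ i)) := by
    intro k
    rw [Pi.basisFun_det_apply]
    rfl
  rw [e1, e1, mul_assoc, ← Module.Basis.det_comp]
  have : (fun i => n (σ i)) = fun i => s (σ i) • (fun i => g • m (σ i)) i := by
    funext i
    rw [h]
  rw [this, AlternatingMap.map_smul_univ, smul_eq_mul]
  rfl

/-- The parameter of a realization, computed from vectors representing its points. -/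
noncomputable def crossParam (n : Fin 6 → V) : ℝ :=
  bracket n ![4, 0, 1, 2] * bracket n ![5, 1, 2, 3] /
    (bracket n ![4, 0, 1, 2] * bracket n ![5, 1, 2, 3]
      - bracket n ![4, 1, 2, 3] * bracket n ![5, 0, 1, 2])

theorem bracket_vert (d : ℝ) : bracket (vert d) ![4, 0, 1, 2] = d ∧
    bracket (vert d) ![5, 1, 2, 3] = 1 ∧ bracket (vert d) ![4, 1, 2, 3] = d - 1 ∧
    bracket (vert d) ![5, 0, 1, 2] = 1 := by
  refine ⟨?_, ?_, ?_, ?_⟩ <;>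
  simp [bracket, Matrix.det_succ_row_zero, Fin.sum_univ_succ, vert, Fin.succAbove]
  ring

/-- Both products of brackets contain each vertex equally often, so by `bracket_eq` the scalings and
the determinant of `g` enter them through the same nonzero factor. For the model vertices the
products are `d` and `d - 1`, whence the quotient is `d / (d - (d - 1))`. The nonvanishing of the
denominator is kept for continuity. -/
theorem crossParam_spec {p : Fin 6 → S3} {d : ℝ} {g : SLpm} (h : ∀ v, g • p v = pvert d v) :
    bracket (fun v => unitVec (p v)) ![4, 0, 1, 2] * bracket (fun v => unitVec (p v)) ![5, 1, 2, 3]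
      - bracket (fun v => unitVec (p v)) ![4, 1, 2, 3]
        * bracket (fun v => unitVec (p v)) ![5, 0, 1, 2] ≠ 0 ∧
    crossParam (fun v => unitVec (p v)) = d := by
  have hs : ∀ v, ∃ s : ℝ, 0 < s ∧ unitVec (p v) = s • g⁻¹ • vert d v := by
    intro v
    have : p v = rayOf (g⁻¹ • vert d v) (smul_ne_zero_of_SLpm g⁻¹ (vert_ne_zero d v)) := by
      rw [← smul_rayOf g⁻¹ (vert_ne_zero d v), eq_inv_smul_iff]
      exact h v
    rw [this]
    exact exists_unitVec_eq _
  choose s hs0 hs using hs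
  obtain ⟨b1, b2, b3, b4⟩ := bracket_vert d
  have hdet : LinearMap.det ((g⁻¹).1 : V →ₗ[ℝ] V) ≠ 0 := (LinearEquiv.isUnit_det' _).ne_zero
  set D := LinearMap.det ((g⁻¹).1 : V →ₗ[ℝ] V)
  have hne := fun v => (hs0 v).ne'
  rw [crossParam]
  simp only [bracket_eq _ _ s g⁻¹ hs, b1, b2, b3, b4, Fin.prod_univ_four]
  change (s 4 * s 0 * s 1 * s 2 * D * d * (s 5 * s 1 * s 2 * s 3 * D * 1)
    - s 4 * s 1 * s 2 * s 3 * D * (d - 1) * (s 5 * s 0 * s 1 * s 2 * D * 1)) ≠ 0 ∧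
    s 4 * s 0 * s 1 * s 2 * D * d * (s 5 * s 1 * s 2 * s 3 * D * 1) /
    (s 4 * s 0 * s 1 * s 2 * D * d * (s 5 * s 1 * s 2 * s 3 * D * 1)
    - s 4 * s 1 * s 2 * s 3 * D * (d - 1) * (s 5 * s 0 * s 1 * s 2 * D * 1)) = d
  have e : s 4 * s 0 * s 1 * s 2 * D * d * (s 5 * s 1 * s 2 * s 3 * D * 1)
    - s 4 * s 1 * s 2 * s 3 * D * (d - 1) * (s 5 * s 0 * s 1 * s 2 * D * 1)
    = s 0 * s 1 ^ 2 * s 2 ^ 2 * s 3 * s 4 * s 5 * D ^ 2 := by ring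
  have e0 : s 0 * s 1 ^ 2 * s 2 ^ 2 * s 3 * s 4 * s 5 * D ^ 2 ≠ 0 := by
    simp [hne, hdet]
  rw [e]
  refine ⟨e0, ?_⟩
  rw [div_eq_iff e0]
  ring

theorem continuous_bracket (σ : Fin 4 → Fin 6) :
    Continuous fun p : PreRS exG => bracket (fun v => unitVec (p.1 v)) σ := by
  unfold bracket
  refine Continuous.matrix_det (continuous_pi fun i => ?_)
  exact continuous_unitVec.comp ((continuous_apply (σ i)).comp continuous_subtype_val)

/-- The parameter `d` of a realization. -/
noncomputable def realizationParam (p : PreRS exG) : ℝ := crossParam fun v => unitVec (p.1 v)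

theorem realizationParam_eq {p : PreRS exG} {d : ℝ} {g : SLpm} (h : ∀ v, g • p.1 v = pvert d v) :
    realizationParam p = d := (crossParam_spec h).2

theorem one_lt_realizationParam (p : PreRS exG) : 1 < realizationParam p := by
  obtain ⟨d, g, hd, h⟩ := p.2.exists_smul_eq_pvert
  rwa [realizationParam_eq h]

theorem continuous_realizationParam : Continuous realizationParam := by
  unfold realizationParam crossParam
  refine Continuous.div ((continuous_bracket _).mul (continuous_bracket _))
    (((continuous_bracket _).mul (continuous_bracket _)).sub
      ((continuous_bracket _).mul (continuous_bracket _))) fun p => ?_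
  obtain ⟨d, g, hd, h⟩ := p.2.exists_smul_eq_pvert
  exact (crossParam_spec h).1

theorem continuous_vert (v : Fin 6) : Continuous fun d => vert d v := by
  refine continuous_pi fun i => ?_
  fin_cases v <;> fin_cases i <;> simp [vert] <;> fun_prop

theorem realizationParam_congr (p q : PreRS exG) (h : realizationSetoid exG p q) :
    realizationParam p = realizationParam q := by
  obtain ⟨A, hA⟩ := h
  obtain ⟨d, g, hd, h⟩ := q.2.exists_smul_eq_pvert
  rw [realizationParam_eq h, realizationParam_eq (g := g * A) (d := d)]
  intro v
  rw [mul_smul, ← hA, h]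

theorem mk_eq_mk_stdRealization {p : PreRS exG} {d : ℝ} (hd : 1 < d) {g : SLpm}
    (h : ∀ v, g • p.1 v = pvert d v) :
    (Quotient.mk _ p : RealizationSpace exG) = Quotient.mk _ (stdRealization hd) :=
  Quotient.sound (s := realizationSetoid exG) ⟨g, fun v => (h v).symm⟩

/-- The class of the model realization. -/
noncomputable def realizationClass (d : Set.Ioi (1 : ℝ)) : RealizationSpace exG :=
  Quotient.mk _ (stdRealization d.2)

/-- The parameter of a class of realizations. -/
noncomputable def classParam : RealizationSpace exG → Set.Ioi (1 : ℝ) :=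
  Quotient.lift (fun p => ⟨realizationParam p, one_lt_realizationParam p⟩)
    fun p q h => Subtype.ext (realizationParam_congr p q h)

theorem classParam_realizationClass (d : Set.Ioi (1 : ℝ)) :
    classParam (realizationClass d) = d :=
  Subtype.ext (realizationParam_eq (g := 1) fun _ => one_smul _ _)

theorem exists_realizationClass_eq (s : RealizationSpace exG) : ∃ d, realizationClass d = s := by
  obtain ⟨p, rfl⟩ := Quotient.exists_rep s
  obtain ⟨d, g, hd, h⟩ := p.2.exists_smul_eq_pvert
  exact ⟨⟨d, hd⟩, (mk_eq_mk_stdRealization hd h).symm⟩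

theorem continuous_stdRealization :
    Continuous fun d : Set.Ioi (1 : ℝ) => stdRealization d.2 := by
  refine Continuous.subtype_mk (continuous_pi fun v => ?_) _
  exact continuous_rayOf.comp (Continuous.subtype_mk
    ((continuous_vert v).comp continuous_subtype_val) fun d : Set.Ioi (1 : ℝ) =>
      vert_ne_zero d.1 v)

/-- The realization space of `exG` is an open interval. -/
noncomputable def realizationHomeo : Set.Ioi (1 : ℝ) ≃ₜ RealizationSpace exG where
  toFun := realizationClass
  invFun := classParam
  left_inv := classParam_realizationClass
  right_inv s := by
    obtain ⟨d, rfl⟩ := exists_realizationClass_eq s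
    rw [classParam_realizationClass]
  continuous_toFun := continuous_quotient_mk'.comp continuous_stdRealization
  continuous_invFun :=
    Continuous.quotient_lift (Continuous.subtype_mk continuous_realizationParam _) _

/-! ### Tits' criterion for the disjointness of the translates of a chamber -/

section Tits

variable {ι : Type*} {Γ : Type*} [Group Γ] (s : ι → Γ)

/-- `g` is a product of at most `n` generators with indices in `J`. -/
def WordLe (J : Set ι) (n : ℕ) (g : Γ) : Prop :=
  ∃ l : List ι, (∀ i ∈ l, i ∈ J) ∧ l.length ≤ n ∧ (l.map s).prod = g

variable {s}

theorem WordLe.one (J : Set ι) (n : ℕ) : WordLe s J n 1 := ⟨[], by simp, by simp, by simp⟩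

theorem WordLe.mono {J K : Set ι} {n m : ℕ} {g : Γ} (h : WordLe s J n g) (hJ : J ⊆ K)
    (hn : n ≤ m) : WordLe s K m g := by
  obtain ⟨l, h1, h2, h3⟩ := h
  exact ⟨l, fun i hi => hJ (h1 i hi), h2.trans hn, h3⟩

theorem WordLe.cons {J : Set ι} {n : ℕ} {g : Γ} (h : WordLe s J n g) {i : ι} (hi : i ∈ J) :
    WordLe s J (n + 1) (s i * g) := by
  obtain ⟨l, h1, h2, h3⟩ := h
  refine ⟨i :: l, ?_, by simpa using h2, by simp [h3]⟩
  simpa [hi] using h1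

theorem WordLe.mul {J : Set ι} {n m : ℕ} {g h : Γ} (hg : WordLe s J n g) (hh : WordLe s J m h) :
    WordLe s J (n + m) (g * h) := by
  obtain ⟨l, h1, h2, h3⟩ := hg
  obtain ⟨l', k1, k2, k3⟩ := hh
  refine ⟨l ++ l', ?_, by simp; omega, by simp [h3, k3]⟩
  intro i hi
  rcases List.mem_append.1 hi with hi | hi
  exacts [h1 i hi, k1 i hi]

theorem WordLe.cases {J : Set ι} {n : ℕ} {g : Γ} (h : WordLe s J n g) :
    g = 1 ∨ ∃ m, n = m + 1 ∧ ∃ i ∈ J, ∃ g', WordLe s J m g' ∧ g = s i * g' := by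
  obtain ⟨l, h1, h2, rfl⟩ := h
  cases l with
  | nil => exact Or.inl (by simp)
  | cons i l =>
    right
    simp only [List.length_cons] at h2
    obtain ⟨m, rfl⟩ : ∃ m, n = m + 1 := ⟨n - 1, by omega⟩
    exact ⟨m, rfl, i, h1 i (by simp), _, ⟨l, fun j hj => h1 j (by simp [hj]), by omega, rfl⟩,
      by simp⟩

variable {E : Type*} [MulAction Γ E] {A : ι → Set E}

/-- The condition of Tits on the subgroup generated by two reflections. -/
def TitsPair (s : ι → Γ) (A : ι → Set E) (i j : ι) : Prop :=
  ∀ n u, WordLe s {i, j} n u →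
    (∀ x ∈ A i ∩ A j, u • x ∈ A i) ∨
    ((∀ x ∈ A i ∩ A j, s i • u • x ∈ A i) ∧ ∃ m, n = m + 1 ∧ WordLe s {i, j} m (s i * u))

/-- The global statement for words of length at most `n`. -/
def TitsHalf (s : ι → Γ) (A : ι → Set E) (n : ℕ) : Prop :=
  ∀ w, WordLe s Set.univ n w → ∀ i,
    (∀ x ∈ ⋂ k, A k, w • x ∈ A i) ∨
    ((∀ x ∈ ⋂ k, A k, s i • w • x ∈ A i) ∧ ∃ m, n = m + 1 ∧ WordLe s Set.univ m (s i * w))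

/-- The factorization through a dihedral subgroup for words of length at most `n`. -/
def TitsFactor (s : ι → Γ) (A : ι → Set E) (n : ℕ) : Prop :=
  ∀ w, WordLe s Set.univ n w → ∀ i j, i ≠ j → ∃ u k m, k + m ≤ n ∧ WordLe s {i, j} k u ∧
    WordLe s Set.univ m (u⁻¹ * w) ∧ ∀ x ∈ ⋂ k, A k, u⁻¹ • w • x ∈ A i ∩ A j

/-- The simultaneous induction of Tits. For the half-space statement, a word of length `n + 1` is `s
j * w'`. If `j = i`, the statement for `w'` suffices. Otherwise `w'` is factored through the
dihedral subgroup of `i` and `j` so that the other factor maps the chamber into `A i ∩ A j`, where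
the hypothesis on pairs applies. The factorization follows in turn: if the image of the chamber is
not in `A i ∩ A j`, multiplication by `s i` or `s j` shortens the word and the shorter word is
already factored. -/
theorem tits_induction (hs : ∀ i, s i * s i = 1) (hpair : ∀ i j, i ≠ j → TitsPair s A i j) (n : ℕ) :
    TitsHalf s A n ∧ TitsFactor s A n := by
  have hss : ∀ i g, s i * (s i * g) = g := fun i g => by rw [← mul_assoc, hs, one_mul]
  have hsa : ∀ i (x : E), s i • s i • x = x := fun i x => by rw [← mul_smul, hs, one_smul]
  have hinv : ∀ i, (s i)⁻¹ = s i := fun i => inv_eq_of_mul_eq_one_left (hs i)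
  induction n with
  | zero =>
    constructor
    · intro w hw i
      rcases hw.cases with rfl | ⟨m, hm, -⟩
      · left
        intro x hx
        rw [one_smul]
        exact Set.mem_iInter.1 hx i
      · omega
    · intro w hw i j _
      rcases hw.cases with rfl | ⟨m, hm, -⟩
      · refine ⟨1, 0, 0, by omega, WordLe.one _ _, by simpa using WordLe.one _ _, fun x hx => ?_⟩
        simp only [inv_one, one_smul]
        exact ⟨Set.mem_iInter.1 hx i, Set.mem_iInter.1 hx j⟩
      · omega
  | succ n ih =>
    obtain ⟨hP, hQ⟩ := ih
    have hP' : TitsHalf s A (n + 1) := by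
      intro w hw i
      rcases hw.cases with rfl | ⟨m, hm, j, -, w', hw', rfl⟩
      · left
        intro x hx
        rw [one_smul]
        exact Set.mem_iInter.1 hx i
      obtain rfl : m = n := by omega
      by_cases hij : j = i
      · subst hij
        rcases hP w' hw' j with h | ⟨h, -⟩
        · right
          refine ⟨fun x hx => ?_, m, rfl, by rwa [hss]⟩
          rw [mul_smul, hsa]
          exact h x hx
        · left
          intro x hx
          rw [mul_smul]
          exact h x hx
      · obtain ⟨u, k, l, hkl, hu, hl, hx⟩ := hQ w' hw' i j (Ne.symm hij)
        have hux : ∀ x : E, (s j * u) • u⁻¹ • w' • x = (s j * w') • x := by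
          intro x
          rw [mul_smul, smul_inv_smul, mul_smul]
        -- The dihedral part of `s j * w'` is `s j * u`. If `s i` shortens it, composing with the
        -- word for `u⁻¹ * w'` shows that `s i` shortens the whole word.
        rcases hpair i j (Ne.symm hij) (k + 1) (s j * u) (hu.cons (by simp)) with
          h | ⟨h, k', hk', hw2⟩
        · left
          intro x hxA
          rw [← hux]
          exact h _ (hx x hxA)
        · right
          refine ⟨fun x hxA => ?_, m, rfl, ?_⟩
          · rw [← hux]
            exact h _ (hx x hxA)
          · have := (hw2.mono (Set.subset_univ _) (show k' ≤ k by omega)).mul hl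
            have e : s i * (s j * u) * (u⁻¹ * w') = s i * (s j * w') := by group
            rw [e] at this
            exact this.mono subset_rfl hkl
    refine ⟨hP', ?_⟩
    -- A factorization of `s a * w` with `a ∈ {i, j}` becomes one of `w` when `s a` is put in front
    -- of the dihedral factor.
    have step : ∀ w i j a, i ≠ j → (a = i ∨ a = j) → WordLe s Set.univ n (s a * w) →
        ∃ u k m, k + m ≤ n + 1 ∧ WordLe s {i, j} k u ∧
          WordLe s Set.univ m (u⁻¹ * w) ∧ ∀ x ∈ ⋂ k, A k, u⁻¹ • w • x ∈ A i ∩ A j := by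
      intro w i j a hij ha hw
      obtain ⟨v, k, l, hkl, hv, hl, hx⟩ := hQ _ hw i j hij
      refine ⟨s a * v, k + 1, l, by omega, hv.cons (by simpa using ha), ?_, fun x hxA => ?_⟩
      · rwa [mul_inv_rev, hinv, mul_assoc]
      · rw [mul_inv_rev, hinv, mul_smul, ← mul_smul (s a) w]
        exact hx x hxA
    intro w hw i j hij
    rcases hP' w hw i with hi | ⟨-, m, hm, hi⟩
    · rcases hP' w hw j with hj | ⟨-, m, hm, hj⟩
      · refine ⟨1, 0, n + 1, by omega, WordLe.one _ _, by simpa using hw, fun x hx => ?_⟩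
        simp only [inv_one, one_smul]
        exact ⟨hi x hx, hj x hx⟩
      · obtain rfl : m = n := by omega
        exact step w i j j hij (Or.inr rfl) hj
    · obtain rfl : m = n := by omega
      exact step w i j i hij (Or.inl rfl) hi

theorem exists_wordLe_of_mem_closure (hs : ∀ i, s i * s i = 1) {g : Γ}
    (hg : g ∈ Subgroup.closure (Set.range s)) : ∃ n, WordLe s Set.univ n g := by
  have hinv : ∀ i, (s i)⁻¹ = s i := fun i => inv_eq_of_mul_eq_one_left (hs i)
  induction hg using Subgroup.closure_induction_left with
  | one => exact ⟨0, WordLe.one _ _⟩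
  | mul_left x hx y _ ih =>
    obtain ⟨i, rfl⟩ := hx
    obtain ⟨n, hn⟩ := ih
    exact ⟨n + 1, hn.cons (Set.mem_univ i)⟩
  | inv_mul_cancel x hx y _ ih =>
    obtain ⟨i, rfl⟩ := hx
    obtain ⟨n, hn⟩ := ih
    rw [hinv]
    exact ⟨n + 1, hn.cons (Set.mem_univ i)⟩

/-- A nontrivial element moves the chamber across one of its walls. -/
theorem exists_wall_of_ne_one (hs : ∀ i, s i * s i = 1)
    (hpair : ∀ i j, i ≠ j → TitsPair s A i j) {g : Γ}
    (hg : g ∈ Subgroup.closure (Set.range s)) (hg1 : g ≠ 1) :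
    ∃ i, ∀ x ∈ ⋂ k, A k, s i • g • x ∈ A i := by
  classical
  have hex := exists_wordLe_of_mem_closure hs hg
  have hss : ∀ i g, s i * (s i * g) = g := fun i g => by rw [← mul_assoc, hs, one_mul]
  rcases (Nat.find_spec hex).cases with h | ⟨m, hm, i, -, g', hg', e⟩
  · exact absurd h hg1
  -- The word for `g` has minimal length and `i` is its first letter. The second alternative would
  -- give `g = s i * g'` a shorter word.
  · rcases (tits_induction hs hpair m).1 g' hg' i with h | ⟨-, l, hl, hw⟩
    · refine ⟨i, fun x hx => ?_⟩
      rw [e, ← mul_smul, hss]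
      exact h x hx
    · rw [← e] at hw
      exact absurd hw (Nat.find_min hex (by omega))

end Tits

/-! ### Pairs of reflections -/

/-- `r` is the reflection `x ↦ x - α(x) v` with `α(v) = 2`. -/
def IsRefl (r : SLpm) (α : StrongDual ℝ V) (v : V) : Prop :=
  α v = 2 ∧ ∀ x : V, r • x = x - α x • v

theorem SLpm_ext {g h : SLpm} (H : ∀ x : V, g • x = h • x) : g = h :=
  Subtype.ext (LinearEquiv.ext H)

theorem exists_isRefl {α : StrongDual ℝ V} {v : V} (h : α v = 2) : ∃ r : SLpm, IsRefl r α v := by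
  have h' : α.toLinearMap v = 2 := h
  set e : V ≃ₗ[ℝ] V := Module.reflection h' with he
  have hinv : (e : V →ₗ[ℝ] V) ∘ₗ (e : V →ₗ[ℝ] V) = LinearMap.id := by
    refine LinearMap.ext fun x => ?_
    exact Module.involutive_reflection h' x
  refine ⟨⟨e, ?_⟩, h, fun x => rfl⟩
  change |LinearMap.det (e : V →ₗ[ℝ] V)| = 1
  have := congrArg LinearMap.det hinv
  rw [LinearMap.det_comp, LinearMap.det_id, ← abs_mul_abs_self, ← sq] at this
  exact (pow_eq_one_iff_of_nonneg (abs_nonneg _) two_ne_zero).1 this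

section

variable {r r' : SLpm} {α α' : StrongDual ℝ V} {v v' : V}

theorem IsRefl.apply_smul (h : IsRefl r α v) (β : StrongDual ℝ V) (x : V) :
    β (r • x) = β x - α x * β v := by
  rw [h.2, map_sub, map_smul, smul_eq_mul]

theorem IsRefl.mul_self (h : IsRefl r α v) : r * r = 1 := by
  refine SLpm_ext fun x => ?_
  rw [mul_smul, one_smul, h.2 (r • x), h.apply_smul, h.1, h.2]
  module

theorem IsRefl.apply_self (h : IsRefl r α v) (x : V) : α (r • x) = -α x := by
  rw [h.apply_smul, h.1]; ring

theorem IsRefl.ne_one (h : IsRefl r α v) : r ≠ 1 := by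
  rintro rfl
  have := h.apply_self v
  rw [one_smul, h.1] at this
  norm_num at this

theorem IsRefl.commute (h : IsRefl r α v) (h' : IsRefl r' α' v') (h1 : α v' = 0) (h2 : α' v = 0) :
    r * r' = r' * r := by
  refine SLpm_ext fun x => ?_
  rw [mul_smul, mul_smul, h.2 (r' • x), h'.2 (r • x), h'.apply_smul, h.apply_smul, h.2, h'.2, h1, h2]
  module

theorem IsRefl.braid (h : IsRefl r α v) (h' : IsRefl r' α' v') (h1 : α v' * α' v = 1) :
    r * r' * r = r' * r * r' := by
  refine SLpm_ext fun x => ?_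
  simp only [mul_smul]
  rw [h.2 (r' • r • x), h'.2 (r • r' • x), h'.2 (r • x), h.2 (r' • x), h.2 x, h'.2 x]
  simp only [map_sub, map_smul, smul_eq_mul, h.1, h'.1]
  match_scalars
  · ring
  · linear_combination -α x * h1
  · linear_combination α' x * h1

theorem IsRefl.orderOf_mul_of_commute (h : IsRefl r α v) (h' : IsRefl r' α' v') (h1 : α v' = 0)
    (h2 : α' v = 0) : orderOf (r * r') = 2 := by
  have hc := h.commute h' h1 h2
  refine orderOf_eq_prime ?_ fun h0 => ?_
  · rw [sq]
    calc r * r' * (r * r') = r * r' * (r' * r) := by rw [hc]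
      _ = r * (r' * r') * r := by group
      _ = 1 := by rw [h'.mul_self, mul_one, h.mul_self]
  · have e : r = r' := by
      rw [← mul_one r, ← h'.mul_self, ← mul_assoc, h0, one_mul]
    have e1 := h.apply_self v
    rw [e, h'.apply_smul, h2, h.1] at e1
    norm_num at e1

theorem IsRefl.orderOf_mul_of_braid (h : IsRefl r α v) (h' : IsRefl r' α' v')
    (h1 : α v' * α' v = 1) : orderOf (r * r') = 3 := by
  have hb := h.braid h' h1
  have : Fact (Nat.Prime 3) := ⟨Nat.prime_three⟩
  refine orderOf_eq_prime ?_ fun h0 => ?_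
  · have hpow : (r * r') ^ 3 = (r * r' * r) * (r' * r * r') := by
      simp only [pow_succ, pow_zero, one_mul, mul_assoc]
    calc (r * r') ^ 3 = (r * r' * r) * (r' * r * r') := hpow
      _ = (r * r' * r) * (r * r' * r) := by rw [hb]
      _ = r * (r' * (r * r) * r') * r := by group
      _ = 1 := by rw [h.mul_self, mul_one, h'.mul_self, mul_one, h.mul_self]
  -- For a single reflection described in two ways the product of the two entries is 4, not 1.
  · have e : r = r' := by
      rw [← mul_one r, ← h'.mul_self, ← mul_assoc, h0, one_mul]
    have e1 := h.apply_self v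
    rw [e, h'.apply_smul, h.1] at e1
    linarith

end

section

variable {ι : Type*} {r : ι → SLpm} {α : ι → StrongDual ℝ V} {v : ι → V}

/-- The products are `1`, `r i`, `r j`, `r i * r j`. The functional `α i` is unchanged by `r j`, and
the two elements starting with `r i` reduce to the other two. -/
theorem titsPair_of_commute (h : ∀ i, IsRefl (r i) (α i) (v i)) {i j : ι} (h1 : α i (v j) = 0)
    (h2 : α j (v i) = 0) : TitsPair r (fun i => {x : V | 0 < α i x}) i j := by
  have hs : ∀ i, r i * r i = 1 := fun i => (h i).mul_self
  have hss : ∀ i g, r i * (r i * g) = g := fun i g => by rw [← mul_assoc, hs, one_mul]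
  have hc := (h i).commute (h j) h1 h2
  have key : ∀ n u, WordLe r {i, j} n u → u = 1 ∨ (u = r i ∧ 1 ≤ n) ∨ (u = r j ∧ 1 ≤ n) ∨
      (u = r i * r j ∧ 2 ≤ n) := by
    intro n
    induction n with
    | zero =>
      intro u hu
      rcases hu.cases with rfl | ⟨m, hm, -⟩
      · exact Or.inl rfl
      · omega
    | succ n ih =>
      intro u hu
      rcases hu.cases with rfl | ⟨m, hm, a, ha, g, hg, rfl⟩
      · exact Or.inl rfl
      obtain rfl : m = n := by omega
      rcases ha with rfl | ha
      · rcases ih g hg with rfl | ⟨rfl, hn⟩ | ⟨rfl, hn⟩ | ⟨rfl, hn⟩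
        · exact Or.inr (Or.inl ⟨mul_one _, by omega⟩)
        · exact Or.inl (hs _)
        · exact Or.inr (Or.inr (Or.inr ⟨rfl, by omega⟩))
        · exact Or.inr (Or.inr (Or.inl ⟨hss _ _, by omega⟩))
      · rw [Set.mem_singleton_iff] at ha
        subst ha
        rcases ih g hg with rfl | ⟨rfl, hn⟩ | ⟨rfl, hn⟩ | ⟨rfl, hn⟩
        · exact Or.inr (Or.inr (Or.inl ⟨mul_one _, by omega⟩))
        · exact Or.inr (Or.inr (Or.inr ⟨hc.symm, by omega⟩))
        · exact Or.inl (hs _)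
        · exact Or.inr (Or.inl ⟨by rw [hc, hss], by omega⟩)
  have pj : ∀ x ∈ {x : V | 0 < α i x} ∩ {x : V | 0 < α j x}, 0 < α i (r j • x) := by
    rintro x ⟨hx, -⟩
    rw [(h j).apply_smul, h1]
    simpa using hx
  intro n u hu
  rcases key n u hu with rfl | ⟨rfl, hn⟩ | ⟨rfl, hn⟩ | ⟨rfl, hn⟩
  · left
    intro x hx
    rw [one_smul]
    exact hx.1
  · right
    refine ⟨fun x hx => ?_, n - 1, by omega, by rw [hs]; exact WordLe.one _ _⟩
    rw [← mul_smul, hs, one_smul]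
    exact hx.1
  · exact Or.inl pj
  · right
    refine ⟨fun x hx => ?_, n - 1, by omega, ?_⟩
    · rw [← mul_smul, hss]
      exact pj x hx
    · rw [hss]
      exact ⟨[j], by simp, by simp; omega, by simp⟩

/-- By the braid relation there are six products to inspect. Those not needing `r i` in front are
`1`, `r j` and `r j * r i`. At a point where both functionals are positive, `α i` remains positive
after `r j` because the entry is negative, and after `r j * r i` it equals `-α j x * α i (v j)`. -/
theorem titsPair_of_braid (h : ∀ i, IsRefl (r i) (α i) (v i)) {i j : ι}
    (h1 : α i (v j) * α j (v i) = 1) (h2 : α i (v j) < 0) :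
    TitsPair r (fun i => {x : V | 0 < α i x}) i j := by
  have hs : ∀ i, r i * r i = 1 := fun i => (h i).mul_self
  have hss : ∀ i g, r i * (r i * g) = g := fun i g => by rw [← mul_assoc, hs, one_mul]
  have hb : r i * (r j * r i) = r j * (r i * r j) := by
    rw [← mul_assoc, ← mul_assoc]
    exact (h i).braid (h j) h1
  have key : ∀ n u, WordLe r {i, j} n u → u = 1 ∨ (u = r i ∧ 1 ≤ n) ∨ (u = r j ∧ 1 ≤ n) ∨
      (u = r i * r j ∧ 2 ≤ n) ∨ (u = r j * r i ∧ 2 ≤ n) ∨ (u = r i * (r j * r i) ∧ 3 ≤ n) := by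
    intro n
    induction n with
    | zero =>
      intro u hu
      rcases hu.cases with rfl | ⟨m, hm, -⟩
      · exact Or.inl rfl
      · omega
    | succ n ih =>
      intro u hu
      rcases hu.cases with rfl | ⟨m, hm, a, ha, g, hg, rfl⟩
      · exact Or.inl rfl
      obtain rfl : m = n := by omega
      rcases ha with rfl | ha
      · rcases ih g hg with rfl | ⟨rfl, hn⟩ | ⟨rfl, hn⟩ | ⟨rfl, hn⟩ | ⟨rfl, hn⟩ | ⟨rfl, hn⟩
        · exact Or.inr (Or.inl ⟨mul_one _, by omega⟩)
        · exact Or.inl (hs _)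
        · exact Or.inr (Or.inr (Or.inr (Or.inl ⟨rfl, by omega⟩)))
        · exact Or.inr (Or.inr (Or.inl ⟨hss _ _, by omega⟩))
        · exact Or.inr (Or.inr (Or.inr (Or.inr (Or.inr ⟨rfl, by omega⟩))))
        · exact Or.inr (Or.inr (Or.inr (Or.inr (Or.inl ⟨hss _ _, by omega⟩))))
      · rw [Set.mem_singleton_iff] at ha
        subst ha
        rcases ih g hg with rfl | ⟨rfl, hn⟩ | ⟨rfl, hn⟩ | ⟨rfl, hn⟩ | ⟨rfl, hn⟩ | ⟨rfl, hn⟩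
        · exact Or.inr (Or.inr (Or.inl ⟨mul_one _, by omega⟩))
        · exact Or.inr (Or.inr (Or.inr (Or.inr (Or.inl ⟨rfl, by omega⟩))))
        · exact Or.inl (hs _)
        · exact Or.inr (Or.inr (Or.inr (Or.inr (Or.inr ⟨hb.symm, by omega⟩))))
        · exact Or.inr (Or.inl ⟨hss _ _, by omega⟩)
        · exact Or.inr (Or.inr (Or.inr (Or.inl ⟨by rw [hb, hss], by omega⟩)))
  have pj : ∀ x ∈ {x : V | 0 < α i x} ∩ {x : V | 0 < α j x}, 0 < α i (r j • x) := by
    rintro x ⟨hx, hx'⟩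
    rw [Set.mem_ofPred_eq] at hx hx'
    rw [(h j).apply_smul]
    nlinarith
  have pji : ∀ x ∈ {x : V | 0 < α i x} ∩ {x : V | 0 < α j x}, 0 < α i (r j • r i • x) := by
    rintro x ⟨hx, hx'⟩
    rw [Set.mem_ofPred_eq] at hx hx'
    rw [(h j).apply_smul, (h i).apply_self, (h i).apply_smul]
    have : -α i x - (α j x - α i x * α j (v i)) * α i (v j) = -(α j x * α i (v j)) := by
      linear_combination α i x * h1
    rw [this]
    nlinarith
  intro n u hu
  rcases key n u hu with rfl | ⟨rfl, hn⟩ | ⟨rfl, hn⟩ | ⟨rfl, hn⟩ | ⟨rfl, hn⟩ | ⟨rfl, hn⟩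
  · left
    intro x hx
    rw [one_smul]
    exact hx.1
  · right
    refine ⟨fun x hx => ?_, n - 1, by omega, by rw [hs]; exact WordLe.one _ _⟩
    rw [← mul_smul, hs, one_smul]
    exact hx.1
  · exact Or.inl pj
  · right
    refine ⟨fun x hx => ?_, n - 1, by omega, ?_⟩
    · rw [← mul_smul, hss]
      exact pj x hx
    · rw [hss]
      exact ⟨[j], by simp, by simp; omega, by simp⟩
  · left
    intro x hx
    rw [mul_smul]
    exact pji x hx
  · right
    refine ⟨fun x hx => ?_, n - 1, by omega, ?_⟩
    · rw [← mul_smul, hss, mul_smul]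
      exact pji x hx
    · rw [hss]
      exact ⟨[j, i], by simp, by simp; omega, by simp⟩

/-- The alternating product of length `n` of two involutions, starting with `a`. -/
def altProd (a b : SLpm) : ℕ → SLpm
  | 0 => 1
  | n + 1 => a * altProd b a n

theorem wordLe_altProd (r : ι → SLpm) (i j : ι) (n : ℕ) :
    WordLe r {i, j} n (altProd (r i) (r j) n) := by
  induction n generalizing i j with
  | zero => exact WordLe.one _ _
  | succ n ih =>
    refine WordLe.cons ?_ (by simp)
    exact (ih j i).mono (by rw [Set.pair_comm]) le_rfl

theorem WordLe.eq_altProd (hs : ∀ i, r i * r i = 1) {i j : ι} {n : ℕ} {u : SLpm}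
    (hu : WordLe r {i, j} n u) :
    ∃ k ≤ n, u = altProd (r i) (r j) k ∨ u = altProd (r j) (r i) k := by
  have hss : ∀ i g, r i * (r i * g) = g := fun i g => by rw [← mul_assoc, hs, one_mul]
  induction n generalizing u with
  | zero =>
    rcases hu.cases with rfl | ⟨m, hm, -⟩
    · exact ⟨0, le_rfl, Or.inl rfl⟩
    · omega
  | succ n ih =>
    rcases hu.cases with rfl | ⟨m, hm, a, ha, g, hg, rfl⟩
    · exact ⟨0, by omega, Or.inl rfl⟩
    obtain rfl : m = n := by omega
    obtain ⟨k, hk, hg | hg⟩ := ih hg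
    · rcases ha with rfl | ha
      · cases k with
        | zero => exact ⟨1, by omega, Or.inl (by rw [hg]; rfl)⟩
        | succ k =>
          refine ⟨k, by omega, Or.inr ?_⟩
          rw [hg, altProd, hss]
      · rw [Set.mem_singleton_iff] at ha
        subst ha
        exact ⟨k + 1, by omega, Or.inr (by rw [hg]; rfl)⟩
    · rcases ha with rfl | ha
      · exact ⟨k + 1, by omega, Or.inl (by rw [hg]; rfl)⟩
      · rw [Set.mem_singleton_iff] at ha
        subst ha
        cases k with
        | zero => exact ⟨1, by omega, Or.inr (by rw [hg]; rfl)⟩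
        | succ k =>
          refine ⟨k, by omega, Or.inl ?_⟩
          rw [hg, altProd, hss]

/-- Positivity of one functional is not inductive by itself. The added inequality bounds the other
functional from below by a multiple of the first, and the hypothesis that the product of the entries
is at least 4 is what carries it through one more reflection with the roles of `i` and `j`
exchanged. -/
theorem altProd_pos (h : ∀ i, IsRefl (r i) (α i) (v i)) {x : V} (k : ℕ) :
    ∀ {i j : ι}, α i (v j) < 0 → α j (v i) < 0 → 4 ≤ α i (v j) * α j (v i) → 0 < α i x → 0 < α j x →
    0 < α j (altProd (r i) (r j) k • x) ∧
      α i (v j) / 2 * α j (altProd (r i) (r j) k • x) < α i (altProd (r i) (r j) k • x) := by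
  induction k with
  | zero =>
    intro i j h1 h2 h3 hi hj
    simp only [altProd, one_smul]
    exact ⟨hj, by nlinarith⟩
  | succ k ih =>
    intro i j h1 h2 h3 hi hj
    obtain ⟨k1, k2⟩ := ih h2 h1 (by linarith) hj hi
    simp only [altProd, mul_smul]
    rw [(h i).apply_self, (h i).apply_smul]
    set a := α i (altProd (r j) (r i) k • x)
    set b := α j (altProd (r j) (r i) k • x)
    have p1 : 0 < b - α j (v i) / 2 * a := by linarith
    have p2 : 0 < -(α i (v j)) * (b - α j (v i) / 2 * a) := mul_pos (by linarith) p1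
    have p3 : 0 ≤ (α i (v j) * α j (v i) - 4) * a := mul_nonneg (by linarith) k1.le
    have p4 : 0 < -(α j (v i)) * a := mul_pos (by linarith) k1
    constructor
    · linarith
    · nlinarith

/-- Every word reduces to an alternating one. Those starting with `r j` keep `α i` positive by
`altProd_pos`; those starting with `r i` become of this kind when the first letter is removed. -/
theorem titsPair_of_four_le (h : ∀ i, IsRefl (r i) (α i) (v i)) {i j : ι}
    (h1 : α i (v j) < 0) (h2 : α j (v i) < 0) (h3 : 4 ≤ α i (v j) * α j (v i)) :
    TitsPair r (fun i => {x : V | 0 < α i x}) i j := by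
  have hs : ∀ i, r i * r i = 1 := fun i => (h i).mul_self
  have hss : ∀ i g, r i * (r i * g) = g := fun i g => by rw [← mul_assoc, hs, one_mul]
  have pos : ∀ k, ∀ x ∈ {x : V | 0 < α i x} ∩ {x : V | 0 < α j x},
      0 < α i (altProd (r j) (r i) k • x) := fun k x hx =>
    (altProd_pos h k h2 h1 (by linarith) hx.2 hx.1).1
  intro n u hu
  obtain ⟨k, hk, rfl | rfl⟩ := hu.eq_altProd hs
  · cases k with
    | zero =>
      left
      intro x hx
      simp only [altProd, one_smul]
      exact hx.1
    | succ k =>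
      right
      simp only [altProd]
      refine ⟨fun x hx => ?_, n - 1, by omega, ?_⟩
      · rw [← mul_smul, hss]
        exact pos k x hx
      · rw [hss]
        exact (wordLe_altProd r j i k).mono (by rw [Set.pair_comm]) (by omega)
  · exact Or.inl (pos k)

end

/-! ### The model Coxeter polytopes -/

/-- The parameters `(d, x)` of the model Coxeter polytopes. -/
def ParamSet : Set (ℝ × ℝ) := {p | 1 < p.1 ∧ p.1 / (2 - 2 * p.1) < p.2 ∧ p.2 < -2}

/-- The entries of the Cartan matrix of the model. -/
noncomputable def cartan (d x : ℝ) (i j : Fin 6) : ℝ := beta d i (w d x j)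

section

variable {d x : ℝ}

/-- This number is the Cartan entry of the pair `4, 3`, and the lower bound on `x` is its negativity
after clearing the denominator `x * d < 0`. -/
theorem slope_neg (hd : 1 < d) (h1 : d / (2 - 2 * d) < x) (h2 : x < -2) :
    -2 / d + 1 / x + 2 < 0 := by
  have hd0 : 0 < d := by linarith
  have h3 : d > x * (2 - 2 * d) := by
    rw [div_lt_iff_of_neg (by linarith)] at h1
    linarith
  have : -2 / d + 1 / x + 2 = (d - x * (2 - 2 * d)) / (x * d) := by
    have : x ≠ 0 := by linarith
    field_simp
    ring
  rw [this]
  exact div_neg_of_pos_of_neg (by linarith) (mul_neg_of_neg_of_pos (by linarith) hd0)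

theorem cartan_self (hd : 1 < d) (h2 : x < -2) (i : Fin 6) :
    cartan d x i i = 2 := by
  have hd1 : d - 1 ≠ 0 := by linarith
  have hx2 : x + 2 ≠ 0 := by linarith
  fin_cases i
  · simp [cartan, beta, coord, w]
  · simp [cartan, beta, coord, w]
  · simp [cartan, beta, coord, w]
  · simp [cartan, beta, coord, w]
  · change beta d 4 (w d x 4) = 2
    simp only [beta_four, w, Matrix.cons_val]
    field_simp
    ring
  · simp [cartan, beta, coord, w]

theorem cartan_of_label_eq_two (hd : 1 < d) {i j : Fin 6} (hij : exG.Adj i j)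
    (hl : exG.label i j = 2) : cartan d x i j = 0 := by
  have hd0 : d ≠ 0 := by linarith
  have hd1 : d - 1 ≠ 0 := by linarith
  fin_cases i <;> fin_cases j <;>
    first
    | (exfalso; revert hij; decide)
    | (exfalso; revert hl; decide)
    | skip
  all_goals simp [cartan, beta, coord, w]
  all_goals field_simp
  all_goals ring

theorem cartan_of_label_eq_three (hd : 1 < d) (h1 : d / (2 - 2 * d) < x) (h2 : x < -2)
    {i j : Fin 6} (hij : exG.Adj i j) (hl : exG.label i j = 3) :
    cartan d x i j * cartan d x j i = 1 ∧ cartan d x i j < 0 := by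
  have hs := slope_neg hd h1 h2
  have hx : x < 0 := by linarith
  have hx2 : x + 2 < 0 := by linarith
  have e23 : cartan d x 2 3 = 1 / x := rfl
  have e32 : cartan d x 3 2 = x := rfl
  have e24 : cartan d x 2 4 = 1 / (x + 2) := rfl
  have e42 : cartan d x 4 2 = x + 2 := by simp [cartan, beta_four, w]; ring
  have e34 : cartan d x 3 4 = 1 / (-2 / d + 1 / x + 2) := rfl
  have e43 : cartan d x 4 3 = -2 / d + 1 / x + 2 := by simp [cartan, beta_four, w]
  have hinv : ∀ y : ℝ, y < 0 → 1 / y * y = 1 ∧ 1 / y < 0 := fun y hy =>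
    ⟨div_mul_cancel₀ 1 hy.ne, one_div_neg.2 hy⟩
  have hinv' : ∀ y : ℝ, y < 0 → y * (1 / y) = 1 ∧ y < 0 := fun y hy =>
    ⟨mul_div_cancel₀ 1 hy.ne, hy⟩
  have hcases : (i = 2 ∧ j = 3) ∨ (i = 3 ∧ j = 2) ∨ (i = 2 ∧ j = 4) ∨ (i = 4 ∧ j = 2) ∨
      (i = 3 ∧ j = 4) ∨ (i = 4 ∧ j = 3) := by revert i j; decide
  rcases hcases with ⟨rfl, rfl⟩ | ⟨rfl, rfl⟩ | ⟨rfl, rfl⟩ | ⟨rfl, rfl⟩ | ⟨rfl, rfl⟩ | ⟨rfl, rfl⟩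
  · rw [e23, e32]; exact hinv _ hx
  · rw [e23, e32]; exact hinv' _ hx
  · rw [e24, e42]; exact hinv _ hx2
  · rw [e24, e42]; exact hinv' _ hx2
  · rw [e34, e43]; exact hinv _ hs
  · rw [e34, e43]; exact hinv' _ hs

/-- There are five such pairs. The products are exactly 4 for `0, 5` and `1, 3`; they are `-2 * x`
for `2, 5` and `4 - 2 / (x + 2)` for `1, 4`. For `0, 4` both summands of the first entry are
negative and the first summand is already at most `-2`. -/
theorem cartan_of_not_adj (hd : 1 < d) (h1 : d / (2 - 2 * d) < x) (h2 : x < -2)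
    {i j : Fin 6} (hij : i ≠ j) (hn : ¬ exG.Adj i j) :
    cartan d x i j < 0 ∧ cartan d x j i < 0 ∧ 4 ≤ cartan d x i j * cartan d x j i := by
  have hs := slope_neg hd h1 h2
  have hd0 : 0 < d := by linarith
  have hd1 : 0 < d - 1 := by linarith
  have hx2 : 1 / (x + 2) < 0 := one_div_neg.2 (by linarith)
  have hs' : 1 / (-2 / d + 1 / x + 2) < 0 := one_div_neg.2 hs
  have e05 : cartan d x 0 5 = -2 := rfl
  have e50 : cartan d x 5 0 = -2 := by simp [cartan, beta_five, w]
  have e04 : cartan d x 0 4 = d * (1 / (x + 2) - 2) / (d - 1) + 1 / (-2 / d + 1 / x + 2) := rfl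
  have e40 : cartan d x 4 0 = -2 := by simp [cartan, beta_four, w]
  have e13 : cartan d x 1 3 = -2 / d := rfl
  have e31 : cartan d x 3 1 = -2 * d := rfl
  have e14 : cartan d x 1 4 = (1 / (x + 2) - 2) / (d - 1) := rfl
  have e41 : cartan d x 4 1 = -2 * (d - 1) := by simp [cartan, beta_four, w]; ring
  have e25 : cartan d x 2 5 = -2 := rfl
  have e52 : cartan d x 5 2 = x := by simp [cartan, beta_five, w]
  have main : ∀ a b : ℝ, a < 0 → b < 0 → 4 ≤ a * b →
      (a < 0 ∧ b < 0 ∧ 4 ≤ a * b) ∧ (b < 0 ∧ a < 0 ∧ 4 ≤ b * a) := fun a b ha hb hab =>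
    ⟨⟨ha, hb, hab⟩, hb, ha, by linarith⟩
  have c05 := main (cartan d x 0 5) (cartan d x 5 0) (by rw [e05]; norm_num)
    (by rw [e50]; norm_num) (by rw [e05, e50]; norm_num)
  have c04 := main (cartan d x 0 4) (cartan d x 4 0) (by
      rw [e04]
      have : d * (1 / (x + 2) - 2) / (d - 1) < 0 :=
        div_neg_of_neg_of_pos (mul_neg_of_pos_of_neg hd0 (by linarith)) hd1
      linarith) (by rw [e40]; norm_num) (by
      rw [e40, e04]
      have : d * (1 / (x + 2) - 2) / (d - 1) ≤ -2 := by
        rw [div_le_iff₀ hd1]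
        nlinarith
      linarith)
  have c13 := main (cartan d x 1 3) (cartan d x 3 1)
    (by rw [e13]; exact div_neg_of_neg_of_pos (by norm_num) hd0) (by rw [e31]; linarith)
    (by rw [e13, e31]; field_simp; norm_num)
  have c14 := main (cartan d x 1 4) (cartan d x 4 1)
    (by rw [e14]; exact div_neg_of_neg_of_pos (by linarith) hd1) (by rw [e41]; linarith) (by
      rw [e14, e41]
      have : (1 / (x + 2) - 2) / (d - 1) * (-2 * (d - 1)) = -2 * (1 / (x + 2) - 2) := by
        field_simp
      rw [this]
      linarith)
  have c25 := main (cartan d x 2 5) (cartan d x 5 2) (by rw [e25]; norm_num)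
    (by rw [e52]; linarith) (by rw [e25, e52]; linarith)
  have hcases : (i = 0 ∧ j = 5) ∨ (i = 5 ∧ j = 0) ∨ (i = 0 ∧ j = 4) ∨ (i = 4 ∧ j = 0) ∨
      (i = 1 ∧ j = 3) ∨ (i = 3 ∧ j = 1) ∨ (i = 1 ∧ j = 4) ∨ (i = 4 ∧ j = 1) ∨
      (i = 2 ∧ j = 5) ∨ (i = 5 ∧ j = 2) := by revert i j; decide
  rcases hcases with ⟨rfl, rfl⟩ | ⟨rfl, rfl⟩ | ⟨rfl, rfl⟩ | ⟨rfl, rfl⟩ | ⟨rfl, rfl⟩ | ⟨rfl, rfl⟩ |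
    ⟨rfl, rfl⟩ | ⟨rfl, rfl⟩ | ⟨rfl, rfl⟩ | ⟨rfl, rfl⟩
  exacts [c05.1, c05.2, c04.1, c04.2, c13.1, c13.2, c14.1, c14.2, c25.1, c25.2]

end

theorem exists_modelReflections {p : ℝ × ℝ} (hp : p ∈ ParamSet) :
    ∃ r : Fin 6 → SLpm, ∀ i, IsRefl (r i) (beta p.1 i) (w p.1 p.2 i) := by
  choose r hr using fun i => exists_isRefl (cartan_self hp.1 hp.2.2 i)
  exact ⟨r, hr⟩

/-- The reflections of the model Coxeter polytope. -/
noncomputable def modelReflections {p : ℝ × ℝ} (hp : p ∈ ParamSet) : Fin 6 → SLpm :=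
  (exists_modelReflections hp).choose

theorem isRefl_modelReflections {p : ℝ × ℝ} (hp : p ∈ ParamSet) (i : Fin 6) :
    IsRefl (modelReflections hp i) (beta p.1 i) (w p.1 p.2 i) :=
  (exists_modelReflections hp).choose_spec i

theorem label_cases : ∀ i j, exG.Adj i j →
    (exG.label i j = 2 ∧ exG.label j i = 2) ∨ (exG.label i j = 3 ∧ exG.label j i = 3) := by
  decide

theorem adj_symm : ∀ i j, exG.Adj i j → exG.Adj j i := by decide

theorem titsPair_model {p : ℝ × ℝ} (hp : p ∈ ParamSet) (i j : Fin 6) (hij : i ≠ j) :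
    TitsPair (modelReflections hp) (fun i => {x : V | 0 < beta p.1 i x}) i j := by
  have hr := isRefl_modelReflections hp
  by_cases hadj : exG.Adj i j
  · rcases label_cases i j hadj with ⟨h, h'⟩ | ⟨h, h'⟩
    · exact titsPair_of_commute hr (cartan_of_label_eq_two hp.1 hadj h)
        (cartan_of_label_eq_two hp.1 (adj_symm i j hadj) h')
    · obtain ⟨h1, h2⟩ := cartan_of_label_eq_three hp.1 hp.2.1 hp.2.2 hadj h
      exact titsPair_of_braid hr h1 h2
  · obtain ⟨h1, h2, h3⟩ := cartan_of_not_adj hp.1 hp.2.1 hp.2.2 hij hadj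
    exact titsPair_of_four_le hr h1 h2 h3

theorem isReflectionWith_model {p : ℝ × ℝ} (hp : p ∈ ParamSet) (i : Fin 6) :
    IsReflectionWith (polytope p.1) (modelReflections hp i) (beta p.1 i) (w p.1 p.2 i) :=
  ⟨(isRefl_modelReflections hp i).1, (nonneg_on_polytope_iff hp.1 _).2 fun v =>
    (incident_beta_vert hp.1).nonneg i v, (isRefl_modelReflections hp i).2⟩

/-- The model Coxeter polytope with parameters `(d, x)`. -/
noncomputable def modelCoxeter {p : ℝ × ℝ} (hp : p ∈ ParamSet) : CoxeterPolytope exG where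
  P := polytope p.1
  r := modelReflections hp
  isConvexPolytope := isConvexPolytope_polytope hp.1
  exists_iso := ⟨faceIso hp.1, fun i => ⟨beta p.1 i, w p.1 p.2 i, isReflectionWith_model hp i,
    faceIso_facetFace hp.1 i⟩⟩
  orderOf_mul i j hij := by
    have hr := isRefl_modelReflections hp
    rcases label_cases i j hij with ⟨h, h'⟩ | ⟨h, h'⟩
    · rw [h]
      exact (hr i).orderOf_mul_of_commute (hr j) (cartan_of_label_eq_two hp.1 hij h)
        (cartan_of_label_eq_two hp.1 (adj_symm i j hij) h')
    · rw [h]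
      exact (hr i).orderOf_mul_of_braid (hr j)
        (cartan_of_label_eq_three hp.1 hp.2.1 hp.2.2 hij h).1
  disjoint_interior γ hγ hγ1 := by
    have hr := isRefl_modelReflections hp
    -- The translate of the open chamber by `γ` lies on the negative side of wall `i`, where no
    -- interior point of the polytope is found.
    obtain ⟨i, hi⟩ := exists_wall_of_ne_one (fun i => (hr i).mul_self) (titsPair_model hp) hγ hγ1
    rw [interior_polytope hp.1, Set.disjoint_left]
    intro z hz hz'
    obtain ⟨y, hy, rfl⟩ := exists_rayOf z
    rw [rayOf_mem_pconePos] at hz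
    rw [rayOf_mem_smul_set, rayOf_mem_pconePos] at hz'
    have := hi (γ⁻¹ • y) (Set.mem_iInter.2 hz')
    rw [smul_inv_smul, Set.mem_ofPred_eq, (hr i).apply_self] at this
    linarith [hz i]

/-! ### Every Coxeter polytope is equivalent to a model -/

section

variable {r r' : SLpm} {α α' : StrongDual ℝ V} {v v' : V}

theorem IsRefl.ne_zero (h : IsRefl r α v) : v ≠ 0 := by
  rintro rfl
  have := h.1
  rw [map_zero] at this
  norm_num at this

/-- Evaluating the commutation relation at a point of the first wall off the second leaves `(α' x *
α v') • v = 0`. -/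
theorem IsRefl.apply_eq_zero_of_orderOf_eq_two (h : IsRefl r α v) (h' : IsRefl r' α' v')
    (ho : orderOf (r * r') = 2) {x : V} (hx : α x = 0) (hx' : α' x ≠ 0) : α v' = 0 := by
  have h2 := pow_orderOf_eq_one (r * r')
  rw [ho, sq] at h2
  have hc : r * r' = r' * r := by
    rw [eq_inv_of_mul_eq_one_left h2, mul_inv_rev, inv_eq_of_mul_eq_one_left h.mul_self,
      inv_eq_of_mul_eq_one_left h'.mul_self]
  have e : (r * r') • x = (r' * r) • x := by rw [hc]
  rw [mul_smul, mul_smul, h.2 (r' • x), h.2 x, hx, zero_smul, sub_zero, h'.apply_smul, hx] at e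
  have e2 : (α' x * α v') • v = 0 := by
    rwa [sub_eq_self, zero_sub, neg_smul, neg_eq_zero] at e
  rcases smul_eq_zero.1 e2 with h0 | h0
  · exact (mul_eq_zero.1 h0).resolve_left hx'
  · exact absurd h0 h.ne_zero

/-- Evaluating the braid relation at a point of the first wall off the second leaves `(α' x * (1 - α
v' * α' v)) • v' = 0`. -/
theorem IsRefl.mul_eq_one_of_orderOf_eq_three (h : IsRefl r α v) (h' : IsRefl r' α' v')
    (ho : orderOf (r * r') = 3) {x : V} (hx : α x = 0) (hx' : α' x ≠ 0) :
    α v' * α' v = 1 := by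
  have h3 := pow_orderOf_eq_one (r * r')
  rw [ho] at h3
  have hc : r * r' * r = r' * r * r' := by
    have e : (r * r' * r) * (r' * r * r') = 1 := by
      rw [← h3]
      simp only [pow_succ, pow_zero, one_mul, mul_assoc]
    rw [eq_inv_of_mul_eq_one_left e]
    simp only [mul_inv_rev, inv_eq_of_mul_eq_one_left h.mul_self,
      inv_eq_of_mul_eq_one_left h'.mul_self, mul_assoc]
  have e : (r * r' * r) • x = (r' * r * r') • x := by rw [hc]
  simp only [mul_smul] at e
  rw [h.2 (r' • r • x), h'.2 (r • r' • x), h'.2 (r • x), h.2 (r' • x), h.2 x, h'.2 x] at e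
  simp only [map_sub, map_smul, smul_eq_mul, h.1, h'.1, hx] at e
  have e2 : (α' x * (1 - α v' * α' v)) • v' = 0 := by
    rw [← sub_eq_zero] at e
    rw [← neg_eq_zero, ← e]
    module
  rcases smul_eq_zero.1 e2 with h0 | h0
  · linarith [(mul_eq_zero.1 h0).resolve_left hx']
  · exact absurd h0 h'.ne_zero

/-- The conjugate of a reflection by a transformation scaling the functional. -/
theorem IsRefl.conj (h : IsRefl r α v) {g : SLpm} {c : ℝ} (hc : 0 < c)
    (hα : ∀ x, α' (g • x) = c * α x) : IsRefl (g * r * g⁻¹) α' (c⁻¹ • g • v) := by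
  constructor
  · rw [map_smul, hα, h.1, smul_eq_mul]
    field_simp
  · intro x
    have e := hα (g⁻¹ • x)
    rw [smul_inv_smul] at e
    rw [mul_smul, mul_smul, h.2, smul_sub, smul_inv_smul, e, smul_smul, smul_comm g]
    congr 2
    field_simp

/-- If the Cartan entries are positive, a conjugate reflection fixes points of the chamber. -/
theorem IsRefl.conj_fixes (h : IsRefl r α v) (h' : IsRefl r' α' v') {y : V}
    (hy : α' y = α' v * α y) : (r * r' * r) • y = y := by
  have e : r' • r • y = r • y := by
    rw [h'.2, h.apply_smul, hy, mul_comm, sub_self, zero_smul, sub_zero]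
  rw [mul_smul, mul_smul, e, ← mul_smul, h.mul_self, one_smul]

end

/-- For the three pairs of order 3 the ratio of the two functionals takes every positive value in
the interior. These points serve as fixed points in `IsRefl.conj_fixes`, to exclude positive Cartan
entries. -/
theorem exists_interior_point {d : ℝ} (hd : 1 < d) {k : ℝ} (hk : 0 < k) {i j : Fin 6}
    (hij : (i = 2 ∧ j = 3) ∨ (i = 2 ∧ j = 4) ∨ (i = 3 ∧ j = 4)) :
    ∃ y : V, (∀ l, 0 < beta d l y) ∧ beta d j y = k * beta d i y := by
  have main : ∀ a b c e : ℝ, 0 < a → 0 < b → 0 < c → 0 < e → 0 < -a + b + c + e →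
      0 < -a + d * b + e → ∀ l, 0 < beta d l ![a, b, c, e] := by
    intro a b c e h0 h1 h2 h3 h4 h5 l
    fin_cases l
    exacts [h0, h1, h2, h3, h4, h5]
  rcases hij with ⟨rfl, rfl⟩ | ⟨rfl, rfl⟩ | ⟨rfl, rfl⟩
  · exact ⟨![1, 1, 1, k], main _ _ _ _ one_pos one_pos one_pos hk (by linarith) (by linarith),
      (mul_one k).symm⟩
  · rcases le_total 1 k with h | h
    · refine ⟨![1 + 1 / k, 1, 1 / k, 1], main _ _ _ _ (by positivity) one_pos (by positivity)
        one_pos (by linarith) ?_, ?_⟩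
      · have : 1 / k ≤ 1 := (div_le_one hk).2 h
        linarith
      · rw [beta_four, beta_two]
        simp only [Matrix.cons_val]
        field_simp
        ring
    · have hd1 : 0 < d - 1 := by linarith
      refine ⟨![2 + (d - 1) * (1 - k), 1, d - 1, 1], main _ _ _ _ ?_ one_pos hd1 one_pos ?_ ?_, ?_⟩
      · have := mul_nonneg hd1.le (show 0 ≤ 1 - k by linarith)
        linarith
      · have := mul_pos hd1 hk
        linarith
      · have := mul_pos hd1 hk
        linarith
      · rw [beta_four, beta_two]
        simp only [Matrix.cons_val]
        ring
  · refine ⟨![(d - 1) / 2 + 1 / k, 1, (d - 1) / 2, 1 / k],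
      main _ _ _ _ ?_ one_pos (by linarith) (by positivity) (by linarith) (by linarith), ?_⟩
    · have : 0 < 1 / k := by positivity
      linarith
    · rw [beta_four, beta_three]
      simp only [Matrix.cons_val]
      field_simp
      ring

/-- The equations of the Cartan matrix determine the vectors of the reflections. -/
theorem exists_param_of_cartan {d : ℝ} (hd : 1 < d) {u : Fin 6 → V}
    (h1 : ∀ i, beta d i (u i) = 2)
    (h2 : ∀ i j, exG.Adj i j → exG.label i j = 2 → beta d i (u j) = 0)
    (h3 : ∀ i j, exG.Adj i j → exG.label i j = 3 →
      beta d i (u j) * beta d j (u i) = 1 ∧ beta d i (u j) < 0) :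
    ∃ x, (d, x) ∈ ParamSet ∧ u = w d x := by
  have hd0 : 0 < d := by linarith
  have a00 := h1 0
  have a11 := h1 1
  have a22 := h1 2
  have a33 := h1 3
  have a44 := h1 4
  have a55 := h1 5
  have a10 := h2 1 0 (by decide) (by decide)
  have a20 := h2 2 0 (by decide) (by decide)
  have a30 := h2 3 0 (by decide) (by decide)
  have a01 := h2 0 1 (by decide) (by decide)
  have a21 := h2 2 1 (by decide) (by decide)
  have a51 := h2 5 1 (by decide) (by decide)
  have a02 := h2 0 2 (by decide) (by decide)
  have a12 := h2 1 2 (by decide) (by decide)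
  have a03 := h2 0 3 (by decide) (by decide)
  have a53 := h2 5 3 (by decide) (by decide)
  have a15 := h2 1 5 (by decide) (by decide)
  have a35 := h2 3 5 (by decide) (by decide)
  have a45 := h2 4 5 (by decide) (by decide)
  have a54 := h2 5 4 (by decide) (by decide)
  obtain ⟨b23, -⟩ := h3 2 3 (by decide) (by decide)
  obtain ⟨-, c32⟩ := h3 3 2 (by decide) (by decide)
  obtain ⟨b24, -⟩ := h3 2 4 (by decide) (by decide)
  obtain ⟨-, c42⟩ := h3 4 2 (by decide) (by decide)
  obtain ⟨b34, -⟩ := h3 3 4 (by decide) (by decide)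
  obtain ⟨-, c43⟩ := h3 4 3 (by decide) (by decide)
  simp only [beta_zero, beta_one, beta_two, beta_three, beta_four, beta_five] at *
  -- The one coordinate left free: the equations for orders 2 and 3 express all the others through
  -- it and `d`.
  set x := u 2 3 with hx
  rw [a02, a12, a22] at c42 b24
  have e31 : u 3 1 = -2 / d := by
    rw [a03, a33] at a53
    field_simp
    linarith
  have e32 : u 3 2 = 1 / x := eq_one_div_of_mul_eq_one_left b23
  rw [a03, a33, e31, e32] at c43 b34
  have hx2 : x < -2 := by linarith
  have hs : -2 / d + 1 / x + 2 < 0 := by linarith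
  have e42 : u 4 2 = 1 / (x + 2) := by
    rw [show x + 2 = -0 + 0 + 2 + x by ring]
    exact eq_one_div_of_mul_eq_one_left b24
  have e43 : u 4 3 = 1 / (-2 / d + 1 / x + 2) := by
    rw [show -2 / d + 1 / x + 2 = -0 + -2 / d + 1 / x + 2 by ring]
    exact eq_one_div_of_mul_eq_one_left b34
  have e41 : u 4 1 = (1 / (x + 2) - 2) / (d - 1) := by
    rw [eq_div_iff (by linarith), ← e42]
    linarith
  have e40 : u 4 0 = d * (1 / (x + 2) - 2) / (d - 1) + 1 / (-2 / d + 1 / x + 2) := by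
    rw [mul_div_assoc, ← e41, ← e43]
    linarith
  have e50 : u 5 0 = -2 := by
    rw [a15, a35] at a55
    linarith
  refine ⟨x, ⟨hd, ?_, hx2⟩, ?_⟩
  -- The lower bound is the negativity of the entry `4, 3`, multiplied by `x * d < 0`.
  · rw [div_lt_iff_of_neg (by linarith)]
    have hxn : x < 0 := by linarith
    have hx0 := hxn.ne
    have : (-2 / d + 1 / x + 2) * (x * d) = d - x * (2 - 2 * d) := by
      field_simp
      ring
    have := mul_pos_of_neg_of_neg hs (mul_neg_of_neg_of_pos hxn hd0)
    linarith
  · funext i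
    fin_cases i
    · exact vec_ext a00 a10 a20 a30
    · exact vec_ext a01 a11 a21 (by change u 1 3 = -2 * d; rw [a01, a11] at a51; linarith)
    · exact vec_ext a02 a12 a22 rfl
    · exact vec_ext a03 e31 e32 a33
    · exact vec_ext e40 e41 e42 e43
    · exact vec_ext e50 a15 (by change u 5 2 = -2; linarith) a35

/-- Points in the faces of a Coxeter polytope corresponding to the vertices. -/
theorem CoxeterPolytope.exists_incident (X : CoxeterPolytope exG) :
    ∃ (α : Fin 6 → StrongDual ℝ V) (v : Fin 6 → V) (q : Fin 6 → V),
      (∀ i, IsReflectionWith X.P (X.r i) (α i) (v i)) ∧ Incident α q ∧ X.P = pcone α := by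
  obtain ⟨φ, hφ⟩ := X.exists_iso
  choose α v hr hF using hφ
  obtain ⟨-, -, k, δ, -, hP⟩ := X.isConvexPolytope
  replace hP : X.P = pcone δ := hP
  set F : Fin 6 → Set S3 := fun a => (φ ⟨{a}, 0, a, rfl⟩ : Set S3) with hFdef
  have hFP : ∀ a, F a ⊆ X.P := by
    intro a
    obtain ⟨-, γ, -, h⟩ := (φ ⟨{a}, 0, a, rfl⟩).2
    intro z hz
    exact (h.subset hz).1
  have hle : ∀ a i, F a ⊆ X.P ∩ sph {x | α i x = 0} ↔ a ∈ exG.facet i := by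
    intro a i
    rw [← hF i]
    have : φ ⟨{a}, 0, a, rfl⟩ ≤ φ (exG.facetFace i) ↔ a ∈ exG.facet i := by
      rw [φ.le_iff_le]
      exact Finset.singleton_subset_iff
    exact this
  -- The face `F a` corresponding to a vertex is not yet known to be a single point. For each wall
  -- not containing it some point of `F a` lies off that wall, and the sum of these points lies off
  -- all of them.
  have hpos : ∀ a i, ∃ (y : V) (hy : y ≠ 0), rayOf y hy ∈ F a ∧
      (a ∉ exG.facet i → 0 < α i y) := by
    intro a i
    by_cases ha : a ∈ exG.facet i
    · obtain ⟨z, hz⟩ := (φ ⟨{a}, 0, a, rfl⟩).2.1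
      obtain ⟨y, hy, rfl⟩ := exists_rayOf z
      exact ⟨y, hy, hz, fun h => absurd ha h⟩
    · have h := (hle a i).not.2 ha
      obtain ⟨z, hz, hz'⟩ := Set.not_subset.1 h
      obtain ⟨y, hy, rfl⟩ := exists_rayOf z
      refine ⟨y, hy, hz, fun _ => ?_⟩
      refine lt_of_le_of_ne (nonneg_of_mem hy ((hr i).2.1 (hFP a hz))) fun h0 => hz' ?_
      exact ⟨hFP a hz, (rayOf_mem_sph_zero (α i) hy).2 h0.symm⟩
  choose y hy hyF hyα using hpos
  have hnn : ∀ i a b, 0 ≤ α i (y a b) := fun i a b =>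
    nonneg_of_mem (hy a b) ((hr i).2.1 (hFP a (hyF a b)))
  have hinc : Incident α fun a => ∑ b, y a b := by
    intro i a
    dsimp only
    rw [map_sum]
    refine ⟨fun ha => Finset.sum_eq_zero fun b _ => ?_, fun ha => ?_⟩
    · exact (rayOf_mem_sph_zero (α i) (hy a b)).1 (((hle a i).2 ha) (hyF a b)).2
    · exact Finset.sum_pos' (fun b _ => hnn i a b) ⟨i, Finset.mem_univ i, hyα a i ha⟩
  refine ⟨α, v, _, hr, hinc, Set.Subset.antisymm ?_ ?_⟩
  · refine subset_of_rayOf fun x hx hxP => (rayOf_mem_pcone α hx).2 fun i => ?_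
    exact nonneg_of_mem hx ((hr i).2.1 hxP)
  -- The cone of the `α i` is generated by the chosen vectors, which are sums of vectors
  -- representing points of `X.P`, and the inequalities defining `X.P` pass to nonnegative
  -- combinations.
  · refine subset_of_rayOf fun x hx hxP => ?_
    rw [hP, rayOf_mem_pcone]
    intro l
    obtain ⟨e, he, rfl⟩ := hinc.exists_nonneg_comb ((rayOf_mem_pcone α hx).1 hxP)
    simp only [map_sum, map_smul, smul_eq_mul]
    refine Finset.sum_nonneg fun a _ => mul_nonneg (he a) (Finset.sum_nonneg fun b _ => ?_)
    have := hFP a (hyF a b)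
    rw [hP, rayOf_mem_pcone] at this
    exact this l

/-- After normalizing the functionals, the orders of the products give the equations for the Cartan
entries, disjointness of the translates gives the signs, and `exists_param_of_cartan` solves the
resulting system. -/
theorem CoxeterPolytope.exists_equiv_model (X : CoxeterPolytope exG) :
    ∃ (p : ℝ × ℝ) (hp : p ∈ ParamSet), coxeterSetoid exG X (modelCoxeter hp) := by
  obtain ⟨α, v, q, hr, hinc, hP⟩ := X.exists_incident
  obtain ⟨d, g, c, hd, hc, hg⟩ := hinc.exists_normal_form
  have hrX : ∀ i, IsRefl (X.r i) (α i) (v i) := fun i => ⟨(hr i).1, (hr i).2.2⟩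
  set u : Fin 6 → V := fun i => (c i)⁻¹ • g • v i with hu
  have hrc : ∀ i, IsRefl (g * X.r i * g⁻¹) (beta d i) (u i) := fun i => (hrX i).conj (hc i) (hg i)
  have hord : ∀ i j, exG.Adj i j →
      orderOf (g * X.r i * g⁻¹ * (g * X.r j * g⁻¹)) = exG.label i j := by
    intro i j hij
    rw [← X.orderOf_mul i j hij, ← MulEquiv.orderOf_eq (MulAut.conj g) (X.r i * X.r j), map_mul]
    rfl
  have hvert : ∀ i j, exG.Adj i j → ∃ x, beta d i x = 0 ∧ beta d j x ≠ 0 := by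
    intro i j hij
    obtain ⟨a, ha, ha'⟩ := (by decide : ∀ i j, exG.Adj i j →
      ∃ a, a ∈ exG.facet i ∧ a ∉ exG.facet j) i j hij
    exact ⟨vert d a, (incident_beta_vert hd i a).1 ha, ((incident_beta_vert hd j a).2 ha').ne'⟩
  have h2 : ∀ i j, exG.Adj i j → exG.label i j = 2 → beta d i (u j) = 0 := by
    intro i j hij hl
    obtain ⟨x, hx, hx'⟩ := hvert i j hij
    exact (hrc i).apply_eq_zero_of_orderOf_eq_two (hrc j) ((hord i j hij).trans hl) hx hx'
  have h3 : ∀ i j, exG.Adj i j → exG.label i j = 3 → beta d i (u j) * beta d j (u i) = 1 := by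
    intro i j hij hl
    obtain ⟨x, hx, hx'⟩ := hvert i j hij
    exact (hrc i).mul_eq_one_of_orderOf_eq_three (hrc j) ((hord i j hij).trans hl) hx hx'
  -- If the entry were positive, there would be an interior point `y` for which `r i • y` lies on
  -- wall `j`. The nontrivial element `r i * r j * r i` would then fix `y`, against the disjointness
  -- of the translates. One order of each pair suffices, since the two entries have product 1 and so
  -- the same sign.
  have hneg : ∀ i j, (i = 2 ∧ j = 3) ∨ (i = 2 ∧ j = 4) ∨ (i = 3 ∧ j = 4) →
      beta d j (u i) ≤ 0 := by
    intro i j hij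
    by_contra hpos
    rw [not_le] at hpos
    obtain ⟨y, hy, hyk⟩ := exists_interior_point hd hpos hij
    have hfix := (hrc i).conj_fixes (hrc j) hyk
    have hne : y ≠ 0 := by
      rintro rfl
      have := hy 0
      rw [map_zero] at this
      exact this.false
    have hne' := smul_ne_zero_of_SLpm g⁻¹ hne
    have hint : rayOf (g⁻¹ • y) hne' ∈ interior X.P := by
      rw [hP, interior_pcone _ hinc.functional_ne_zero, rayOf_mem_pconePos]
      intro l
      have := hg l (g⁻¹ • y)
      rw [smul_inv_smul] at this
      have h0 := hy l
      rw [this] at h0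
      exact pos_of_mul_pos_right h0 (hc l).le
    have hfix' : (X.r i * X.r j * X.r i)⁻¹ • g⁻¹ • y = g⁻¹ • y := by
      rw [inv_smul_eq_iff, eq_comm, ← smul_left_cancel_iff g, ← mul_smul, ← mul_smul, smul_inv_smul]
      have e : g * (X.r i * X.r j * X.r i) * g⁻¹
        = g * X.r i * g⁻¹ * (g * X.r j * g⁻¹) * (g * X.r i * g⁻¹) := by group
      rw [e]
      exact hfix
    have hcl : X.r i * X.r j * X.r i ∈ Subgroup.closure (Set.range X.r) :=
      mul_mem (mul_mem (Subgroup.subset_closure ⟨i, rfl⟩) (Subgroup.subset_closure ⟨j, rfl⟩))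
        (Subgroup.subset_closure ⟨i, rfl⟩)
    have hne1 : X.r i * X.r j * X.r i ≠ 1 := by
      intro h
      refine (hrX j).ne_one ?_
      calc X.r j = X.r i * X.r i * X.r j * (X.r i * X.r i) := by
            rw [(hrX i).mul_self, one_mul, mul_one]
        _ = X.r i * (X.r i * X.r j * X.r i) * X.r i := by group
        _ = 1 := by rw [h, mul_one, (hrX i).mul_self]
    refine Set.disjoint_left.1 (X.disjoint_interior _ hcl hne1) hint ?_
    rw [rayOf_mem_smul_set]
    simpa only [hfix'] using hint
  have h3' : ∀ i j, exG.Adj i j → exG.label i j = 3 →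
      beta d i (u j) * beta d j (u i) = 1 ∧ beta d i (u j) < 0 := by
    intro i j hij hl
    have hm := h3 i j hij hl
    refine ⟨hm, ?_⟩
    rcases (by decide : ∀ i j, exG.Adj i j → exG.label i j = 3 →
      ((i = 2 ∧ j = 3) ∨ (i = 2 ∧ j = 4) ∨ (i = 3 ∧ j = 4)) ∨
      ((j = 2 ∧ i = 3) ∨ (j = 2 ∧ i = 4) ∨ (j = 3 ∧ i = 4))) i j hij hl with h | h
    · have := hneg i j h
      by_contra hcon
      have := mul_nonpos_of_nonneg_of_nonpos (not_lt.1 hcon) this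
      linarith
    · refine lt_of_le_of_ne (hneg j i h) fun h0 => ?_
      rw [h0] at hm
      norm_num at hm
  obtain ⟨x, hx, hux⟩ := exists_param_of_cartan hd (fun i => (hrc i).1) h2 h3'
  refine ⟨(d, x), hx, g, ?_, fun i => ?_⟩
  · rw [hP, smul_pcone_eq_polytope hc hg]
    rfl
  · refine SLpm_ext fun y => ?_
    rw [(hrc i).2, hux]
    exact (isRefl_modelReflections hx i).2 y

/-! ### The deformation space -/

/-- A reflection determines its functional and vector up to reciprocal factors, and the sign of the
factor is fixed by nonnegativity on a set with interior. Thus the functionals picked by choice in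
`Phi` may be replaced by `beta` and `w`. -/
theorem IsReflectionWith.exists_pos_scaling {P : Set S3} (hP : (interior P).Nonempty) {r : SLpm}
    {α α' : StrongDual ℝ V} {v v' : V} (h : IsReflectionWith P r α v)
    (h' : IsReflectionWith P r α' v') :
    ∃ k : ℝ, 0 < k ∧ (∀ x, α' x = k⁻¹ * α x) ∧ v' = k • v := by
  obtain ⟨h1, h2, h3⟩ := h
  obtain ⟨k1, k2, k3⟩ := h'
  have hv : v ≠ 0 := by
    rintro rfl
    rw [map_zero] at h1
    norm_num at h1
  have e1 : ∀ x : V, α x • v = α' x • v' := by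
    intro x
    have := (h3 x).symm.trans (k3 x)
    exact sub_right_injective this
  have e2 : v' = (α v' / 2) • v := by
    have := e1 v'
    rw [k1] at this
    rw [div_eq_inv_mul, mul_smul, this, smul_smul]
    norm_num
  set k := α v' / 2 with hk
  have e3 : ∀ x, α x = α' x * k := by
    intro x
    have := e1 x
    rw [e2, smul_smul] at this
    exact smul_left_injective ℝ hv this
  have hk0 : k ≠ 0 := by
    intro h
    have := e3 v
    rw [h1, h, mul_zero] at this
    norm_num at this
  have hkpos : 0 < k := by
    obtain ⟨x, hx, hxP, hαx⟩ := exists_mem_ne_zero hP α (v := v) (by rw [h1]; norm_num)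
    have p1 : 0 < α x := lt_of_le_of_ne (nonneg_of_mem hx (h2 hxP)) hαx.symm
    have p2 := nonneg_of_mem hx (k2 hxP)
    rw [e3] at p1
    exact pos_of_mul_pos_right p1 p2
  exact ⟨k, hkpos, fun x => by rw [e3]; field_simp, e2⟩

/-- The class of the model Coxeter polytope. -/
noncomputable def modelClass (p : ParamSet) : DefSpace exG := DefSpace.mk (modelCoxeter p.2)

theorem exists_modelClass_eq (c : DefSpace exG) : ∃ p, modelClass p = c := by
  induction c using Quotient.inductionOn with
  | h X =>
    obtain ⟨p, hp, h⟩ := X.exists_equiv_model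
    exact ⟨⟨p, hp⟩, (Quotient.sound (s := coxeterSetoid exG) h).symm⟩

/-- The functionals and vectors of the model. -/
noncomputable def modelPair (p : ℝ × ℝ) : Pairs 6 := (beta p.1, w p.1 p.2)

theorem Phi_modelClass (p : ParamSet) :
    Phi exG (modelClass p) = Quotient.mk (pairSetoid 6) (modelPair p) := by
  symm
  refine Quotient.sound (s := pairSetoid 6) ?_
  set X := modelCoxeter p.2 with hX
  have h : ∀ i, ∃ k : ℝ, 0 < k ∧ (∀ x, X.functionals.1 i x = k⁻¹ * beta p.1.1 i x) ∧
      X.functionals.2 i = k • w p.1.1 p.1.2 i := fun i =>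
    IsReflectionWith.exists_pos_scaling X.isConvexPolytope.2.1 (isReflectionWith_model p.2 i)
      (X.functionals_spec i)
  choose k hk h1 h2 using h
  refine ⟨1, k, hk, fun i x => ?_, fun i => ?_⟩
  · rw [inv_one, one_smul]
    exact h1 i x
  · rw [one_smul]
    exact h2 i

/-- An entry changes only by the factor `c j / c i`, so products along cycles of indices are
invariant. -/
theorem pairSetoid_entry {p q : Pairs 6} {A : SLpm} {c : Fin 6 → ℝ}
    (h1 : ∀ i x, q.1 i x = (c i)⁻¹ * p.1 i (A⁻¹ • x)) (h2 : ∀ i, q.2 i = c i • A • p.2 i)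
    (i j : Fin 6) : q.1 i (q.2 j) = (c i)⁻¹ * c j * p.1 i (p.2 j) := by
  rw [h2, map_smul, h1, inv_smul_smul, smul_eq_mul]
  ring

/-- A cyclic product of Cartan entries of length two. -/
noncomputable def cyclicTwo : Quotient (pairSetoid 6) → ℝ :=
  Quotient.lift (fun p => p.1 2 (p.2 5) * p.1 5 (p.2 2)) (by
    rintro p q ⟨A, c, hc, h1, h2⟩
    have := (hc 2).ne'
    have := (hc 5).ne'
    simp only [pairSetoid_entry h1 h2]
    field_simp)

/-- A cyclic product of Cartan entries of length three. -/
noncomputable def cyclicThree : Quotient (pairSetoid 6) → ℝ :=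
  Quotient.lift (fun p => p.1 3 (p.2 2) * p.1 4 (p.2 3) * p.1 2 (p.2 4)) (by
    rintro p q ⟨A, c, hc, h1, h2⟩
    have := (hc 2).ne'
    have := (hc 3).ne'
    have := (hc 4).ne'
    simp only [pairSetoid_entry h1 h2]
    field_simp)

theorem continuous_entry (i j : Fin 6) : Continuous fun p : Pairs 6 => p.1 i (p.2 j) :=
  ((continuous_apply i).comp continuous_fst).clm_apply ((continuous_apply j).comp continuous_snd)

theorem continuous_cyclicTwo : Continuous cyclicTwo :=
  Continuous.quotient_lift ((continuous_entry _ _).mul (continuous_entry _ _)) _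

theorem continuous_cyclicThree : Continuous cyclicThree :=
  Continuous.quotient_lift
    (((continuous_entry _ _).mul (continuous_entry _ _)).mul (continuous_entry _ _)) _

theorem continuous_Phi : Continuous (Phi exG) := continuous_induced_dom

/-- The parameter `x` of a class of Coxeter polytopes. -/
noncomputable def secondParam (c : DefSpace exG) : ℝ := -cyclicTwo (Phi exG c) / 2

/-- The reciprocal, up to a factor, of the parameter `d` of a class of Coxeter polytopes. -/
noncomputable def slopeParam (c : DefSpace exG) : ℝ :=
  1 / secondParam c + 2 - cyclicThree (Phi exG c) * (secondParam c + 2) / secondParam c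

theorem secondParam_modelClass (p : ParamSet) : secondParam (modelClass p) = p.1.2 := by
  rw [secondParam, Phi_modelClass]
  change -(beta p.1.1 2 (w p.1.1 p.1.2 5) * beta p.1.1 5 (w p.1.1 p.1.2 2)) / 2 = _
  rw [beta_two, beta_five]
  simp [w]

/-- On the model the cyclic product of length three is `x * (-2 / d + 1 / x + 2) / (x + 2)`. With
`x` known from the product of length two, this is solved for `2 / d`. -/
theorem slopeParam_modelClass (p : ParamSet) : slopeParam (modelClass p) = 2 / p.1.1 := by
  rw [slopeParam, secondParam_modelClass, Phi_modelClass]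
  change 1 / p.1.2 + 2 - beta p.1.1 3 (w p.1.1 p.1.2 2) * beta p.1.1 4 (w p.1.1 p.1.2 3)
    * beta p.1.1 2 (w p.1.1 p.1.2 4) * (p.1.2 + 2) / p.1.2 = _
  obtain ⟨⟨d, x⟩, hd, -, hx⟩ := p
  change 1 < d at hd
  change x < -2 at hx
  have hd0 : d ≠ 0 := by linarith
  have hx0 : x ≠ 0 := by linarith
  have hx2 : x + 2 ≠ 0 := by linarith
  rw [beta_three, beta_four, beta_two]
  simp only [w, Matrix.cons_val]
  field_simp
  ring

theorem continuous_secondParam : Continuous secondParam := by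
  unfold secondParam
  exact ((continuous_cyclicTwo.comp continuous_Phi).neg).div_const 2

theorem secondParam_ne_zero (c : DefSpace exG) : secondParam c ≠ 0 := by
  obtain ⟨p, rfl⟩ := exists_modelClass_eq c
  rw [secondParam_modelClass]
  have := p.2.2.2
  linarith

theorem slopeParam_ne_zero (c : DefSpace exG) : slopeParam c ≠ 0 := by
  obtain ⟨p, rfl⟩ := exists_modelClass_eq c
  rw [slopeParam_modelClass]
  have := p.2.1
  exact div_ne_zero two_ne_zero (by linarith)

theorem continuous_slopeParam : Continuous slopeParam := by
  unfold slopeParam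
  refine Continuous.sub (Continuous.add ?_ continuous_const) ?_
  · exact continuous_const.div continuous_secondParam secondParam_ne_zero
  · exact ((continuous_cyclicThree.comp continuous_Phi).mul
      (continuous_secondParam.add continuous_const)).div continuous_secondParam secondParam_ne_zero

/-- The parameters of a class of Coxeter polytopes. -/
noncomputable def defParams (c : DefSpace exG) : ℝ × ℝ := (2 / slopeParam c, secondParam c)

theorem defParams_modelClass (p : ParamSet) : defParams (modelClass p) = p := by
  rw [defParams, slopeParam_modelClass, secondParam_modelClass]
  have : p.1.1 ≠ 0 := by have := p.2.1; linarith
  rw [div_div_cancel₀ two_ne_zero]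

theorem continuous_defParams : Continuous defParams := by
  unfold defParams
  exact (continuous_const.div continuous_slopeParam slopeParam_ne_zero).prodMk
    continuous_secondParam

theorem defParams_mem (c : DefSpace exG) : defParams c ∈ ParamSet := by
  obtain ⟨p, rfl⟩ := exists_modelClass_eq c
  rw [defParams_modelClass]
  exact p.2

theorem continuous_modelPair : Continuous fun p : ParamSet => modelPair p := by
  have hd : Continuous fun p : ParamSet => p.1.1 := continuous_fst.comp continuous_subtype_val
  have hx : Continuous fun p : ParamSet => p.1.2 := continuous_snd.comp continuous_subtype_val
  have hd0 : ∀ p : ParamSet, p.1.1 ≠ 0 := fun p => by have := p.2.1; linarith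
  have hd1 : ∀ p : ParamSet, p.1.1 - 1 ≠ 0 := fun p => by have := p.2.1; linarith
  have hx0 : ∀ p : ParamSet, p.1.2 ≠ 0 := fun p => by have := p.2.2.2; linarith
  have hx2 : ∀ p : ParamSet, p.1.2 + 2 ≠ 0 := fun p => by have := p.2.2.2; linarith
  have hs : ∀ p : ParamSet, -2 / p.1.1 + 1 / p.1.2 + 2 ≠ 0 := fun p =>
    (slope_neg p.2.1 p.2.2.1 p.2.2.2).ne
  have c1 : Continuous fun p : ParamSet => 1 / p.1.2 := continuous_const.div hx hx0
  have c2 : Continuous fun p : ParamSet => -2 / p.1.1 := continuous_const.div hd hd0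
  have c3 : Continuous fun p : ParamSet => 1 / (p.1.2 + 2) :=
    continuous_const.div (hx.add continuous_const) hx2
  have c4 : Continuous fun p : ParamSet => 1 / (-2 / p.1.1 + 1 / p.1.2 + 2) :=
    continuous_const.div ((c2.add c1).add continuous_const) hs
  have c5 : Continuous fun p : ParamSet => (1 / (p.1.2 + 2) - 2) / (p.1.1 - 1) :=
    (c3.sub continuous_const).div (hd.sub continuous_const) hd1
  have c6 : Continuous fun p : ParamSet => p.1.1 * (1 / (p.1.2 + 2) - 2) / (p.1.1 - 1) :=
    (hd.mul (c3.sub continuous_const)).div (hd.sub continuous_const) hd1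
  have k : ∀ a : ℝ, Continuous fun _ : ParamSet => a := fun a => continuous_const
  refine Continuous.prodMk (continuous_pi fun i => ?_) (continuous_pi fun i => continuous_pi fun j => ?_)
  · fin_cases i
    · exact continuous_const
    · exact continuous_const
    · exact continuous_const
    · exact continuous_const
    · exact continuous_const
    · exact (continuous_const.add (hd.smul continuous_const)).add continuous_const
  · fin_cases i <;> fin_cases j
    exacts [k 2, k 0, k 0, k 0, k 0, k 2, k 0, (k (-2)).mul hd, k 0, k 0, k 2, hx,
      k 0, c2, c1, k 2, c6.add c4, c5, c3, c4, k (-2), k 0, k (-2), k 0]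

theorem continuous_modelClass : Continuous modelClass := by
  refine continuous_induced_rng.2 ?_
  have : Phi exG ∘ modelClass = fun p : ParamSet => Quotient.mk (pairSetoid 6) (modelPair p) :=
    funext Phi_modelClass
  rw [this]
  exact continuous_quotient_mk'.comp continuous_modelPair

/-- The deformation space is parametrized by `ParamSet`. -/
noncomputable def defSpaceHomeo : ParamSet ≃ₜ DefSpace exG where
  toFun := modelClass
  invFun c := ⟨defParams c, defParams_mem c⟩
  left_inv p := Subtype.ext (defParams_modelClass p)
  right_inv c := by
    obtain ⟨p, rfl⟩ := exists_modelClass_eq c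
    congr 1
    exact Subtype.ext (defParams_modelClass p)
  continuous_toFun := continuous_modelClass
  continuous_invFun := continuous_defParams.subtype_mk _

/-! ### Projective equivalences between the model polytopes -/

theorem smul_mem_cone_of_smul_eq {d d' : ℝ} {B : SLpm} (hB : B • polytope d = polytope d') {x : V}
    (hx : x ≠ 0) (h : ∀ i, 0 ≤ beta d i x) (i : Fin 6) : 0 ≤ beta d' i (B • x) := by
  have : rayOf (B • x) (smul_ne_zero_of_SLpm B hx) ∈ polytope d' := by
    rw [← hB, ← smul_rayOf B hx]
    exact Set.smul_mem_smul_set ((rayOf_mem_polytope d hx).2 h)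
  exact (rayOf_mem_polytope d' _).1 this i

/-- A projective equivalence maps vertices to vertices. -/
theorem exists_vertex_image {d d' : ℝ} (hd : 1 < d) (hd' : 1 < d') {B : SLpm}
    (hB : B • polytope d = polytope d') (v : Fin 6) :
    ∃ (u : Fin 6) (t : ℝ), 0 < t ∧ B • vert d v = t • vert d' u := by
  have hB' : B⁻¹ • polytope d' = polytope d := by rw [← hB, inv_smul_smul]
  obtain ⟨c, hc, h⟩ := exists_nonneg_comb hd' (y := B • vert d v) fun i =>
    smul_mem_cone_of_smul_eq hB (vert_ne_zero d v) (fun i => (incident_beta_vert hd).nonneg i v) i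
  have hf : exG.IsFaceOfDim {v} 0 := ⟨v, rfl⟩
  have hcomb : ∀ u, ∃ e : Fin 6 → ℝ, (∀ a, 0 ≤ e a) ∧ B⁻¹ • vert d' u = ∑ a, e a • vert d a :=
    fun u => exists_nonneg_comb hd fun i => smul_mem_cone_of_smul_eq hB' (vert_ne_zero d' u)
      (fun i => (incident_beta_vert hd').nonneg i u) i
  have hnn : ∀ u, 0 ≤ faceFun d {v} (B⁻¹ • vert d' u) := by
    intro u
    obtain ⟨e, he, h⟩ := hcomb u
    rw [h, map_sum]
    refine Finset.sum_nonneg fun a _ => ?_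
    rw [map_smul, smul_eq_mul]
    exact mul_nonneg (he a) (faceFun_vert_nonneg hd {v} a)
  obtain ⟨u, hu⟩ : ∃ u, c u ≠ 0 := by
    by_contra hcon
    push Not at hcon
    refine smul_ne_zero_of_SLpm B (vert_ne_zero d v) (h.trans ?_)
    exact Finset.sum_eq_zero fun u _ => by rw [hcon u, zero_smul]
  -- The vertex `v` is a nonnegative combination of the vectors `B⁻¹ • vert d' u`. A nonnegative
  -- functional vanishing at `v` vanishes at each of them with nonzero coefficient, and in the cone
  -- it vanishes only on the ray of `v`.
  have hz : faceFun d {v} (B⁻¹ • vert d' u) = 0 := by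
    have e := (faceFun_vert_eq_zero_iff hd hf v).2 (Finset.mem_singleton_self v)
    rw [← inv_smul_smul B (vert d v), h, Finset.smul_sum, map_sum] at e
    simp only [smul_comm B⁻¹, map_smul, smul_eq_mul] at e
    have := (Finset.sum_eq_zero_iff_of_nonneg fun u _ => mul_nonneg (hc u) (hnn u)).1 e u
      (Finset.mem_univ u)
    exact (mul_eq_zero.1 this).resolve_left hu
  obtain ⟨e, he, h'⟩ := hcomb u
  rw [h', map_sum] at hz
  simp only [map_smul, smul_eq_mul] at hz
  rw [Finset.sum_eq_zero_iff_of_nonneg fun a _ =>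
    mul_nonneg (he a) (faceFun_vert_nonneg hd {v} a)] at hz
  have hsum : ∑ a, e a • vert d a = e v • vert d v := by
    refine Finset.sum_eq_single v (fun a _ hav => ?_) fun hv => absurd (Finset.mem_univ v) hv
    rcases mul_eq_zero.1 (hz a (Finset.mem_univ a)) with h | h
    · rw [h, zero_smul]
    · exact absurd (Finset.mem_singleton.1 ((faceFun_vert_eq_zero_iff hd hf a).1 h)) hav
  rw [hsum] at h'
  have hev : 0 < e v := by
    refine lt_of_le_of_ne (he v) fun h0 => ?_
    rw [← h0, zero_smul] at h'
    exact smul_ne_zero_of_SLpm B⁻¹ (vert_ne_zero d' u) h'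
  refine ⟨u, (e v)⁻¹, inv_pos.2 hev, ?_⟩
  rw [inv_smul_eq_iff, smul_comm] at h'
  rw [h', smul_smul, inv_mul_cancel₀ hev.ne', one_smul]

theorem pvert_injective {d : ℝ} (hd : 1 < d) : Function.Injective (pvert d) := by
  intro a b hab
  have := (pvert_mem_convHull_iff hd {b} b).2 (Finset.mem_singleton_self b)
  rw [← hab, pvert_mem_convHull_iff hd] at this
  exact Finset.mem_singleton.1 this

/-- The composition of a functional with an element of `SL±(4, ℝ)`. -/
noncomputable def compSLpm (α : StrongDual ℝ V) (B : SLpm) : StrongDual ℝ V :=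
  LinearMap.toContinuousLinearMap (α.toLinearMap ∘ₗ (B.1 : V →ₗ[ℝ] V))

theorem compSLpm_apply (α : StrongDual ℝ V) (B : SLpm) (x : V) : compSLpm α B x = α (B • x) := rfl

set_option maxRecDepth 20000 in
theorem CircuitClosed.eq_facet : ∀ Z : Finset (Fin 6), CircuitClosed Z →
    (Z.card = 3 → Z = exG.facet 0 ∨ Z = exG.facet 1 ∨ Z = exG.facet 4 ∨ Z = exG.facet 5) ∧
    (Z.card = 4 → Z = exG.facet 2 ∨ Z = exG.facet 3) := by
  decide

/-- The images of the facets under a projective equivalence are facets. -/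
theorem circuitClosed_image {d d' : ℝ} (hd : 1 < d) (hd' : 1 < d') {B : SLpm}
    (hB : B • polytope d = polytope d') {π : Fin 6 → Fin 6} (hπ : Function.Bijective π)
    {t : Fin 6 → ℝ} (ht : ∀ v, 0 < t v) (h : ∀ v, B • vert d v = t v • vert d' (π v)) (i : Fin 6) :
    CircuitClosed ((exG.facet i).image π) := by
  have hB' : B⁻¹ • polytope d' = polytope d := by rw [← hB, inv_smul_smul]
  refine circuitClosed_zeroSet hd' (α := compSLpm (beta d i) B⁻¹) (fun u => ?_) fun u => ?_
  · exact smul_mem_cone_of_smul_eq hB' (vert_ne_zero d' u)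
      (fun i => (incident_beta_vert hd').nonneg i u) i
  · obtain ⟨v, rfl⟩ := hπ.2 u
    rw [compSLpm_apply, Finset.mem_image]
    have e : B⁻¹ • vert d' (π v) = (t v)⁻¹ • vert d v := by
      rw [inv_smul_eq_iff, smul_comm, h, smul_smul, inv_mul_cancel₀ (ht v).ne', one_smul]
    rw [e, map_smul, smul_eq_mul, mul_eq_zero, or_iff_right (inv_pos.2 (ht v)).ne',
      (incident_beta_vert hd).eq_zero_iff]
    exact ⟨fun hv => ⟨v, hv, rfl⟩, fun ⟨a, ha, hav⟩ => hπ.1 hav ▸ ha⟩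

/-- The three points lie on a common triangle of the boundary of `exG`. -/
def IsTriangle (a b c : Fin 6) : Prop :=
  (a ∈ exG.facet 0 ∧ b ∈ exG.facet 0 ∧ c ∈ exG.facet 0) ∨
  (a ∈ exG.facet 1 ∧ b ∈ exG.facet 1 ∧ c ∈ exG.facet 1) ∨
  (a ∈ exG.facet 4 ∧ b ∈ exG.facet 4 ∧ c ∈ exG.facet 4) ∨
  (a ∈ exG.facet 5 ∧ b ∈ exG.facet 5 ∧ c ∈ exG.facet 5)

instance (a b c : Fin 6) : Decidable (IsTriangle a b c) := inferInstanceAs (Decidable (_ ∨ _))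

/-- The four points lie on a common quadrilateral of the boundary of `exG`. -/
def IsQuadrilateral (a b c e : Fin 6) : Prop :=
  (a ∈ exG.facet 2 ∧ b ∈ exG.facet 2 ∧ c ∈ exG.facet 2 ∧ e ∈ exG.facet 2) ∨
  (a ∈ exG.facet 3 ∧ b ∈ exG.facet 3 ∧ c ∈ exG.facet 3 ∧ e ∈ exG.facet 3)

instance (a b c e : Fin 6) : Decidable (IsQuadrilateral a b c e) :=
  inferInstanceAs (Decidable (_ ∨ _))

set_option maxRecDepth 20000 in
set_option synthInstance.maxSize 1000 in
set_option synthInstance.maxHeartbeats 400000 in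
/-- The combinatorial automorphisms of `exG`. -/
theorem automorphism_cases : ∀ a b : Fin 6, a ≠ b → ∀ c, c ≠ a → c ≠ b → ∀ e, e ≠ a → e ≠ b →
    e ≠ c → IsQuadrilateral a b c e → ∀ f, f ≠ a → f ≠ b → f ≠ c → f ≠ e →
    IsTriangle a b f → IsTriangle b e f → ∀ g, g ≠ a → g ≠ b → g ≠ c → g ≠ e → g ≠ f →
    IsQuadrilateral a c f g → IsTriangle c e g → IsTriangle e f g →
    (a = 0 ∧ f = 1 ∧ b = 2 ∧ c = 3 ∧ g = 4 ∧ e = 5) ∨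
    (a = 3 ∧ f = 5 ∧ b = 4 ∧ c = 0 ∧ g = 2 ∧ e = 1) := by
  decide

theorem isTriangle_of_image {π : Fin 6 → Fin 6} (hπ : Function.Injective π) {i : Fin 6}
    (hi : CircuitClosed ((exG.facet i).image π)) (h3 : (exG.facet i).card = 3) {a b c : Fin 6}
    (ha : a ∈ exG.facet i) (hb : b ∈ exG.facet i) (hc : c ∈ exG.facet i) :
    IsTriangle (π a) (π b) (π c) := by
  have ma := Finset.mem_image_of_mem π ha
  have mb := Finset.mem_image_of_mem π hb
  have mc := Finset.mem_image_of_mem π hc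
  rcases (CircuitClosed.eq_facet _ hi).1 ((Finset.card_image_of_injective _ hπ).trans h3) with
    h | h | h | h <;> rw [h] at ma mb mc
  · exact Or.inl ⟨ma, mb, mc⟩
  · exact Or.inr (Or.inl ⟨ma, mb, mc⟩)
  · exact Or.inr (Or.inr (Or.inl ⟨ma, mb, mc⟩))
  · exact Or.inr (Or.inr (Or.inr ⟨ma, mb, mc⟩))

theorem isQuadrilateral_of_image {π : Fin 6 → Fin 6} (hπ : Function.Injective π) {i : Fin 6}
    (hi : CircuitClosed ((exG.facet i).image π)) (h4 : (exG.facet i).card = 4) {a b c e : Fin 6}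
    (ha : a ∈ exG.facet i) (hb : b ∈ exG.facet i) (hc : c ∈ exG.facet i) (he : e ∈ exG.facet i) :
    IsQuadrilateral (π a) (π b) (π c) (π e) := by
  have ma := Finset.mem_image_of_mem π ha
  have mb := Finset.mem_image_of_mem π hb
  have mc := Finset.mem_image_of_mem π hc
  have me := Finset.mem_image_of_mem π he
  rcases (CircuitClosed.eq_facet _ hi).2 ((Finset.card_image_of_injective _ hπ).trans h4) with
    h | h <;> rw [h] at ma mb mc me
  · exact Or.inl ⟨ma, mb, mc, me⟩
  · exact Or.inr ⟨ma, mb, mc, me⟩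

/-- Projectively equivalent model polytopes have the same parameter. -/
theorem eq_of_smul_polytope_eq {d d' : ℝ} (hd : 1 < d) (hd' : 1 < d') {B : SLpm}
    (hB : B • polytope d = polytope d') : d = d' := by
  choose π t ht h using exists_vertex_image hd hd' hB
  have hinj : Function.Injective π := by
    intro a b hab
    refine pvert_injective hd ((smul_left_cancel_iff B).1 ?_)
    have key : ∀ v, B • pvert d v = pvert d' (π v) := fun v => by
      rw [smul_rayOf]
      exact ((rayOf_eq_iff _ _).2 ⟨t v, ht v, h v⟩).symm
    rw [key, key, hab]
  have hC := circuitClosed_image hd hd' hB (Finite.injective_iff_bijective.1 hinj) ht h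
  have hne : ∀ {a b : Fin 6}, a ≠ b → π a ≠ π b := fun hab => hinj.ne hab
  have hcases := automorphism_cases (π 0) (π 2) (hne (by decide)) (π 3) (hne (by decide))
    (hne (by decide)) (π 5) (hne (by decide)) (hne (by decide)) (hne (by decide))
    (isQuadrilateral_of_image hinj (hC 2) (by decide) (by decide) (by decide) (by decide)
      (by decide)) (π 1) (hne (by decide)) (hne (by decide)) (hne (by decide)) (hne (by decide))
    (isTriangle_of_image hinj (hC 0) (by decide) (by decide) (by decide) (by decide))
    (isTriangle_of_image hinj (hC 1) (by decide) (by decide) (by decide) (by decide))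
    (π 4) (hne (by decide)) (hne (by decide)) (hne (by decide)) (hne (by decide)) (hne (by decide))
    (isQuadrilateral_of_image hinj (hC 3) (by decide) (by decide) (by decide) (by decide)
      (by decide))
    (isTriangle_of_image hinj (hC 4) (by decide) (by decide) (by decide) (by decide))
    (isTriangle_of_image hinj (hC 5) (by decide) (by decide) (by decide) (by decide))
  -- The linear dependences of the vertices of the first polytope, transported by `B`. Coordinates 0
  -- and 1 suffice to compare them with those of the second.
  have hrel : ∀ k : Fin 4, t 0 * vert d' (π 0) k + t 5 * vert d' (π 5) k
      = t 2 * vert d' (π 2) k + t 3 * vert d' (π 3) k ∧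
      (d - 1) * (t 0 * vert d' (π 0) k) + t 4 * vert d' (π 4) k
      = (d - 1) * (t 1 * vert d' (π 1) k) + d * (t 3 * vert d' (π 3) k) := by
    intro k
    have := vert_relation d (compSLpm (coord k) B)
    simp only [compSLpm_apply, h] at this
    exact this
  obtain ⟨r0, s0⟩ := hrel 0
  obtain ⟨r1, s1⟩ := hrel 1
  -- Either `π` is the identity, or it is the involution exchanging 0 with 3, 1 with 5 and 2 with 4.
  -- The second automorphism also preserves the parameter.
  rcases hcases with ⟨e0, e1, e2, e3, e4, e5⟩ | ⟨e0, e1, e2, e3, e4, e5⟩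
  · rw [e0, e2, e3, e5] at r0 r1
    rw [e0, e1, e3, e4] at s0 s1
    simp [vert] at r0 r1 s0 s1
    have h43 : t 4 = t 3 := by
      rw [r1] at s1
      linarith
    rw [h43, mul_comm] at s0
    exact (mul_right_cancel₀ (ht 3).ne' s0).symm
  · rw [e0, e2, e3, e5] at r0 r1
    rw [e0, e1, e3, e4] at s0 s1
    simp [vert] at r0 r1 s0 s1
    have e : t 2 * (d - d') = 0 := by
      linear_combination s1 + r0 - d * r1
    have := (mul_eq_zero.1 e).resolve_left (ht 2).ne'
    linarith

/-! ### The projection to the realization space -/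

/-- A reflection changes the sign of `α`, while a fixed ray is only scaled by a positive factor.
Fixed points on the sphere therefore encode incidence with walls. -/
theorem IsRefl.smul_rayOf_eq_iff {r : SLpm} {α : StrongDual ℝ V} {v : V} (h : IsRefl r α v) {x : V}
    (hx : x ≠ 0) : r • rayOf x hx = rayOf x hx ↔ α x = 0 := by
  rw [smul_rayOf, rayOf_eq_iff]
  constructor
  · rintro ⟨t, ht, e⟩
    have := congrArg α e
    rw [map_smul, h.apply_self, smul_eq_mul] at this
    have e2 : (1 + t) * α x = 0 := by linarith
    exact (mul_eq_zero.1 e2).resolve_left (by linarith)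
  · intro h0
    exact ⟨1, one_pos, by rw [one_smul, h.2, h0, zero_smul, sub_zero]⟩

theorem projectsTo_modelClass (p : ParamSet) :
    ProjectsTo (modelClass p) (realizationClass ⟨p.1.1, p.2.1⟩) := by
  refine ⟨modelCoxeter p.2, stdRealization p.2.1, rfl, rfl, convHull_range_pvert p.2.1,
    fun v j => ?_⟩
  rw [← (incident_beta_vert p.2.1).eq_zero_iff]
  exact ((isRefl_modelReflections p.2 j).smul_rayOf_eq_iff (vert_ne_zero _ v)).symm

/-- After moving to the model, each `p_v` is a point of `polytope d` lying on precisely the walls of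
the facets containing `v`, and `eq_smul_vert` shows that only one point does so. -/
theorem ProjectsTo.eq_realizationClass {p : ParamSet} {s : RealizationSpace exG}
    (h : ProjectsTo (modelClass p) s) : s = realizationClass ⟨p.1.1, p.2.1⟩ := by
  obtain ⟨X, q, hX, rfl, hq, hinc⟩ := h
  obtain ⟨g, hP, hr⟩ := Quotient.exact (s := coxeterSetoid exG) hX
  refine mk_eq_mk_stdRealization p.2.1 (g := g) fun v => ?_
  obtain ⟨y, hy, hyv⟩ := exists_rayOf (g • q.1 v)
  have hmem : rayOf y hy ∈ polytope p.1.1 := by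
    have e : polytope p.1.1 = g • X.P := hP
    rw [e, hyv, ← hq]
    refine Set.smul_mem_smul_set ?_
    rw [← Set.image_univ, ← Finset.coe_univ]
    exact mem_convHull_range_self q.1 _ (Finset.mem_univ v)
  have hzero : ∀ j, v ∈ exG.facet j ↔ beta p.1.1 j y = 0 := by
    intro j
    have e : modelReflections p.2 j = g * X.r j * g⁻¹ := hr j
    rw [hinc, ← (isRefl_modelReflections p.2 j).smul_rayOf_eq_iff hy, hyv, e, mul_smul, mul_smul,
      inv_smul_smul, smul_left_cancel_iff]
  rw [rayOf_mem_polytope] at hmem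
  obtain ⟨t, ht, e⟩ := eq_smul_vert (d := p.1.1) (y := y) (v := v) (fun j hj => (hzero j).1 hj)
    fun j hj => lt_of_le_of_ne (hmem j) fun h0 => hj ((hzero j).2 h0.symm)
  rw [← hyv]
  exact ((rayOf_eq_iff _ _).2 ⟨t, ht, e⟩).symm

/-- Membership in the restricted space allows projective equivalences that ignore the labeling of
the facets, so the forward direction rests on `eq_of_smul_polytope_eq`. -/
theorem modelClass_mem_restricted_iff {d : ℝ} (hd : 1 < d) (p : ParamSet) :
    modelClass p ∈ restricted exG (polytope d) ↔ p.1.1 = d := by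
  constructor
  · rintro ⟨X, hX, A, hA⟩
    obtain ⟨g, hP, -⟩ := Quotient.exact (s := coxeterSetoid exG) hX
    have e : polytope p.1.1 = g • X.P := hP
    rw [← hA, ← mul_smul] at e
    exact (eq_of_smul_polytope_eq hd p.2.1 e.symm).symm
  · rintro rfl
    exact ⟨modelCoxeter p.2, rfl, 1, one_smul _ _⟩

theorem ParamSet.lt_of_mem {p : ℝ × ℝ} (hp : p ∈ ParamSet) : p.1 < 4 / 3 := by
  obtain ⟨h1, h2, h3⟩ := hp
  have := h2.trans h3
  rw [div_lt_iff_of_neg (by linarith)] at this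
  linarith

/-- Multiplying by the negative number `2 - 2 * d` turns the inequality into `4 * (d - 1) < d`. -/
theorem lowerBound_lt {d : ℝ} (hd : 1 < d) (h : d < 4 / 3) : d / (2 - 2 * d) < -2 := by
  rw [div_lt_iff_of_neg (by linarith)]
  linarith

theorem restricted_nonempty_iff {d : ℝ} (hd : 1 < d) :
    (restricted exG (polytope d)).Nonempty ↔ d < 4 / 3 := by
  constructor
  · rintro ⟨c, hc⟩
    obtain ⟨p, rfl⟩ := exists_modelClass_eq c
    rw [modelClass_mem_restricted_iff hd] at hc
    rw [← hc]
    exact ParamSet.lt_of_mem p.2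
  · intro h
    obtain ⟨x, hx⟩ := exists_between (lowerBound_lt hd h)
    exact ⟨modelClass ⟨(d, x), hd, hx⟩, (modelClass_mem_restricted_iff hd _).2 rfl⟩

/-- The restricted deformation space of `P_d` is an open interval. -/
noncomputable def restrictedHomeo {d : ℝ} (hd : 1 < d) :
    Set.Ioo (d / (2 - 2 * d)) (-2) ≃ₜ restricted exG (polytope d) where
  toFun x := ⟨modelClass ⟨(d, x), hd, x.2⟩, (modelClass_mem_restricted_iff hd _).2 rfl⟩
  invFun c := ⟨secondParam c, by
    obtain ⟨c, hc⟩ := c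
    obtain ⟨p, rfl⟩ := exists_modelClass_eq c
    rw [modelClass_mem_restricted_iff hd] at hc
    rw [secondParam_modelClass, ← hc]
    exact p.2.2⟩
  left_inv x := Subtype.ext (secondParam_modelClass _)
  right_inv c := by
    obtain ⟨c, hc⟩ := c
    obtain ⟨p, rfl⟩ := exists_modelClass_eq c
    refine Subtype.ext (congrArg modelClass (Subtype.ext (Prod.ext ?_ (secondParam_modelClass p))))
    exact ((modelClass_mem_restricted_iff hd p).1 hc).symm
  continuous_toFun := by
    refine Continuous.subtype_mk (continuous_modelClass.comp (Continuous.subtype_mk ?_ _)) _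
    exact continuous_const.prodMk continuous_subtype_val
  continuous_invFun :=
    Continuous.subtype_mk (continuous_secondParam.comp continuous_subtype_val) _

/-! ### The parameter set is a plane -/

/-- A parametrization of the open interval `(l, u)` by the real line. -/
noncomputable def squash (l u t : ℝ) : ℝ := (l + u * Real.exp t) / (1 + Real.exp t)

/-- The inverse of the parametrization of the open interval `(l, u)`. -/
noncomputable def unsquash (l u y : ℝ) : ℝ := Real.log ((y - l) / (u - y))

theorem squash_mem {l u : ℝ} (h : l < u) (t : ℝ) : l < squash l u t ∧ squash l u t < u := by
  have := Real.exp_pos t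
  rw [squash, lt_div_iff₀ (by positivity), div_lt_iff₀ (by positivity)]
  constructor <;> nlinarith

theorem unsquash_squash {l u : ℝ} (h : l < u) (t : ℝ) : unsquash l u (squash l u t) = t := by
  have he := Real.exp_pos t
  have h1 : (1 + Real.exp t) ≠ 0 := by positivity
  have hul : u - l ≠ 0 := by linarith
  have e1 : squash l u t - l = (u - l) * Real.exp t / (1 + Real.exp t) := by
    rw [squash]; field_simp; ring
  have e2 : u - squash l u t = (u - l) / (1 + Real.exp t) := by
    rw [squash]; field_simp; ring
  have e3 : (squash l u t - l) / (u - squash l u t) = Real.exp t := by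
    rw [e1, e2]; field_simp
  rw [unsquash, e3, Real.log_exp]

theorem squash_unsquash {l u y : ℝ} (h1 : l < y) (h2 : y < u) : squash l u (unsquash l u y) = y := by
  have e1 : 0 < y - l := by linarith
  have e2 : 0 < u - y := by linarith
  rw [squash, unsquash, Real.exp_log (div_pos e1 e2)]
  have : u - l ≠ 0 := by linarith
  have h3 : 1 + (y - l) / (u - y) = (u - l) / (u - y) := by field_simp; ring
  rw [h3]
  field_simp
  ring

theorem continuous_squash : Continuous fun p : ℝ × ℝ × ℝ => squash p.1 p.2.1 p.2.2 := by
  unfold squash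
  refine Continuous.div (by fun_prop) (by fun_prop) fun p => ?_
  have := Real.exp_pos p.2.2
  positivity

/-- The parameter set is homeomorphic to the plane. -/
noncomputable def paramHomeo : ParamSet ≃ₜ ℝ × ℝ where
  -- The map is triangular: `d` is straightened by itself, and then the interval of admissible `x`
  -- over that `d`.
  toFun p := (unsquash 1 (4 / 3) p.1.1, unsquash (p.1.1 / (2 - 2 * p.1.1)) (-2) p.1.2)
  invFun q := ⟨(squash 1 (4 / 3) q.1,
      squash (squash 1 (4 / 3) q.1 / (2 - 2 * squash 1 (4 / 3) q.1)) (-2) q.2), by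
    obtain ⟨h1, h2⟩ := squash_mem (show (1 : ℝ) < 4 / 3 by norm_num) q.1
    exact ⟨h1, squash_mem (lowerBound_lt h1 h2) q.2⟩⟩
  left_inv p := by
    have h := squash_unsquash p.2.1 (ParamSet.lt_of_mem p.2)
    refine Subtype.ext (Prod.ext h ?_)
    dsimp only
    rw [h]
    exact squash_unsquash p.2.2.1 p.2.2.2
  right_inv q := by
    have hlt : (1 : ℝ) < 4 / 3 := by norm_num
    obtain ⟨h1, h2⟩ := squash_mem hlt q.1
    exact Prod.ext (unsquash_squash hlt q.1) (unsquash_squash (lowerBound_lt h1 h2) q.2)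
  continuous_toFun := by
    have hd : Continuous fun p : ParamSet => p.1.1 := continuous_fst.comp continuous_subtype_val
    have hx : Continuous fun p : ParamSet => p.1.2 := continuous_snd.comp continuous_subtype_val
    have hl : Continuous fun p : ParamSet => p.1.1 / (2 - 2 * p.1.1) :=
      hd.div (continuous_const.sub (continuous_const.mul hd)) fun p => by
        have := p.2.1
        linarith
    unfold unsquash
    refine Continuous.prodMk (Continuous.log (Continuous.div (by fun_prop) (by fun_prop) ?_) ?_)
      (Continuous.log (Continuous.div (by fun_prop) (by fun_prop) ?_) ?_)
    · intro p
      have := ParamSet.lt_of_mem p.2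
      linarith
    · intro p
      have h1 := ParamSet.lt_of_mem p.2
      have h2 := p.2.1
      exact (div_pos (by linarith) (by linarith)).ne'
    · intro p
      have := p.2.2.2
      linarith
    · intro p
      have h1 := p.2.2.1
      have h2 := p.2.2.2
      exact (div_pos (by linarith) (by linarith)).ne'
  continuous_invFun := by
    have h1 : Continuous fun q : ℝ × ℝ => squash 1 (4 / 3) q.1 :=
      continuous_squash.comp
        (continuous_const.prodMk (continuous_const.prodMk continuous_fst))
    refine Continuous.subtype_mk (h1.prodMk ?_) _
    refine continuous_squash.comp (Continuous.prodMk (h1.div (by fun_prop) fun q => ?_)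
      (continuous_const.prodMk continuous_snd))
    have := (squash_mem (show (1 : ℝ) < 4 / 3 by norm_num) q.1).1
    linarith

theorem nonempty_homeomorph_plane : Nonempty (DefSpace exG ≃ₜ EuclideanSpace ℝ (Fin 2)) := by
  have e : (ℝ × ℝ) ≃L[ℝ] EuclideanSpace ℝ (Fin 2) :=
    ContinuousLinearEquiv.ofFinrankEq (by simp)
  exact ⟨(defSpaceHomeo.symm.trans paramHomeo).trans e.toHomeomorph⟩

theorem exG_orderable : exG.Orderable := by
  refine ⟨1, ?_⟩
  decide

end CoxDef

/-! ### The main theorem -/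

open CoxDef
theorem mainTheorem3 :
    -- `f = 6`, `e = 10`, `e₂ = 7`, and the labeled polytope is orderable
    (exG.edges.card = 10 ∧ exG.edgesOrderTwo.card = 7 ∧ exG.Orderable) ∧
    -- the realization space is an open interval, parametrized by `d`
    (∃ h : Set.Ioi (1 : ℝ) ≃ₜ RealizationSpace exG,
      (∀ d : Set.Ioi (1 : ℝ), ∃ p : PreRS exG, h d = Quotient.mk _ p ∧
        convHull (Set.range p.1) = polytope d ∧
        ∀ v i, v ∈ exG.facet i ↔ p.1 v ∈ sph {x | beta d i x = 0}) ∧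
      -- the restricted deformation spaces are the fibers of the projection to the realization space
      (∀ c : DefSpace exG, ∃! s, ProjectsTo c s) ∧
      ∀ (d : Set.Ioi (1 : ℝ)) (c : DefSpace exG),
        c ∈ restricted exG (polytope d) ↔ ProjectsTo c (h d)) ∧
    -- the restricted deformation spaces are nonempty exactly for `1 < d < 4 / 3`
    (∀ d : ℝ, 1 < d → ((restricted exG (polytope d)).Nonempty ↔ d < 4 / 3)) ∧
    -- in that case they are open intervals, parametrized by `x`
    (∀ d : ℝ, 1 < d → d < 4 / 3 →
      d / (2 - 2 * d) < -2 ∧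
      ∃ h : Set.Ioo (d / (2 - 2 * d)) (-2) ≃ₜ restricted exG (polytope d),
        ∀ x : Set.Ioo (d / (2 - 2 * d)) (-2), ∃ X : CoxeterPolytope exG,
          (h x : DefSpace exG) = DefSpace.mk X ∧ X.P = polytope d ∧
          ∀ i, IsReflectionWith (polytope d) (X.r i) (beta d i) (w d x i)) ∧
    Nonempty (DefSpace exG ≃ₜ EuclideanSpace ℝ (Fin 2)) := by
  refine ⟨⟨by decide, by decide, exG_orderable⟩, ⟨realizationHomeo, fun d => ?_, fun c => ?_,
    fun d c => ?_⟩, fun d hd => restricted_nonempty_iff hd, fun d hd hd' =>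
    ⟨lowerBound_lt hd hd', restrictedHomeo hd, fun x => ?_⟩, nonempty_homeomorph_plane⟩
  · refine ⟨stdRealization d.2, rfl, convHull_range_pvert d.2, fun v i => ?_⟩
    rw [← (incident_beta_vert d.2).eq_zero_iff]
    exact (rayOf_mem_sph_zero (beta d i) (vert_ne_zero d v)).symm
  · obtain ⟨p, rfl⟩ := exists_modelClass_eq c
    exact ⟨_, projectsTo_modelClass p, fun s hs => hs.eq_realizationClass⟩
  · obtain ⟨p, rfl⟩ := exists_modelClass_eq c
    rw [modelClass_mem_restricted_iff d.2]
    constructor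
    · intro h
      obtain rfl : (⟨p.1.1, p.2.1⟩ : Set.Ioi (1 : ℝ)) = d := Subtype.ext h
      exact projectsTo_modelClass p
    · intro h
      have e : realizationHomeo d = realizationHomeo ⟨p.1.1, p.2.1⟩ := h.eq_realizationClass
      exact congrArg Subtype.val (realizationHomeo.injective e).symm
  · exact ⟨modelCoxeter (p := (d, x.1)) ⟨hd, x.2⟩, rfl, rfl, fun i =>
      isReflectionWith_model (p := (d, x.1)) ⟨hd, x.2⟩ i⟩
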